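/- **Setting.** Let $S=(l,r)$, $-\infty\le l<r\le\infty$, let $\Theta\subseteq\mathbb R$ and let $\theta_0$ be an interior point of $\Theta$; a subscript $0$ means $\theta=\theta_0$. Assume that for every $\theta\in\Theta$ the process $(X_t)_{t\ge0}$ is, under $\mathbb P_\theta$, an $S$-valued continuous Markov process that is a weak solution of $$dX_t=a(X_t;\theta)\,dt+b(X_t;\theta)\,dB_t,\qquad X_0\sim\mu_\theta,$$ and is stationary and $\rho$-mixing (the maximal correlation of $\sigma(X_0)$ and $\sigma(X_t)$ tends to $0$ as $t\to\infty$). Assume moreover that $a$ and $b$ are continuous in $\theta$ and $C^2$ in $x\in S$, with $x$-derivatives of order $\le 2$ of polynomial growth in $x$; that $|a(x;\theta)|+|b(x;\theta)|\le C_\theta(1+|x|)$ and $b(x;\theta)>0$ on $S$; and that $\int|x|^k\,d\mu_\theta<\infty$ for all $k\ge1$. Let $P_t^\theta g(x)=\mathbb E_\theta[g(X_t)\mid X_0=x]$ on $L^2(\mu_\theta)$, let $\mathcal A_\theta$ be the $L^2(\mu_\theta)$-generator of this semigroup and let $U_\theta(g)=\int_0^\infty P_t^\theta g\,dt$. A number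 $\lambda>0$ is called a spectral gap of $(X_t)$ under $\mathbb P_0$ if the spectrum of $\mathcal A_{\theta_0}$ (the set of real $z$ such that $z-\mathcal A_{\theta_0}$ has no bounded everywhere defined inverse) is contained in $(-\infty,-\lambda]\cup\{0\}$. Let $f:S\to\mathbb R$, write $\mu_\theta(f)=\int f\,d\mu_\theta$ and $f^*=f-\mu_0(f)$. Assume that $f^*$ and $U_0(f^*)$ are $C^2$ on $S$ with derivatives of order $\le2$ of polynomial growth, that $\theta\mapsto\mu_\theta(f)$ is $C^1$ on $\Theta$, and that $\partial_\theta\mu_{\theta_0}(f)\ne0$. The asymptotic variance of the estimators $\hat\theta_n$ that solve $G_n(\theta)=\sum_{i=1}^n[f(X_{i\Delta_n})-\mu_\theta(f)]=0$ is $$\mathrm{AVAR}(\hat\theta_n)=\frac{2\,\mu_0\big(f^*\,U_0(f^*)\big)}{[\partial_\theta\mu_{\theta_0}(f)]^2}.$$ **Proposition 5.1.** There is a spectral gap under $\mathbb P_0$, the integral defining $U_0(f^*)$ converges in $L^2(\mu_0)$, and for every spectral gap $\lambda_0$ under $\mathbb P_0$ (in particular for the largest one) $$\mathrm{AVAR}(\hat\theta_n)\le\frac{2\,\mathrm{Var}_0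 f(X_0)}{\lambda_0\,[\partial_\theta\mu_{\theta_0}(f)]^2}.$$ The same bound holds for the variance $v$ of every normal limit law: if $\Delta_n>0$, $\Delta_n\to0$, $n\Delta_n\to\infty$, if $\hat\theta_n$ are $\Theta$-valued estimators with $\mathbb P_0(G_n(\hat\theta_n)=0)\to1$ and $\hat\theta_n\to\theta_0$ in $\mathbb P_0$-probability, and if $\sqrt{n\Delta_n}(\hat\theta_n-\theta_0)\to\mathcal N(0,v)$ in distribution under $\mathbb P_0$, then $v\le 2\,\mathrm{Var}_0 f(X_0)/(\lambda_0[\partial_\theta\mu_{\theta_0}(f)]^2)$. The bound is attained for the estimation of the mean of an Ornstein–Uhlenbeck process: if $S=\mathbb R$, $a(x;\theta)=\kappa(\theta-x)$ and $b(x;\theta)=\xi$ with known $\kappa,\xi>0$, then $f(x)=x$ satisfies all the conditions above, the largest spectral gap is $\lambda_0=\kappa$, and $$\mathrm{AVAR}(\hat\theta_n)=\frac{2\,\mathrm{Var}_0 f(X_0)}{\kappa\,[\partial_\theta\mu_{\theta_0}(f)]^2}=\Big(\frac{\xi}{\kappa}\Big)^2.$$ -/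

import Mathlib

open MeasureTheory ProbabilityTheory Filter Set Topology
open scoped NNReal ENNReal

noncomputable section

namespace Diffusion

/-! ### One-parameter semigroups of operators: generator, spectrum, spectral gap -/

section Semigroup

variable {E : Type*} [NormedAddCommGroup E] [NormedSpace ℝ E]

/-- `F` belongs to the domain of the infinitesimal generator `A` of the family `T`, and `A F = G`:
the difference quotients `(T_t F - F) / t` converge to `G` in norm as `t ↓ 0`. -/
def HasGenerator (T : ℝ≥0 → E →L[ℝ] E) (F G : E) : Prop :=
  Tendsto (fun t : ℝ≥0 => (t : ℝ)⁻¹ • (T t F - F)) (𝓝[>] 0) (𝓝 G)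

/-- The resolvent set of the generator `A` of `T`: the real `z` for which `z - A` is a bijection
from the domain of `A` onto `E` with a bounded inverse `R`. -/
def generatorResolventSet (T : ℝ≥0 → E →L[ℝ] E) : Set ℝ :=
  {z | ∃ R : E →L[ℝ] E, (∀ G, HasGenerator T (R G) (z • R G - G)) ∧
    ∀ F G, HasGenerator T F G → R (z • F - G) = F}

/-- The spectrum of the (in general unbounded) generator of `T`. -/
def generatorSpectrum (T : ℝ≥0 → E →L[ℝ] E) : Set ℝ := (generatorResolventSet T)ᶜ

/-- `lam > 0` is a spectral gap of the generator of `T`: the spectrum is contained in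
`(-∞, -lam] ∪ {0}`. -/
def IsSpectralGap (T : ℝ≥0 → E →L[ℝ] E) (lam : ℝ) : Prop :=
  0 < lam ∧ generatorSpectrum T ⊆ Iic (-lam) ∪ {0}

end Semigroup

/-! ### Function classes -/

/-- The open interval `(l, r)` of the real line, `-∞ ≤ l`, `r ≤ ∞`. -/
def openInterval (l r : EReal) : Set ℝ := {x | l < (x : EReal) ∧ (x : EReal) < r}

/-- Polynomial growth on `S`. -/
def PolyGrowth (S : Set ℝ) (g : ℝ → ℝ) : Prop :=
  ∃ C : ℝ, 0 < C ∧ ∀ x ∈ S, |g x| ≤ C * (1 + |x| ^ C)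

/-- The class `C^j_p(S)`: `j` times continuously differentiable on the open set `S`, with all
derivatives of order at most `j` of polynomial growth. -/
def CPoly (j : ℕ) (S : Set ℝ) (g : ℝ → ℝ) : Prop :=
  ContDiffOn ℝ j g S ∧ ∀ k ≤ j, PolyGrowth S (iteratedDeriv k g)

/-- The class `C^{j,0}_p(S × Θ)` of functions `g x θ`: in `C^j_p(S)` as functions of `x`,
for every `θ ∈ Θ`, and continuous in `θ ∈ Θ`, for every `x ∈ S`. -/
def CPolyParam (j : ℕ) (S Θ : Set ℝ) (g : ℝ → ℝ → ℝ) : Prop :=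
  (∀ θ ∈ Θ, CPoly j S (fun x => g x θ)) ∧ ∀ x ∈ S, ContinuousOn (fun θ => g x θ) Θ

/-! ### Stochastic notions -/

section Stoch

variable {Ω : Type*} [mΩ : MeasurableSpace Ω]

/-- The process `X` is strictly stationary under `P`: all time shifts have the same law on the
path space (with the product σ-algebra). -/
def IsStationary (P : Measure Ω) (X : ℝ≥0 → Ω → ℝ) : Prop :=
  ∀ h : ℝ≥0, P.map (fun ω t => X (t + h) ω) = P.map (fun ω t => X t ω)

/-- The Markov property of `X` with respect to the filtration `ℱ`. -/
def IsMarkov (P : Measure Ω) (ℱ : Filtration ℝ≥0 mΩ) (X : ℝ≥0 → Ω → ℝ) : Prop :=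
  ∀ s t : ℝ≥0, s ≤ t → ∀ g : ℝ → ℝ, Measurable g → (∃ C, ∀ x, |g x| ≤ C) →
    P[fun ω => g (X t ω) | ℱ s]
      =ᵐ[P] P[fun ω => g (X t ω) | MeasurableSpace.comap (X s) inferInstance]

/-- The maximal correlation `ρ(m₁, m₂)` of two σ-algebras: the supremum of the absolute
correlations of square integrable variables measurable with respect to `m₁` and `m₂` (a degenerate
variable is given correlation `0`, by the convention `x / 0 = 0`). -/
def maxCorrelation (P : Measure Ω) (m₁ m₂ : MeasurableSpace Ω) : ℝ :=
  sSup {c | ∃ Y Z : Ω → ℝ, StronglyMeasurable[m₁] Y ∧ StronglyMeasurable[m₂] Z ∧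
    MemLp Y 2 P ∧ MemLp Z 2 P ∧ c = |cov[Y, Z; P]| / (√(Var[Y; P]) * √(Var[Z; P]))}

/-- `ρ`-mixing of a stationary Markov process: `ρ(σ(X_0), σ(X_t)) → 0` as `t → ∞`. -/
def IsRhoMixing (P : Measure Ω) (X : ℝ≥0 → Ω → ℝ) : Prop :=
  Tendsto (fun t : ℝ≥0 => maxCorrelation P (MeasurableSpace.comap (X 0) inferInstance)
    (MeasurableSpace.comap (X t) inferInstance)) atTop (𝓝 0)

/-- The differential operator `L φ = a φ' + (1/2) b² φ''`. -/
def diffOp (a b : ℝ → ℝ) (φ : ℝ → ℝ) (x : ℝ) : ℝ :=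
  a x * deriv φ x + 1 / 2 * b x ^ 2 * iteratedDeriv 2 φ x

/-- `X` is a weak solution of `dX_t = a(X_t) dt + b(X_t) dB_t`, `X_0 ∼ μ`, with state space `S`
(`S` an open interval, `b > 0` on `S`), on the filtered probability space `(Ω, ℱ, P)`: `X` is
adapted with continuous paths in `S`, has initial law `μ`, is a Markov process, and solves the
martingale problem, i.e. `φ(X_t) - ∫_0^t L φ(X_s) ds` is an `ℱ`-martingale for every smooth `φ`
with compact support in `S`.  As `b > 0`, the driving Brownian motion is recovered from `X` as
`B_t = ∫_0^t b(X_s)⁻¹ (dX_s - a(X_s) ds)`. -/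
structure IsWeakSolution (S : Set ℝ) (a b : ℝ → ℝ) (μ : Measure ℝ)
    (P : Measure Ω) (ℱ : Filtration ℝ≥0 mΩ) (X : ℝ≥0 → Ω → ℝ) : Prop where
  adapted : StronglyAdapted ℱ X
  continuous_paths : ∀ ω, Continuous fun t => X t ω
  mem_state : ∀ t ω, X t ω ∈ S
  initial_law : P.map (X 0) = μ
  markov : IsMarkov P ℱ X
  martingale : ∀ φ : ℝ → ℝ, ContDiff ℝ (⊤ : ℕ∞) φ → HasCompactSupport φ → tsupport φ ⊆ S →
    Martingale (fun (t : ℝ≥0) ω =>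
      φ (X t ω) - ∫ s in (0 : ℝ)..t, diffOp a b φ (X s.toNNReal ω)) ℱ P

open Classical in
/-- The operator `F ↦ F(Y)` from `L²(μ)` to `L²(P)`, for a random variable `Y` with law `μ`
under `P` (and the junk value `0` if `Y` does not have law `μ`). -/
def evalOp (P : Measure Ω) (μ : Measure ℝ) (Y : Ω → ℝ) : Lp ℝ 2 μ →L[ℝ] Lp ℝ 2 P :=
  if h : MeasurePreserving Y P μ then
    (Lp.compMeasurePreservingₗᵢ ℝ Y h).toContinuousLinearMap
  else 0

/-- The transition operator `P_t F (x) = E[F(X_t) | X_0 = x]` on `L²(μ)`, for a process all of whose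
marginal laws are `μ`.  The adjoint of `F ↦ F(X_0)` maps `Y ∈ L²(P)` to the function
`x ↦ E[Y | X_0 = x]`; that the composition is the conditional expectation is proved in
`transitionOp_comp_ae_eq_condExp` below. -/
def transitionOp (P : Measure Ω) (μ : Measure ℝ) (X : ℝ≥0 → Ω → ℝ) (t : ℝ≥0) :
    Lp ℝ 2 μ →L[ℝ] Lp ℝ 2 μ :=
  (ContinuousLinearMap.adjoint (evalOp P μ (X 0))).comp (evalOp P μ (X t))

theorem evalOp_ae_eq {P : Measure Ω} {μ : Measure ℝ} {Y : Ω → ℝ} (h : MeasurePreserving Y P μ)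
    (F : Lp ℝ 2 μ) : (evalOp P μ Y F : Ω → ℝ) =ᵐ[P] fun ω => F (Y ω) := by
  unfold evalOp
  rw [dif_pos h]
  exact Lp.coeFn_compMeasurePreserving F h

/-- `(P_t F)(X_0) = E[F(X_t) | X_0]` almost surely. -/
theorem transitionOp_comp_ae_eq_condExp {P : Measure Ω} [IsProbabilityMeasure P] {μ : Measure ℝ}
    {X : ℝ≥0 → Ω → ℝ} (h : ∀ t, MeasurePreserving (X t) P μ) (t : ℝ≥0) (F : Lp ℝ 2 μ) :
    (fun ω => transitionOp P μ X t F (X 0 ω))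
      =ᵐ[P] P[fun ω => F (X t ω) | MeasurableSpace.comap (X 0) inferInstance] := by
  have hm : MeasurableSpace.comap (X 0) inferInstance ≤ mΩ := (h 0).measurable.comap_le
  have hmem : ∀ s : ℝ≥0, ∀ G : Lp ℝ 2 μ, MemLp (fun ω => G (X s ω)) 2 P := fun s G =>
    (Lp.memLp G).comp_measurePreserving (h s)
  have hμ : IsProbabilityMeasure μ := by
    rw [← (h 0).map_eq]
    exact Measure.isProbabilityMeasure_map (h 0).measurable.aemeasurable
  refine ae_eq_condExp_of_forall_setIntegral_eq hm ((hmem t F).integrable one_le_two)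
    (fun s _ _ => ((hmem 0 _).integrable one_le_two).integrableOn) ?_ ?_
  · rintro _ ⟨B, hB, rfl⟩ -
    have hBμ : μ B ≠ ∞ := measure_ne_top μ B
    have hPB : P (X 0 ⁻¹' B) ≠ ∞ := measure_ne_top P _
    have e1 : evalOp P μ (X 0) (indicatorConstLp 2 hB hBμ (1 : ℝ))
        = indicatorConstLp 2 ((h 0).measurable hB) hPB (1 : ℝ) := by
      apply Lp.ext
      refine (evalOp_ae_eq (h 0) _).trans ?_
      have h1 := (h 0).quasiMeasurePreserving.ae
        (indicatorConstLp_coeFn (p := 2) (hs := hB) (hμs := hBμ) (c := (1 : ℝ)))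
      filter_upwards [h1, indicatorConstLp_coeFn (p := 2) (hs := (h 0).measurable hB)
        (hμs := hPB) (c := (1 : ℝ))] with ω h1 h2
      rw [h1, h2]
      rfl
    have e2 : inner ℝ (indicatorConstLp 2 hB hBμ (1 : ℝ)) (transitionOp P μ X t F)
        = inner ℝ (indicatorConstLp 2 ((h 0).measurable hB) hPB (1 : ℝ)) (evalOp P μ (X t) F) := by
      rw [transitionOp, ContinuousLinearMap.comp_apply, ContinuousLinearMap.adjoint_inner_right, e1]
    rw [L2.inner_indicatorConstLp_one, L2.inner_indicatorConstLp_one] at e2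
    rw [setIntegral_congr_ae (g := fun ω => F (X t ω)) ((h 0).measurable hB)
      ((evalOp_ae_eq (h t) F).mono fun _ hω _ => hω)] at e2
    rw [← e2]
    have e3 := setIntegral_map (μ := P) (g := X 0) (f := transitionOp P μ X t F) hB
      (by rw [(h 0).map_eq]; exact Lp.aestronglyMeasurable _) (h 0).measurable.aemeasurable
    rw [(h 0).map_eq] at e3
    exact e3.symm
  · refine StronglyMeasurable.aestronglyMeasurable ?_
    exact (Lp.stronglyMeasurable _).comp_measurable (comap_measurable (X 0))

/-- The class in `L²(μ)` of a square integrable function `g` (and `0` for any other `g`). -/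
def toL2 (μ : Measure ℝ) (g : ℝ → ℝ) : Lp ℝ 2 μ :=
  open Classical in if h : MemLp g 2 μ then h.toLp g else 0

end Stoch

/-! ### Parametric diffusion models -/

/-- The data of a one-parameter family of scalar diffusion models. -/
structure Model (Ω : Type*) [mΩ : MeasurableSpace Ω] where
  /-- left end point of the state space -/
  l : EReal
  /-- right end point of the state space -/
  r : EReal
  /-- parameter set -/
  Θ : Set ℝ
  /-- drift coefficient `a x θ` -/
  a : ℝ → ℝ → ℝ
  /-- diffusion coefficient `b x θ` -/
  b : ℝ → ℝ → ℝ
  /-- invariant distributions -/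
  μ : ℝ → Measure ℝ
  /-- probability measures -/
  P : ℝ → ProbabilityMeasure Ω
  /-- filtration -/
  ℱ : Filtration ℝ≥0 mΩ
  /-- the observed process -/
  X : ℝ≥0 → Ω → ℝ

namespace Model

variable {Ω : Type*} [MeasurableSpace Ω] (M : Model Ω)

/-- The state space `(l, r)`. -/
def S : Set ℝ := openInterval M.l M.r

/-- The standing condition on the diffusion model: for every `θ ∈ Θ` the process is a stationary,
`ρ`-mixing weak solution, and the triplet `(a, b, μ_θ)` is regular. -/
structure Regular : Prop where
  l_lt_r : M.l < M.r
  weak_solution : ∀ θ ∈ M.Θ,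
    IsWeakSolution M.S (fun x => M.a x θ) (fun x => M.b x θ) (M.μ θ) (M.P θ : Measure Ω) M.ℱ M.X
  stationary : ∀ θ ∈ M.Θ, IsStationary (M.P θ : Measure Ω) M.X
  rho_mixing : ∀ θ ∈ M.Θ, IsRhoMixing (M.P θ : Measure Ω) M.X
  drift_smooth : CPolyParam 2 M.S M.Θ M.a
  diffusion_smooth : CPolyParam 2 M.S M.Θ M.b
  linear_growth : ∀ θ ∈ M.Θ, ∃ C : ℝ, 0 < C ∧ ∀ x ∈ M.S, |M.a x θ| + |M.b x θ| ≤ C * (1 + |x|)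
  diffusion_pos : ∀ θ ∈ M.Θ, ∀ x ∈ M.S, 0 < M.b x θ
  moments : ∀ θ ∈ M.Θ, ∀ k : ℕ, 1 ≤ k → Integrable (fun x => |x| ^ k) (M.μ θ)

/-- `κ(θ) = μ_θ(f)`. -/
def mean (f : ℝ → ℝ) (θ : ℝ) : ℝ := ∫ x, f x ∂(M.μ θ)

/-- The transition semigroup `(P_t^θ)` on `L²(μ_θ)`. -/
def semigroup (θ : ℝ) : ℝ≥0 → Lp ℝ 2 (M.μ θ) →L[ℝ] Lp ℝ 2 (M.μ θ) :=
  transitionOp (M.P θ : Measure Ω) (M.μ θ) M.X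

/-- The integral defining the potential `U_θ(g)` converges (absolutely, in `L²(μ_θ)`). -/
def PotentialConverges (θ : ℝ) (g : ℝ → ℝ) : Prop :=
  IntegrableOn (fun t : ℝ => M.semigroup θ t.toNNReal (toL2 (M.μ θ) g)) (Ioi 0)

/-- The potential `U_θ(g) = ∫_0^∞ P_t^θ g dt`, an element of `L²(μ_θ)`. -/
def potential (θ : ℝ) (g : ℝ → ℝ) : Lp ℝ 2 (M.μ θ) :=
  ∫ t in Ioi (0 : ℝ), M.semigroup θ t.toNNReal (toL2 (M.μ θ) g)

/-- The class `ℋ²_θ`: `g ∈ C²_p(S)` with `μ_θ(g) = 0` whose potential `U_θ(g)` belongs to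
`C²_p(S)` (i.e. has a version in this class). -/
def InH2 (θ : ℝ) (g : ℝ → ℝ) : Prop :=
  CPoly 2 M.S g ∧ M.mean g θ = 0 ∧
    ∃ u : ℝ → ℝ, CPoly 2 M.S u ∧ (M.potential θ g : ℝ → ℝ) =ᵐ[M.μ θ] u

/-- `f* = f - μ_{θ₀}(f)`. -/
def centred (f : ℝ → ℝ) (θ₀ : ℝ) : ℝ → ℝ := fun x => f x - M.mean f θ₀

/-- The condition on the predictor function `f`: `f* ∈ ℋ²_{θ₀}` and `θ ↦ μ_θ(f)` is `C¹`. -/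
def PredictorRegular (f : ℝ → ℝ) (θ₀ : ℝ) : Prop :=
  M.InH2 θ₀ (M.centred f θ₀) ∧ ContDiffOn ℝ 1 (M.mean f) M.Θ

/-- The explicit asymptotic variance `2 μ_{θ₀}(f* U_{θ₀}(f*)) / [∂_θ μ_{θ₀}(f)]²` of the estimator
with the simple predictor space. -/
def avar (f : ℝ → ℝ) (θ₀ : ℝ) : ℝ :=
  2 * (∫ x, M.centred f θ₀ x * M.potential θ₀ (M.centred f θ₀) x ∂(M.μ θ₀)) /
    (deriv (M.mean f) θ₀) ^ 2

/-- The upper bound `2 Var_{θ₀} f(X_0) / (lam [∂_θ μ_{θ₀}(f)]²)`. -/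
def avarBound (f : ℝ → ℝ) (θ₀ lam : ℝ) : ℝ :=
  2 * Var[fun ω => f (M.X 0 ω); (M.P θ₀ : Measure Ω)] / (lam * (deriv (M.mean f) θ₀) ^ 2)

/-- The estimating function `G_n(θ) = ∑_{i=1}^n (f(X_{iΔ_n}) - μ_θ(f))`. -/
def estimatingFunction (f : ℝ → ℝ) (Δ : ℕ → ℝ≥0) (n : ℕ) (θ : ℝ) (ω : Ω) : ℝ :=
  ∑ i ∈ Finset.Icc 1 n, (f (M.X ((i : ℝ≥0) * Δ n) ω) - M.mean f θ)

/-- The sequence `est` is a consistent sequence of `G_n`-estimators of `θ₀`: measurable, `Θ`-valued,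
`P_{θ₀}(G_n(est_n) = 0) → 1`, and `est_n → θ₀` in `P_{θ₀}`-probability. -/
structure IsConsistentEstimator (f : ℝ → ℝ) (θ₀ : ℝ) (Δ : ℕ → ℝ≥0) (est : ℕ → Ω → ℝ) : Prop where
  measurable : ∀ n, Measurable (est n)
  mem : ∀ n ω, est n ω ∈ M.Θ
  solves : Tendsto (fun n => (M.P θ₀ : Measure Ω)
    {ω | M.estimatingFunction f Δ n (est n ω) ω = 0}) atTop (𝓝 1)
  consistent : TendstoInMeasure (M.P θ₀ : Measure Ω) est atTop (fun _ => θ₀)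

/-- `v` is the asymptotic variance of `est`: `√(n Δ_n) (est_n - θ₀)` converges in distribution
under `P_{θ₀}` to `N(0, v)`. -/
def IsAsymptoticVariance (θ₀ : ℝ) (Δ : ℕ → ℝ≥0) (est : ℕ → Ω → ℝ) (v : ℝ≥0) : Prop :=
  TendstoInDistribution (fun (n : ℕ) ω => √((n : ℝ) * (Δ n : ℝ)) * (est n ω - θ₀)) atTop (id : ℝ → ℝ)
    (fun _ => (M.P θ₀ : Measure Ω)) (gaussianReal 0 v)

/-- The Ornstein–Uhlenbeck model `dX_t = κ (θ - X_t) dt + ξ dB_t` on the real line, parametrized by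
its mean `θ`. -/
def IsOrnsteinUhlenbeck (κ ξ : ℝ) : Prop :=
  M.l = ⊥ ∧ M.r = ⊤ ∧ ∀ θ ∈ M.Θ, ∀ x, M.a x θ = κ * (θ - x) ∧ M.b x θ = ξ

end Model

/-- The ergodic high-frequency sampling scenario for the observation times `i Δ_n`:
`Δ_n → 0` and `n Δ_n → ∞`. -/
def HighFrequency (Δ : ℕ → ℝ≥0) : Prop :=
  (∀ n, 0 < Δ n) ∧ Tendsto Δ atTop (𝓝 0) ∧ Tendsto (fun n : ℕ => (n : ℝ≥0) * Δ n) atTop atTop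

end Diffusion

end

/-! Let `T` be the transition semigroup on `L²(μ)` and `e` the constant function one. The maximal
correlation bounds the norm of `T t` on the orthogonal complement of `e`, so ρ-mixing makes `T t`
halve norms there at some time. Iteration gives exponential decay, hence a bounded potential
operator `U`. On the complement of `e`, `-U` inverts the generator: `hasGenerator_potential` and
`potential_generator`. A bound on the quadratic form of `U` yields a spectral gap by Lax–Milgram
(`isSpectralGap_of_inner_le`), so some gap always exists.

The estimate in the other direction, `⟨U x, x⟩ ≤ ‖x‖² / lam` for every gap `lam`, needs `U` to be
self-adjoint (`inner_le_of_isSpectralGap`). Self-adjointness is the reversibility of scalar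
diffusions. For `v` with `v' = w ∈ C¹_c(S)`, the function `L v = a w + b² w' / 2` is the generator
applied to `v`, and stationarity gives `⟨U L v₁, L v₂⟩ = ½ ∫ b² w₁ w₂ dμ`, which is symmetric
(`inner_potential_op`). The functions `L v` are dense in the mean zero part of `L²(μ)`, because `a w
+ b² w' / 2 = h` is a first order linear equation, solvable with compact support as soon as `h`
integrates to zero against the speed density. Such a `v` is constant near each end point, possibly
with two different constants, so it need not have compact support. The martingale identity is
therefore extended from `C^∞_c` to `C²_c` by mollification, and from there to `v` by cutting time
into short pieces on which the path cannot cross from one end of the support of `w` to the other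
(`exists_localisation`, `integral_mul_increment`).

For limit laws, self-adjointness of `U` passes to `T`, so `t ↦ ⟨x, T_t x⟩` is nonnegative and
decreasing. Riemann sums of it lie below `⟨x, U x⟩`, which bounds the variance of the empirical
mean. Linearising `θ ↦ μ_θ(f)` at `θ₀` and truncating squares transfers this bound to the variance
of the normal limit.

In the Ornstein–Uhlenbeck case `x - θ` is an eigenfunction of the generator for `-κ`, so no gap
exceeds `κ`; that `κ` is a gap follows from an integrated inequality in which a completed square is
dropped. -/

noncomputable section

namespace Diffusion

/-! ### Exponentially mixing contraction semigroups on a Hilbert space -/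

section MixingSemigroup

variable {E : Type*} [NormedAddCommGroup E] [InnerProductSpace ℝ E]

/-- A strongly continuous contraction semigroup on a Hilbert space with an invariant unit vector
`e`, which is a strict contraction on the orthogonal complement of `e` at some positive time. -/
structure IsMixingSemigroup (T : ℝ≥0 → E →L[ℝ] E) (e : E) : Prop where
  zero : ∀ x, T 0 x = x
  add : ∀ s t x, T (s + t) x = T s (T t x)
  contraction : ∀ t x, ‖T t x‖ ≤ ‖x‖
  tendsto_zero : ∀ x, Tendsto (fun t => T t x) (𝓝 0) (𝓝 x)
  norm_unit : ‖e‖ = 1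
  map_unit : ∀ t, T t e = e
  inner_unit : ∀ t x, inner ℝ e (T t x) = inner ℝ e x
  mixing : ∃ t, 0 < t ∧ ∀ x, inner ℝ e x = 0 → ‖T t x‖ ≤ 1 / 2 * ‖x‖

/-- The component of `x` orthogonal to the unit vector `e`. -/
def centre (e : E) : E →L[ℝ] E := ContinuousLinearMap.id ℝ E - (innerSL ℝ e).smulRight e

theorem centre_apply (e x : E) : centre e x = x - inner ℝ e x • e := rfl

theorem centre_of_inner_eq_zero {e x : E} (h : inner ℝ e x = 0) : centre e x = x := by
  simp [centre_apply, h]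

theorem tendsto_coe_nhdsGT_zero :
    Tendsto (fun t : ℝ≥0 => (t : ℝ)) (𝓝[>] 0) (𝓝[>] 0) := by
  refine tendsto_nhdsWithin_iff.2 ⟨?_, ?_⟩
  · have : Tendsto (fun t : ℝ≥0 => (t : ℝ)) (𝓝 0) (𝓝 ((0 : ℝ≥0) : ℝ)) :=
      NNReal.continuous_coe.tendsto 0
    exact this.mono_left nhdsWithin_le_nhds
  · filter_upwards [self_mem_nhdsWithin] with t ht
    exact NNReal.coe_pos.2 ht

namespace IsMixingSemigroup

variable {T : ℝ≥0 → E →L[ℝ] E} {e : E} (hT : IsMixingSemigroup T e)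
include hT

theorem inner_self : inner ℝ e e = 1 := by
  rw [real_inner_self_eq_norm_sq, hT.norm_unit]; norm_num

theorem inner_centre (x : E) : inner ℝ e (centre e x) = 0 := by
  simp [centre_apply, inner_sub_right, inner_smul_right, hT.norm_unit]

theorem map_centre (t : ℝ≥0) (x : E) : T t (centre e x) = centre e (T t x) := by
  simp [centre_apply, hT.map_unit, hT.inner_unit]

theorem comm (s t : ℝ≥0) (x : E) : T s (T t x) = T t (T s x) := by
  rw [← hT.add, ← hT.add, add_comm]

/-- Factoring out `T` at the smaller time and using contractivity reduces continuity at any time,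
from both sides, to continuity at zero. -/
theorem dist_le (s t : ℝ≥0) (x : E) : dist (T s x) (T t x) ≤ ‖T (nndist s t) x - x‖ := by
  wlog hst : s ≤ t generalizing s t
  · rw [dist_comm, nndist_comm]
    exact this t s (le_of_not_ge hst)
  obtain ⟨u, rfl⟩ := exists_add_of_le hst
  have h1 : nndist s (s + u) = u := by
    ext
    simp [NNReal.dist_eq]
  rw [h1, hT.add, dist_comm, dist_eq_norm, ← map_sub]
  exact hT.contraction _ _

theorem continuous (x : E) : Continuous fun t => T t x := by
  refine continuous_iff_continuousAt.2 fun t => tendsto_iff_dist_tendsto_zero.2 ?_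
  refine squeeze_zero (fun _ => dist_nonneg) (fun s => hT.dist_le s t x) ?_
  have h1 : Tendsto (fun s : ℝ≥0 => nndist s t) (𝓝 t) (𝓝 0) := by
    have : Continuous fun s : ℝ≥0 => nndist s t := by fun_prop
    simpa using this.tendsto t
  have h2 := ((hT.tendsto_zero x).comp h1).sub_const x
  simpa using h2.norm

theorem continuous_toNNReal (x : E) : Continuous fun t : ℝ => T t.toNNReal x :=
  (hT.continuous x).comp continuous_real_toNNReal

/-- The half-contraction at `t₀` is iterated `⌊t / t₀⌋` times, which preserves orthogonality to `e`.
The rate is `log 2 / t₀`, and the factor `2` pays for the incomplete last period. -/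
theorem exists_exp_decay : ∃ c : ℝ, 0 < c ∧ ∀ t x, inner ℝ e x = 0 →
    ‖T t x‖ ≤ 2 * Real.exp (-c * t) * ‖x‖ := by
  obtain ⟨t₀, ht₀, hmix⟩ := hT.mixing
  have hpow : ∀ (n : ℕ) x, inner ℝ e x = 0 → ‖T (n * t₀) x‖ ≤ (1 / 2) ^ n * ‖x‖ := by
    intro n
    induction n with
    | zero => intro x _; simp [hT.zero]
    | succ n ih =>
      intro x hx
      have h1 : ((n + 1 : ℕ) : ℝ≥0) * t₀ = t₀ + n * t₀ := by push_cast; ring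
      rw [h1, hT.add]
      calc _ ≤ 1 / 2 * ‖T (n * t₀) x‖ := hmix _ (by rw [hT.inner_unit, hx])
        _ ≤ 1 / 2 * ((1 / 2) ^ n * ‖x‖) := by gcongr; exact ih x hx
        _ = _ := by ring
  have ht₀' : (0 : ℝ) < t₀ := ht₀
  refine ⟨Real.log 2 / t₀, div_pos (Real.log_pos one_lt_two) ht₀', fun t x hx => ?_⟩
  set n := ⌊(t : ℝ) / t₀⌋₊ with hn
  have hle : (n : ℝ≥0) * t₀ ≤ t := by
    rw [← NNReal.coe_le_coe]
    push_cast
    rw [← le_div_iff₀ ht₀']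
    exact Nat.floor_le (by positivity)
  obtain ⟨u, hu⟩ := exists_add_of_le hle
  have h1 : ‖T t x‖ ≤ (1 / 2) ^ n * ‖x‖ := by
    rw [hu, hT.add, hT.comm]
    exact (hT.contraction _ _).trans (hpow n x hx)
  refine h1.trans (mul_le_mul_of_nonneg_right ?_ (norm_nonneg _))
  have h2 : (t : ℝ) / t₀ < n + 1 := Nat.lt_floor_add_one _
  have h3 : (1 / 2 : ℝ) ^ n = Real.exp (-(n * Real.log 2)) := by
    rw [Real.exp_neg, Real.exp_nat_mul, Real.exp_log two_pos]; simp
  have h4 : (2 : ℝ) = Real.exp (Real.log 2) := (Real.exp_log two_pos).symm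
  rw [h3]
  conv_rhs => rw [h4, ← Real.exp_add]
  rw [Real.exp_le_exp, ← h4]
  have h5 := mul_le_mul_of_nonneg_right h2.le (Real.log_pos one_lt_two).le
  have h6 : -(Real.log 2 / t₀) * t = -((t : ℝ) / t₀ * Real.log 2) := by ring
  linarith

theorem integrableOn (x : E) (hx : inner ℝ e x = 0) :
    IntegrableOn (fun t : ℝ => T t.toNNReal x) (Ioi 0) := by
  obtain ⟨c, hc, h⟩ := hT.exists_exp_decay
  have hi : IntegrableOn (fun t : ℝ => 2 * Real.exp (-c * t) * ‖x‖) (Ioi 0) :=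
    ((exp_neg_integrableOn_Ioi 0 hc).const_mul 2).mul_const _
  refine hi.mono' (hT.continuous_toNNReal x).aestronglyMeasurable ?_
  filter_upwards [ae_restrict_mem measurableSet_Ioi] with t ht
  have := h t.toNNReal x hx
  rwa [Real.coe_toNNReal _ (le_of_lt ht)] at this

/-- The potential operator `U x = ∫₀^∞ T_t (x - ⟨e, x⟩ e) dt`. -/
theorem exists_potential : ∃ U : E →L[ℝ] E, ∀ x,
    U x = ∫ t in Ioi (0 : ℝ), T t.toNNReal (centre e x) := by
  obtain ⟨c, hc, h⟩ := hT.exists_exp_decay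
  have hi : ∀ x, IntegrableOn (fun t : ℝ => T t.toNNReal (centre e x)) (Ioi 0) :=
    fun x => hT.integrableOn _ (hT.inner_centre x)
  let L : E →ₗ[ℝ] E :=
    { toFun := fun x => ∫ t in Ioi (0 : ℝ), T t.toNNReal (centre e x)
      map_add' := fun x y => by
        simp only [map_add]
        exact integral_add (hi x) (hi y)
      map_smul' := fun r x => by
        simp only [map_smul, RingHom.id_apply]
        exact integral_smul _ _ }
  let C : ℝ := (∫ t in Ioi (0 : ℝ), 2 * Real.exp (-c * t)) * ‖centre e‖
  refine ⟨L.mkContinuous C fun x => ?_, fun x => rfl⟩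
  have hexp : IntegrableOn (fun t : ℝ => 2 * Real.exp (-c * t)) (Ioi 0) :=
    (exp_neg_integrableOn_Ioi 0 hc).const_mul 2
  have h1 : ‖∫ t in Ioi (0 : ℝ), T t.toNNReal (centre e x)‖
      ≤ ∫ t in Ioi (0 : ℝ), 2 * Real.exp (-c * t) * ‖centre e x‖ := by
    refine norm_integral_le_of_norm_le (hexp.mul_const _) ?_
    filter_upwards [ae_restrict_mem measurableSet_Ioi] with t ht
    have := h t.toNNReal _ (hT.inner_centre x)
    rwa [Real.coe_toNNReal _ (le_of_lt ht)] at this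
  rw [integral_mul_const] at h1
  refine h1.trans ?_
  rw [mul_assoc]
  refine mul_le_mul_of_nonneg_left ((centre e).le_opNorm x) ?_
  exact integral_nonneg fun t => by positivity

end IsMixingSemigroup

end MixingSemigroup

/-! ### The potential operator: inverse of the generator, spectral gaps, self-adjointness. -/

section Potential

variable {E : Type*} [NormedAddCommGroup E] [InnerProductSpace ℝ E]

variable {T : ℝ≥0 → E →L[ℝ] E} {e : E} {U : E →L[ℝ] E}

/-- `U` is the potential operator of the semigroup `T`. -/
def IsPotential (T : ℝ≥0 → E →L[ℝ] E) (e : E) (U : E →L[ℝ] E) : Prop :=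
  ∀ x, U x = ∫ t in Ioi (0 : ℝ), T t.toNNReal (centre e x)

namespace IsMixingSemigroup

variable (hT : IsMixingSemigroup T e) (hU : IsPotential T e U)
include hT hU

theorem potential_centre (x : E) : U (centre e x) = U x := by
  rw [hU, hU, centre_of_inner_eq_zero (hT.inner_centre x)]

omit hU in
theorem inner_centre_left (x y : E) : inner ℝ (centre e x) y = inner ℝ (centre e x) (centre e y) := by
  rw [centre_apply e y, inner_sub_right, inner_smul_right, real_inner_comm e (centre e x),
    hT.inner_centre]
  simp

variable [CompleteSpace E]

theorem inner_potential (x : E) : inner ℝ e (U x) = 0 := by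
  rw [hU, ← integral_inner (hT.integrableOn _ (hT.inner_centre x))]
  simp [hT.inner_unit, hT.inner_centre]

theorem map_potential (t : ℝ≥0) (x : E) : T t (U x) = U (T t x) := by
  rw [hU, hU, ← ContinuousLinearMap.integral_comp_comm _
    (hT.integrableOn _ (hT.inner_centre x))]
  refine integral_congr_ae (.of_forall fun s => ?_)
  change T t (T s.toNNReal (centre e x)) = _
  rw [hT.comm, hT.map_centre]

/-- `T_h U x - U x = - ∫₀^h T_s (x - ⟨e, x⟩ e) ds`. -/
theorem map_potential_sub (h : ℝ≥0) (x : E) :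
    T h (U x) - U x = -∫ s in (0 : ℝ)..h, T s.toNNReal (centre e x) := by
  have hi := hT.integrableOn _ (hT.inner_centre x)
  have h1 : T h (U x) = ∫ s in Ioi (h : ℝ), T s.toNNReal (centre e x) := by
    rw [hU, ← ContinuousLinearMap.integral_comp_comm _ hi]
    -- By the semigroup law `T h` shifts the integrand, so `T h (U x)` is the same integral over the
    -- half-line from `h`.
    have h2 := (measurePreserving_add_right (volume : Measure ℝ) (h : ℝ)).setIntegral_preimage_emb
      (measurableEmbedding_addRight (h : ℝ)) (fun s : ℝ => T s.toNNReal (centre e x)) (Ioi (h : ℝ))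
    rw [← h2]
    have h3 : (fun s : ℝ => s + h) ⁻¹' Ioi (h : ℝ) = Ioi 0 := by ext s; simp
    rw [h3]
    refine setIntegral_congr_fun measurableSet_Ioi fun s hs => ?_
    rw [Real.toNNReal_add (le_of_lt hs) h.coe_nonneg, Real.toNNReal_coe, add_comm, hT.add]
  have h4 := intervalIntegral.integral_interval_add_Ioi
    (a := 0) (b := (h : ℝ)) (f := fun s : ℝ => T s.toNNReal (centre e x)) hi
    (hi.mono_set (Ioi_subset_Ioi h.2))
  rw [h1, hU x, ← h4]
  abel

omit hU in
theorem tendsto_average (x : E) :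
    Tendsto (fun h : ℝ≥0 => (h : ℝ)⁻¹ • ∫ s in (0 : ℝ)..h, T s.toNNReal x) (𝓝[>] 0) (𝓝 x) := by
  have hc := hT.continuous_toNNReal x
  have h1 : HasDerivAt (fun h : ℝ => ∫ s in (0 : ℝ)..h, T s.toNNReal x) x 0 := by
    have := intervalIntegral.integral_hasDerivAt_right (hc.intervalIntegrable 0 0)
      (hc.stronglyMeasurableAtFilter _ _) hc.continuousAt
    simpa [hT.zero] using this
  have h2 := hasDerivAt_iff_tendsto_slope_zero.1 h1
  have h3 := h2.comp (tendsto_coe_nhdsGT_zero.mono_right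
    (nhdsWithin_mono _ fun x hx => ne_of_gt hx))
  simpa [Function.comp_def] using h3

theorem hasGenerator_potential (x : E) : HasGenerator T (U x) (-centre e x) := by
  unfold HasGenerator
  simp only [hT.map_potential_sub hU, smul_neg]
  exact (hT.tendsto_average _).neg

omit hU [CompleteSpace E] in
theorem inner_generator {F G : E} (h : HasGenerator T F G) : inner ℝ e G = 0 := by
  have h1 := (Filter.Tendsto.inner (𝕜 := ℝ) (tendsto_const_nhds (x := e)) h)
  have h2 : (fun t : ℝ≥0 => inner ℝ e ((t : ℝ)⁻¹ • (T t F - F))) = fun _ => 0 := by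
    ext t
    simp [inner_smul_right, inner_sub_right, hT.inner_unit]
  rw [h2] at h1
  exact tendsto_nhds_unique h1 tendsto_const_nhds

/-- As `U` commutes with `T`, it maps the difference quotients of `F` to those of `U F`, which are
minus time averages of the orbit of `centre e F`. Together with `hasGenerator_potential` this makes
`-U` a two-sided inverse of the generator on the complement of `e`. -/
theorem potential_generator {F G : E} (h : HasGenerator T F G) : U G = -centre e F := by
  have h1 := (U.continuous.tendsto G).comp h
  have h2 : (U ∘ fun t : ℝ≥0 => (t : ℝ)⁻¹ • (T t F - F))
      = fun t : ℝ≥0 => -((t : ℝ)⁻¹ • ∫ s in (0 : ℝ)..t, T s.toNNReal (centre e F)) := by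
    ext t
    simp only [Function.comp, map_smul, map_sub]
    rw [← hT.map_potential hU, hT.map_potential_sub hU, smul_neg]
  rw [h2] at h1
  exact tendsto_nhds_unique h1 (hT.tendsto_average _).neg

/-- This is dissipativity: a contraction satisfies `⟨F, T_t F - F⟩ ≤ 0`, so `⟨F, A F⟩ ≤ 0` in the
limit, applied with `F = U x` and `A F = -centre e x`. -/
theorem inner_potential_nonneg (x : E) : 0 ≤ inner ℝ (U x) x := by
  have h1 := (hT.hasGenerator_potential hU x)
  have h2 := Filter.Tendsto.inner (𝕜 := ℝ) (tendsto_const_nhds (x := U x)) h1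
  have h3 : inner ℝ (U x) (-centre e x) ≤ 0 := by
    refine le_of_tendsto h2 (.of_forall fun t => ?_)
    rw [inner_smul_right, inner_sub_right, real_inner_self_eq_norm_sq]
    refine mul_nonpos_of_nonneg_of_nonpos (by positivity) ?_
    have h4 := real_inner_le_norm (U x) (T t (U x))
    have h5 := mul_le_mul_of_nonneg_left (hT.contraction t (U x)) (norm_nonneg (U x))
    nlinarith
  rw [inner_neg_right, centre_apply, inner_sub_right, inner_smul_right,
    real_inner_comm, real_inner_comm e, hT.inner_potential hU, real_inner_comm] at h3
  linarith

/-- If `0 ≤ ⟨U x, x⟩ ≤ ‖x‖² / lam` then `lam` is a spectral gap. -/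
theorem isSpectralGap_of_inner_le {lam : ℝ} (hlam : 0 < lam)
    (hle : ∀ x, inner ℝ (U x) x ≤ lam⁻¹ * ‖x‖ ^ 2) : IsSpectralGap T lam := by
  refine ⟨hlam, fun z hz => ?_⟩
  by_contra hcon
  simp only [mem_union, mem_Iic, mem_singleton_iff, not_or, not_le] at hcon
  obtain ⟨hz1, hz0⟩ := hcon
  refine hz ?_
  -- With `A = -U⁻¹` on the complement of `e`, formally `z - A = U⁻¹ (1 + z U)`. It thus suffices to
  -- invert `1 + z U`, which is coercive by the two bounds on the form of `U`, one for each sign of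
  -- `z`; Lax–Milgram then applies without symmetry.
  let B : E →L[ℝ] E →L[ℝ] ℝ := (innerSL ℝ).comp (ContinuousLinearMap.id ℝ E + z • U)
  have hB : ∀ x y, B x y = inner ℝ (x + z • U x) y := fun x y => rfl
  have hco : IsCoercive B := by
    refine ⟨min 1 (1 + z * lam⁻¹), ?_, fun x => ?_⟩
    · refine lt_min one_pos ?_
      have : -lam * lam⁻¹ < z * lam⁻¹ := mul_lt_mul_of_pos_right hz1 (inv_pos.2 hlam)
      rw [neg_mul, mul_inv_cancel₀ hlam.ne'] at this
      linarith
    · rw [hB, inner_add_left, inner_smul_left, real_inner_self_eq_norm_sq]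
      simp only [conj_trivial]
      have h0 := hT.inner_potential_nonneg hU x
      rcases le_or_gt 0 z with h | h
      · have h1 : min 1 (1 + z * lam⁻¹) * (‖x‖ * ‖x‖) ≤ 1 * (‖x‖ * ‖x‖) := by
          gcongr; exact min_le_left _ _
        have := mul_nonneg h h0
        nlinarith
      · have h1 : min 1 (1 + z * lam⁻¹) * (‖x‖ * ‖x‖) ≤ (1 + z * lam⁻¹) * (‖x‖ * ‖x‖) := by
          gcongr; exact min_le_right _ _
        have := mul_le_mul_of_nonpos_left (hle x) h.le
        nlinarith
  let V₀ := hco.continuousLinearEquivOfBilin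
  have hV₀ : ∀ x, V₀ x = x + z • U x := by
    intro x
    refine ext_inner_right ℝ fun w => ?_
    rw [hco.continuousLinearEquivOfBilin_apply, hB]
  let V : E →L[ℝ] E := V₀.symm
  have hV : ∀ x, V x + z • U (V x) = x := fun x => by
    rw [← hV₀]; exact V₀.apply_symm_apply x
  have hV' : ∀ x, V (x + z • U x) = x := fun x => by
    rw [← hV₀]; exact V₀.symm_apply_apply x
  -- The resolvent acts as `1 / z` on the invariant vector and as `U (1 + z U)⁻¹` on its complement.
  let R : E →L[ℝ] E := z⁻¹ • (innerSL ℝ e).smulRight e + (U.comp V).comp (centre e)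
  have hR : ∀ G, R G = z⁻¹ • inner ℝ e G • e + U (V (centre e G)) := fun G => rfl
  refine ⟨R, fun G => ?_, fun F G hFG => ?_⟩
  · set y := V (centre e G) with hy
    have hyG := hV (centre e G)
    rw [← hy] at hyG
    have hye : inner ℝ e y = 0 := by
      have := congrArg (inner ℝ e) hyG
      rw [inner_add_right, inner_smul_right, hT.inner_potential hU, hT.inner_centre] at this
      simpa using this
    have h1 : z • R G - G = -y := by
      rw [hR, smul_add, smul_inv_smul₀ hz0, ← hy, eq_sub_of_add_eq' hyG, centre_apply]
      abel
    have h2 := hT.hasGenerator_potential hU y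
    rw [centre_of_inner_eq_zero hye] at h2
    rw [h1, hR]
    unfold HasGenerator at h2 ⊢
    refine h2.congr fun t => ?_
    simp only [map_add, map_smul, hT.map_unit]
    congr 1
    rw [← hy]
    abel
  · have h1 := hT.inner_generator hFG
    have h2 := hT.potential_generator hU hFG
    have h3 : centre e (z • F - G) = -(G + z • U G) := by
      rw [map_sub, map_smul, centre_of_inner_eq_zero h1, h2, smul_neg]
      abel
    rw [hR, h3, map_neg, hV', map_neg, h2, inner_sub_right, h1, inner_smul_right, sub_zero,
      smul_smul, inv_mul_cancel_left₀ hz0, neg_neg, centre_apply]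
    abel

/-- Cauchy–Schwarz bounds the form of `U` by its norm; adding one keeps the candidate well defined
when `U = 0`. -/
theorem exists_isSpectralGap : ∃ lam, IsSpectralGap T lam := by
  refine ⟨(‖U‖ + 1)⁻¹, hT.isSpectralGap_of_inner_le hU (by positivity) fun x => ?_⟩
  rw [inv_inv]
  calc inner ℝ (U x) x ≤ ‖U x‖ * ‖x‖ := real_inner_le_norm _ _
    _ ≤ (‖U‖ * ‖x‖) * ‖x‖ := by gcongr; exact U.le_opNorm x
    _ ≤ _ := by nlinarith [sq_nonneg ‖x‖]

variable (hsymm : ∀ x y, inner ℝ (U x) y = inner ℝ x (U y))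
include hsymm

/-- For a self-adjoint potential operator, a spectral gap bounds the quadratic form. -/
theorem inner_le_of_isSpectralGap {lam : ℝ} (h : IsSpectralGap T lam) (x : E) :
    inner ℝ (U x) x ≤ lam⁻¹ * ‖x‖ ^ 2 := by
  obtain ⟨hlam, hspec⟩ := h
  have hpos := hT.inner_potential_nonneg hU
  -- The aim is `m = sup Q ≤ 1 / lam`. If `m` were larger, `-1 / m` would be a resolvent point, so
  -- `m - U` would be bounded below on the complement of `e`. For a nonnegative symmetric form this
  -- pushes the supremum strictly below `m`.
  set Q : Set ℝ := {r | ∃ x : E, ‖x‖ = 1 ∧ r = inner ℝ (U x) x} with hQ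
  have hbdd : BddAbove Q := by
    refine ⟨‖U‖, ?_⟩
    rintro _ ⟨x, hx, rfl⟩
    calc inner ℝ (U x) x ≤ ‖U x‖ * ‖x‖ := real_inner_le_norm _ _
      _ ≤ (‖U‖ * ‖x‖) * ‖x‖ := by gcongr; exact U.le_opNorm x
      _ = _ := by rw [hx]; ring
  set m := sSup Q with hm
  have hbound : ∀ x, inner ℝ (U x) x ≤ m * ‖x‖ ^ 2 := by
    intro x
    rcases eq_or_ne x 0 with rfl | hx
    · simp
    have hx' : 0 < ‖x‖ := norm_pos_iff.2 hx
    have h1 : inner ℝ (U (‖x‖⁻¹ • x)) (‖x‖⁻¹ • x) ≤ m :=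
      le_csSup hbdd ⟨_, by rw [norm_smul, norm_inv, norm_norm, inv_mul_cancel₀ hx'.ne'], rfl⟩
    rw [map_smul, inner_smul_left, inner_smul_right] at h1
    simp only [conj_trivial] at h1
    have h2 : inner ℝ (U x) x = (‖x‖⁻¹ * (‖x‖⁻¹ * inner ℝ (U x) x)) * ‖x‖ ^ 2 := by
      field_simp
    rw [h2]
    gcongr
  suffices hmle : m ≤ lam⁻¹ by
    exact (hbound x).trans (by gcongr)
  by_contra! hlt
  have hm0 : 0 < m := (inv_pos.2 hlam).trans hlt
  -- The point `-1 / m` lies in the resolvent set.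
  have hz : -m⁻¹ ∈ generatorResolventSet T := by
    by_contra hz
    have h1 : m⁻¹ < lam := inv_lt_of_inv_lt₀ hlam hlt
    have h2 := inv_pos.2 hm0
    rcases hspec hz with h | h
    · simp only [mem_Iic] at h; linarith
    · simp only [mem_singleton_iff] at h; linarith
  obtain ⟨R, -, hR⟩ := hz
  -- `B = m - U` is nonnegative, hence `‖B x‖² ≤ ‖B‖ ⟨B x, x⟩`.
  have hB : ∀ x, ‖m • x - U x‖ ^ 2 ≤ (m + ‖U‖) * (m * ‖x‖ ^ 2 - inner ℝ (U x) x) := by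
    intro x
    set y := m • x - U x with hy
    have hform : ∀ u : E, 0 ≤ m * ‖u‖ ^ 2 - inner ℝ (U u) u := fun u => by
      linarith [hbound u]
    have hyy : inner ℝ x (m • y - U y) = ‖y‖ ^ 2 := by
      rw [inner_sub_right, ← hsymm, inner_smul_right, ← real_inner_self_eq_norm_sq]
      rw [← real_inner_smul_left, ← inner_sub_left]
    have hUy : m * ‖y‖ ^ 2 - inner ℝ (U y) y ≤ (m + ‖U‖) * ‖y‖ ^ 2 := by
      have := abs_real_inner_le_norm (U y) y
      have h2 := mul_le_mul_of_nonneg_right (U.le_opNorm y) (norm_nonneg y)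
      have h3 := neg_abs_le (inner ℝ (U y) y)
      nlinarith
    rcases eq_or_lt_of_le (show 0 ≤ m + ‖U‖ by positivity) with h0 | h0
    · linarith [norm_nonneg U]
    -- expand the form at `x - y / (m + ‖U‖)`
    have h1 := hform (x - (m + ‖U‖)⁻¹ • y)
    set c := (m + ‖U‖)⁻¹ with hc
    have hc0 : 0 < c := inv_pos.2 h0
    have h2 : m * ‖x - c • y‖ ^ 2 - inner ℝ (U (x - c • y)) (x - c • y)
        = (m * ‖x‖ ^ 2 - inner ℝ (U x) x) - 2 * c * ‖y‖ ^ 2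
          + c ^ 2 * (m * ‖y‖ ^ 2 - inner ℝ (U y) y) := by
      rw [inner_sub_right, inner_smul_right] at hyy
      rw [norm_sub_sq_real, norm_smul, map_sub, map_smul, inner_sub_left, inner_sub_right,
        inner_sub_right, inner_smul_left, inner_smul_left, inner_smul_right, inner_smul_right,
        inner_smul_right, mul_pow, Real.norm_eq_abs, sq_abs, hsymm x y, ← real_inner_comm (U y) x,
        ← real_inner_comm x (U y)]
      simp only [conj_trivial]
      rw [real_inner_comm x (U y)] 
      linear_combination (-2 * c) * hyy
    rw [h2] at h1
    have h3 : c ^ 2 * (m * ‖y‖ ^ 2 - inner ℝ (U y) y) ≤ c * ‖y‖ ^ 2 := by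
      have := mul_le_mul_of_nonneg_left hUy (sq_nonneg c)
      have h4 : c ^ 2 * ((m + ‖U‖) * ‖y‖ ^ 2) = c * ‖y‖ ^ 2 * (c * (m + ‖U‖)) := by ring
      rw [h4, hc, inv_mul_cancel₀ h0.ne', mul_one] at this
      exact this
    have h5 : c * ‖y‖ ^ 2 ≤ m * ‖x‖ ^ 2 - inner ℝ (U x) x := by linarith
    have h6 := mul_le_mul_of_nonneg_left h5 h0.le
    rwa [← mul_assoc, hc, mul_inv_cancel₀ h0.ne', one_mul] at h6
  set C := m⁻¹ * (1 + ‖R‖ * m⁻¹) with hC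
  have hC0 : 0 < C := by positivity
  -- The left inverse `R` at `z = -1 / m`, applied to the pair `U x`, `-x`, returns `U x` from `m⁻¹
  -- (m x - U x)`. This bounds `U x`, and then `x`, by `m x - U x`.
  have hinv : ∀ x, inner ℝ e x = 0 → ‖x‖ ≤ C * ‖m • x - U x‖ := by
    intro x hx
    have h1 := hR _ _ (hT.hasGenerator_potential hU x)
    rw [centre_of_inner_eq_zero hx] at h1
    have h2 : -m⁻¹ • U x - -x = m⁻¹ • (m • x - U x) := by
      rw [smul_sub, inv_smul_smul₀ hm0.ne', neg_smul]; abel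
    rw [h2] at h1
    have h3 : ‖U x‖ ≤ ‖R‖ * (m⁻¹ * ‖m • x - U x‖) := by
      have := R.le_opNorm (m⁻¹ • (m • x - U x))
      rwa [h1, norm_smul, Real.norm_of_nonneg (inv_pos.2 hm0).le] at this
    have h4 : m * ‖x‖ ≤ ‖m • x - U x‖ + ‖U x‖ := by
      have := norm_add_le (m • x - U x) (U x)
      rwa [sub_add_cancel, norm_smul, Real.norm_of_nonneg hm0.le] at this
    calc ‖x‖ = m⁻¹ * (m * ‖x‖) := by field_simp
      _ ≤ m⁻¹ * (‖m • x - U x‖ + ‖R‖ * (m⁻¹ * ‖m • x - U x‖)) := by gcongr; linarith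
      _ = _ := by rw [hC]; ring
  have hK : 0 < C ^ 2 * (m + ‖U‖) := by positivity
  have hQne : Q.Nonempty := ⟨_, e, hT.norm_unit, rfl⟩
  -- Projecting a unit vector to the complement of `e` can shorten it. The maximum with `0` keeps
  -- the factor nonnegative, so that `‖centre e x‖ ≤ 1` may be used; `m > 0` rules that alternative
  -- out at the end.
  have hub : m ≤ max (m - (C ^ 2 * (m + ‖U‖))⁻¹) 0 := by
    refine csSup_le hQne ?_
    rintro _ ⟨x, hx, rfl⟩
    have h1 : inner ℝ (U x) x = inner ℝ (U (centre e x)) (centre e x) := by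
      rw [hT.potential_centre hU, centre_apply, inner_sub_right, inner_smul_right,
        real_inner_comm e, hT.inner_potential hU]
      simp
    have h2 : ‖centre e x‖ ^ 2 ≤ 1 := by
      rw [← real_inner_self_eq_norm_sq, ← hT.inner_centre_left, centre_apply, inner_sub_left,
        real_inner_self_eq_norm_sq, hx, real_inner_smul_left]
      nlinarith [mul_self_nonneg (inner ℝ e x : ℝ)]
    set y := centre e x with hy
    have h3 := hinv y (hT.inner_centre x)
    have h4 : ‖y‖ ^ 2 ≤ C ^ 2 * (m + ‖U‖) * (m * ‖y‖ ^ 2 - inner ℝ (U y) y) := by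
      calc ‖y‖ ^ 2 ≤ (C * ‖m • y - U y‖) ^ 2 := by gcongr
        _ = C ^ 2 * ‖m • y - U y‖ ^ 2 := mul_pow _ _ _
        _ ≤ C ^ 2 * ((m + ‖U‖) * (m * ‖y‖ ^ 2 - inner ℝ (U y) y)) := by gcongr; exact hB y
        _ = _ := by ring
    have h5 : inner ℝ (U y) y ≤ (m - (C ^ 2 * (m + ‖U‖))⁻¹) * ‖y‖ ^ 2 := by
      have := mul_le_mul_of_nonneg_left h4 (inv_pos.2 hK).le
      rw [inv_mul_cancel_left₀ hK.ne'] at this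
      linarith
    rw [h1]
    calc _ ≤ (m - (C ^ 2 * (m + ‖U‖))⁻¹) * ‖y‖ ^ 2 := h5
      _ ≤ max (m - (C ^ 2 * (m + ‖U‖))⁻¹) 0 * ‖y‖ ^ 2 := by gcongr; exact le_max_left _ _
      _ ≤ max (m - (C ^ 2 * (m + ‖U‖))⁻¹) 0 * 1 := by gcongr
      _ = _ := mul_one _
  have := inv_pos.2 hK
  rcases le_max_iff.1 hub with h | h <;> linarith

-- For `s ≥ 0` and `U` the potential operator, this function is `T_s (U x)` when `x` is orthogonal
-- to `e`. Written as an integral it is differentiable on the whole line, since `T` is frozen at the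
-- identity for negative times, so no one-sided derivatives arise at the end points.
omit hsymm hU in
theorem hasDerivAt_map_potential (U : E →L[ℝ] E) (x : E) (s : ℝ) :
    HasDerivAt (fun s : ℝ => U x - ∫ r in (0 : ℝ)..s, T r.toNNReal x) (-T s.toNNReal x) s := by
  have hc := hT.continuous_toNNReal x
  exact (intervalIntegral.integral_hasDerivAt_right (hc.intervalIntegrable 0 s)
      (hc.stronglyMeasurableAtFilter _ _) hc.continuousAt).const_sub _

omit hsymm in
theorem map_potential_eq (x : E) (hx : inner ℝ e x = 0) {s : ℝ} (hs : 0 ≤ s) :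
    U x - ∫ r in (0 : ℝ)..s, T r.toNNReal x = T s.toNNReal (U x) := by
  have h := hT.map_potential_sub hU s.toNNReal x
  rw [centre_of_inner_eq_zero hx, Real.coe_toNNReal _ hs] at h
  rw [sub_eq_iff_eq_add.1 h]
  abel

/-- A self-adjoint potential operator forces the semigroup to be self-adjoint. -/
theorem inner_map_comm (t : ℝ≥0) (x y : E) : inner ℝ (T t x) y = inner ℝ x (T t y) := by
  have key : ∀ x y, inner ℝ e x = 0 → inner ℝ e y = 0 →
      inner ℝ (T t (U x)) (U y) = inner ℝ (U x) (T t (U y)) := by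
    intro x y hx hy
    let ψ : E → ℝ → E := fun z s => U z - ∫ r in (0 : ℝ)..s, T r.toNNReal z
    -- On `[0, t]` this is `⟨T_{t-s} U x, T_s U y⟩`. Its derivative is `⟨T_{t-s} x, U T_s y⟩ - ⟨U
    -- T_{t-s} x, T_s y⟩`, which vanishes by symmetry of `U`; comparing the two ends moves `T t`
    -- across the inner product.
    let φ : ℝ → ℝ := fun s => inner ℝ (ψ x (t - s)) (ψ y s)
    have hφ : ∀ s ∈ Icc (0 : ℝ) t, HasDerivAt φ 0 s := by
      intro s hs
      have h1 : HasDerivAt (fun s : ℝ => ψ x (t - s)) (T (t - s).toNNReal x) s := by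
        have := (hT.hasDerivAt_map_potential U x (t - s)).scomp s
          ((hasDerivAt_id s).const_sub (t : ℝ))
        simpa [Function.comp_def] using this
      have h2 : HasDerivAt (ψ y) _ s := hT.hasDerivAt_map_potential U y s
      have h3 := h1.inner ℝ h2
      have h4 : ψ x (t - s) = T (t - s).toNNReal (U x) :=
        hT.map_potential_eq hU x hx (by linarith [hs.2])
      have h5 : ψ y s = T s.toNNReal (U y) := hT.map_potential_eq hU y hy hs.1
      refine h3.congr_deriv ?_
      rw [h4, h5, hT.map_potential hU, hT.map_potential hU, inner_neg_right, hsymm]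
      ring
    have h0 : φ t = φ 0 :=
      constant_of_has_deriv_right_zero
        (fun s hs => (hφ s hs).continuousAt.continuousWithinAt)
        (fun s hs => (hφ s ⟨hs.1, hs.2.le⟩).hasDerivWithinAt) t ⟨t.2, le_rfl⟩
    have e1 : ∀ z, inner ℝ e z = 0 → ψ z 0 = U z := fun z _ => by simp [ψ]
    have e2 : ∀ z, inner ℝ e z = 0 → ψ z t = T t (U z) := fun z hz => by
      have := hT.map_potential_eq hU z hz t.2
      simpa using this
    simp only [φ, sub_self, sub_zero] at h0
    rw [e1 x hx, e2 x hx, e1 y hy, e2 y hy] at h0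
    exact h0.symm
  -- the range of `U` is dense in the orthogonal complement of `e`
  have hlim : ∀ x, inner ℝ e x = 0 →
      Tendsto (fun h : ℝ≥0 => U ((h : ℝ)⁻¹ • (x - T h x))) (𝓝[>] 0) (𝓝 x) := by
    intro x hx
    refine (hT.tendsto_average x).congr fun h => ?_
    have h1 := hT.map_potential_sub hU h x
    rw [centre_of_inner_eq_zero hx] at h1
    rw [map_smul, map_sub, ← hT.map_potential hU, ← neg_sub, h1, neg_neg]
  have hort : ∀ x (h : ℝ≥0), inner ℝ e x = 0 → inner ℝ e ((h : ℝ)⁻¹ • (x - T h x)) = 0 := by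
    intro x h hx
    simp [inner_smul_right, inner_sub_right, hT.inner_unit]
  have hper : ∀ x y, inner ℝ e x = 0 → inner ℝ e y = 0 →
      inner ℝ (T t x) y = inner ℝ x (T t y) := by
    intro x y hx hy
    have h1 := ((T t).continuous.tendsto x).comp (hlim x hx)
    have h2 := ((T t).continuous.tendsto y).comp (hlim y hy)
    refine tendsto_nhds_unique (Filter.Tendsto.inner (𝕜 := ℝ) h1 (hlim y hy)) ?_
    refine (Filter.Tendsto.inner (𝕜 := ℝ) (hlim x hx) h2).congr fun h => ?_
    exact (key _ _ (hort x h hx) (hort y h hy)).symm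
  have hx : x = centre e x + inner ℝ e x • e := by rw [centre_apply]; abel
  have hy : y = centre e y + inner ℝ e y • e := by rw [centre_apply]; abel
  have hTe : ∀ z, inner ℝ (T t (centre e z)) e = 0 := fun z => by
    rw [real_inner_comm, hT.inner_unit, hT.inner_centre]
  have hTe' : ∀ z, inner ℝ e (T t (centre e z)) = 0 := fun z => by
    rw [hT.inner_unit, hT.inner_centre]
  have hce : ∀ z, inner ℝ (centre e z) e = 0 := fun z => by
    rw [real_inner_comm, hT.inner_centre]
  have hcc := hper _ _ (hT.inner_centre x) (hT.inner_centre y)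
  rw [hx, hy]
  simp only [map_add, map_smul, hT.map_unit, inner_add_left, inner_add_right, real_inner_smul_left,
    real_inner_smul_right, hTe, hTe', hce, hT.inner_centre, hcc]

end IsMixingSemigroup

end Potential

/-! ### Square integrable functions -/

section SquareIntegrable

variable {α : Type*} {mα : MeasurableSpace α} {ν : Measure α}

theorem inner_eq_integral_mul (F G : Lp ℝ 2 ν) : inner ℝ F G = ∫ x, F x * G x ∂ν := by
  rw [L2.inner_def]
  refine integral_congr_ae (.of_forall fun x => ?_)
  simp [mul_comm]

theorem inner_toLp_toLp {f g : α → ℝ} (hf : MemLp f 2 ν) (hg : MemLp g 2 ν) :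
    inner ℝ (hf.toLp f) (hg.toLp g) = ∫ x, f x * g x ∂ν := by
  rw [inner_eq_integral_mul]
  refine integral_congr_ae ?_
  filter_upwards [hf.coeFn_toLp, hg.coeFn_toLp] with x h1 h2
  rw [h1, h2]

theorem norm_toLp_sq {f : α → ℝ} (hf : MemLp f 2 ν) : ‖hf.toLp f‖ ^ 2 = ∫ x, f x ^ 2 ∂ν := by
  rw [← real_inner_self_eq_norm_sq, inner_toLp_toLp hf hf]
  simp only [sq]

theorem abs_integral_mul_le {f g : α → ℝ} (hf : MemLp f 2 ν) (hg : MemLp g 2 ν) :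
    |∫ x, f x * g x ∂ν| ≤ √(∫ x, f x ^ 2 ∂ν) * √(∫ x, g x ^ 2 ∂ν) := by
  rw [← inner_toLp_toLp hf hg, ← norm_toLp_sq hf, ← norm_toLp_sq hg,
    Real.sqrt_sq (norm_nonneg _), Real.sqrt_sq (norm_nonneg _)]
  exact abs_real_inner_le_norm _ _

theorem abs_covariance_le [IsProbabilityMeasure ν] {f g : α → ℝ} (hf : MemLp f 2 ν)
    (hg : MemLp g 2 ν) : |cov[f, g; ν]| ≤ √(Var[f; ν]) * √(Var[g; ν]) := by
  rw [variance_eq_integral hf.1.aemeasurable, variance_eq_integral hg.1.aemeasurable]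
  exact abs_integral_mul_le (hf.sub (memLp_const _)) (hg.sub (memLp_const _))

theorem toL2_of_memLp {μ : Measure ℝ} {g : ℝ → ℝ} (h : MemLp g 2 μ) : toL2 μ g = h.toLp g := by
  rw [toL2, dif_pos h]

theorem toL2_ae_eq {μ : Measure ℝ} {g : ℝ → ℝ} (h : MemLp g 2 μ) :
    (toL2 μ g : ℝ → ℝ) =ᵐ[μ] g := by
  rw [toL2_of_memLp h]
  exact h.coeFn_toLp

theorem inner_toL2 {μ : Measure ℝ} {f g : ℝ → ℝ} (hf : MemLp f 2 μ) (hg : MemLp g 2 μ) :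
    inner ℝ (toL2 μ f) (toL2 μ g) = ∫ x, f x * g x ∂μ := by
  rw [toL2_of_memLp hf, toL2_of_memLp hg, inner_toLp_toLp]

theorem norm_toL2_sq {μ : Measure ℝ} {f : ℝ → ℝ} (hf : MemLp f 2 μ) :
    ‖toL2 μ f‖ ^ 2 = ∫ x, f x ^ 2 ∂μ := by
  rw [toL2_of_memLp hf, norm_toLp_sq]

theorem inner_one {μ : Measure ℝ} [IsFiniteMeasure μ] (F : Lp ℝ 2 μ) :
    inner ℝ (toL2 μ fun _ => 1) F = ∫ x, F x ∂μ := by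
  rw [inner_eq_integral_mul]
  refine integral_congr_ae ?_
  filter_upwards [toL2_ae_eq (memLp_const (μ := μ) (1 : ℝ))] with x hx
  rw [hx, one_mul]

theorem inner_one_toL2 {μ : Measure ℝ} [IsFiniteMeasure μ] {f : ℝ → ℝ} (hf : MemLp f 2 μ) :
    inner ℝ (toL2 μ fun _ => 1) (toL2 μ f) = ∫ x, f x ∂μ := by
  rw [inner_one, integral_congr_ae (toL2_ae_eq hf)]

theorem integral_mul_condExp_eq {P : Measure α} [IsProbabilityMeasure P] {m : MeasurableSpace α}
    (hm : m ≤ mα) {Z Y : α → ℝ} (hZ : StronglyMeasurable[m] Z) (hZY : Integrable (Z * Y) P)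
    (hY : Integrable Y P) : ∫ ω, Z ω * (P[Y | m]) ω ∂P = ∫ ω, Z ω * Y ω ∂P := by
  have h1 := condExp_mul_of_stronglyMeasurable_left hZ hZY hY
  have h2 := integral_condExp (μ := P) hm (f := Z * Y)
  rw [integral_congr_ae h1] at h2
  simpa using h2

end SquareIntegrable

/-! ### The transition semigroup of a stationary mixing Markov process -/

section Markov

variable {Ω : Type*} [mΩ : MeasurableSpace Ω] {P : Measure Ω} {μ : Measure ℝ}
  {X : ℝ≥0 → Ω → ℝ}

theorem integral_comp_measurePreserving {Y : Ω → ℝ} (h : MeasurePreserving Y P μ) {g : ℝ → ℝ}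
    (hg : AEStronglyMeasurable g μ) : ∫ ω, g (Y ω) ∂P = ∫ x, g x ∂μ := by
  obtain ⟨h, rfl⟩ := h
  exact (integral_map h.aemeasurable hg).symm

theorem IsStationary.measurePreserving (hs : IsStationary P X) (hm : ∀ t, Measurable (X t))
    (h0 : P.map (X 0) = μ) (t : ℝ≥0) : MeasurePreserving (X t) P μ := by
  refine ⟨hm t, ?_⟩
  have h1 := congrArg (fun m : Measure (ℝ≥0 → ℝ) => m.map fun p => p 0) (hs t)
  rw [Measure.map_map (measurable_pi_apply 0) (measurable_pi_lambda _ fun s => hm _),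
    Measure.map_map (measurable_pi_apply 0) (measurable_pi_lambda _ fun s => hm _)] at h1
  simpa [Function.comp_def, h0] using h1

theorem IsStationary.map_pair (hs : IsStationary P X) (hm : ∀ t, Measurable (X t)) (s t : ℝ≥0) :
    P.map (fun ω => (X s ω, X (s + t) ω)) = P.map (fun ω => (X 0 ω, X t ω)) := by
  have h1 := congrArg (fun m : Measure (ℝ≥0 → ℝ) => m.map fun p => (p 0, p t)) (hs s)
  have h2 : Measurable fun p : ℝ≥0 → ℝ => (p 0, p t) := by fun_prop
  rw [Measure.map_map h2 (measurable_pi_lambda _ fun s => hm _),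
    Measure.map_map h2 (measurable_pi_lambda _ fun s => hm _)] at h1
  simpa [Function.comp_def, add_comm] using h1

theorem inner_transitionOp (h : ∀ t, MeasurePreserving (X t) P μ) (t : ℝ≥0) (G F : Lp ℝ 2 μ) :
    inner ℝ G (transitionOp P μ X t F) = ∫ ω, G (X 0 ω) * F (X t ω) ∂P := by
  rw [transitionOp, ContinuousLinearMap.comp_apply, ContinuousLinearMap.adjoint_inner_right,
    inner_eq_integral_mul]
  refine integral_congr_ae ?_
  filter_upwards [evalOp_ae_eq (h 0) G, evalOp_ae_eq (h t) F] with ω h1 h2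
  rw [h1, h2]

theorem memLp_comp (h : ∀ t, MeasurePreserving (X t) P μ) (F : Lp ℝ 2 μ) (t : ℝ≥0) :
    MemLp (fun ω => F (X t ω)) 2 P :=
  (Lp.memLp F).comp_measurePreserving (h t)

theorem integral_mul_shift (h : ∀ t, MeasurePreserving (X t) P μ) (hs : IsStationary P X)
    (s t : ℝ≥0) {g f : ℝ → ℝ} (hg : AEStronglyMeasurable g μ) (hf : AEStronglyMeasurable f μ) :
    ∫ ω, g (X s ω) * f (X (s + t) ω) ∂P = ∫ ω, g (X 0 ω) * f (X t ω) ∂P := by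
  obtain ⟨g', hg', hgg⟩ := hg
  obtain ⟨f', hf', hff⟩ := hf
  have e : ∀ r u : ℝ≥0, ∫ ω, g (X r ω) * f (X u ω) ∂P = ∫ ω, g' (X r ω) * f' (X u ω) ∂P := by
    intro r u
    refine integral_congr_ae ?_
    filter_upwards [(h r).quasiMeasurePreserving.ae hgg, (h u).quasiMeasurePreserving.ae hff]
      with ω h1 h2
    rw [h1, h2]
  rw [e, e]
  have hm := fun t => (h t).measurable
  have hmeas : StronglyMeasurable fun p : ℝ × ℝ => g' p.1 * f' p.2 :=
    (hg'.comp_measurable measurable_fst).mul (hf'.comp_measurable measurable_snd)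
  have h1 := integral_map (μ := P) ((hm s).prodMk (hm (s + t))).aemeasurable
    hmeas.aestronglyMeasurable
  have h2 := integral_map (μ := P) ((hm 0).prodMk (hm t)).aemeasurable
    hmeas.aestronglyMeasurable
  rw [hs.map_pair hm] at h1
  rw [← h1, ← h2]

/-- By stationarity the pairs `(X_s, X_{s+t})` and `(X_0, X_t)` have the same law. This allows
conditional expectations given `X_s`, not only given `X_0`, to be read off from the transition
operator. -/
theorem transitionOp_shift (h : ∀ t, MeasurePreserving (X t) P μ) (hs : IsStationary P X)
    (s t : ℝ≥0) :
    transitionOp P μ (fun r => X (s + r)) t = transitionOp P μ X t := by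
  ext1 F
  refine ext_inner_left ℝ fun G => ?_
  rw [inner_transitionOp (fun t => h (s + t)), inner_transitionOp h, add_zero,
    integral_mul_shift h hs s t (Lp.aestronglyMeasurable G) (Lp.aestronglyMeasurable F)]

variable [IsProbabilityMeasure P]

omit [IsProbabilityMeasure P] in
theorem transitionOp_zero (h : ∀ t, MeasurePreserving (X t) P μ) (F : Lp ℝ 2 μ) :
    transitionOp P μ X 0 F = F := by
  refine ext_inner_left ℝ fun G => ?_
  rw [inner_transitionOp h, inner_eq_integral_mul]
  exact integral_comp_measurePreserving (h 0)
    ((Lp.aestronglyMeasurable G).mul (Lp.aestronglyMeasurable F))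

omit [IsProbabilityMeasure P] in
theorem norm_evalOp (h : ∀ t, MeasurePreserving (X t) P μ) (t : ℝ≥0) (F : Lp ℝ 2 μ) :
    ‖evalOp P μ (X t) F‖ = ‖F‖ := by
  unfold evalOp
  rw [dif_pos (h t)]
  exact (Lp.compMeasurePreservingₗᵢ ℝ (X t) (h t)).norm_map F

omit [IsProbabilityMeasure P] in
theorem norm_adjoint_evalOp_le (h : ∀ t, MeasurePreserving (X t) P μ) (t : ℝ≥0) (Y : Lp ℝ 2 P) :
    ‖ContinuousLinearMap.adjoint (evalOp P μ (X t)) Y‖ ≤ ‖Y‖ := by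
  refine (ContinuousLinearMap.le_opNorm _ _).trans ?_
  rw [LinearIsometryEquiv.norm_map]
  have : ‖evalOp P μ (X t)‖ ≤ 1 :=
    ContinuousLinearMap.opNorm_le_bound _ zero_le_one fun F => by rw [norm_evalOp h, one_mul]
  exact mul_le_of_le_one_left (norm_nonneg _) this

omit [IsProbabilityMeasure P] in
theorem norm_transitionOp_le (h : ∀ t, MeasurePreserving (X t) P μ) (t : ℝ≥0) (F : Lp ℝ 2 μ) :
    ‖transitionOp P μ X t F‖ ≤ ‖F‖ :=
  (norm_adjoint_evalOp_le h 0 _).trans (norm_evalOp h t F).le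

/-- Conditioning on the past at time `s` turns `E[G(X_0) F(X_{s+t})]` into `E[G(X_0) (P_t F)(X_s)]`.
The Markov property is available for bounded measurable functions only, hence the induction from
indicators to all of `L²(μ)`. -/
theorem transitionOp_add (h : ∀ t, MeasurePreserving (X t) P μ) (hs : IsStationary P X)
    {ℱ : Filtration ℝ≥0 mΩ} (hX : StronglyAdapted ℱ X) (hM : IsMarkov P ℱ X) (s t : ℝ≥0)
    (F : Lp ℝ 2 μ) :
    transitionOp P μ X (s + t) F = transitionOp P μ X s (transitionOp P μ X t F) := by
  induction F using Lp.induction (by norm_num : (2 : ℝ≥0∞) ≠ ∞) with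
  | @indicatorConst c B hB hBfin =>
    set F : Lp ℝ 2 μ := (Lp.simpleFunc.indicatorConst 2 hB hBfin.ne c : Lp ℝ 2 μ) with hF
    have hFae : (F : ℝ → ℝ) =ᵐ[μ] B.indicator fun _ => c := by
      rw [hF, Lp.simpleFunc.coe_indicatorConst]
      exact indicatorConstLp_coeFn
    refine ext_inner_left ℝ fun G => ?_
    rw [inner_transitionOp h, inner_transitionOp h]
    have hmark := hM s (s + t) le_self_add (B.indicator fun _ => c)
      (measurable_const.indicator hB) ⟨|c|, fun x => by
        by_cases hx : x ∈ B <;> simp [hx]⟩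
    have hae : ∀ u, (fun ω => F (X u ω)) =ᵐ[P] fun ω => B.indicator (fun _ => c) (X u ω) :=
      fun u => (h u).quasiMeasurePreserving.ae hFae
    have h1 := condExp_congr_ae (m := ℱ s) (hae (s + t))
    have h2 := condExp_congr_ae (m := MeasurableSpace.comap (X s) inferInstance) (hae (s + t))
    have h3 := transitionOp_comp_ae_eq_condExp (X := fun r => X (s + r)) (fun t => h (s + t)) t F
    rw [transitionOp_shift h hs] at h3
    simp only [add_zero] at h3
    have h4 : P[fun ω => F (X (s + t) ω) | ℱ s]
        =ᵐ[P] fun ω => transitionOp P μ X t F (X s ω) :=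
      h1.trans (hmark.trans (h2.symm.trans h3.symm))
    have hG : StronglyMeasurable[ℱ s] fun ω => G (X 0 ω) :=
      (Lp.stronglyMeasurable G).comp_measurable
        (((hX 0).mono (ℱ.mono zero_le)).measurable)
    have h5 := integral_mul_condExp_eq (P := P) (ℱ.le s) hG
      ((memLp_comp h G 0).integrable_mul (memLp_comp h F (s + t)))
      ((memLp_comp h F (s + t)).integrable one_le_two)
    rw [← h5]
    refine integral_congr_ae ?_
    filter_upwards [h4] with ω hω
    rw [hω]
  | add _ _ _ ih1 ih2 => simp only [map_add, ih1, ih2]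
  | isClosed => exact isClosed_eq (by fun_prop) (by fun_prop)

/-- For bounded continuous functions, path continuity and dominated convergence give convergence of
`g(X_t)` to `g(X_0)` in `L²(P)`, and the adjoint of evaluation at time zero is a contraction.
Density and contractivity do the rest. -/
theorem tendsto_transitionOp_zero (h : ∀ t, MeasurePreserving (X t) P μ)
    (hc : ∀ ω, Continuous fun t => X t ω) (F : Lp ℝ 2 μ) :
    Tendsto (fun t => transitionOp P μ X t F) (𝓝 0) (𝓝 F) := by
  have hμ : IsProbabilityMeasure μ := by
    rw [← (h 0).map_eq]
    exact Measure.isProbabilityMeasure_map (h 0).measurable.aemeasurable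
  -- bounded continuous functions
  have hbc : ∀ g : BoundedContinuousFunction ℝ ℝ,
      Tendsto (fun t => transitionOp P μ X t (BoundedContinuousFunction.toLp 2 μ ℝ g)) (𝓝 0)
        (𝓝 (BoundedContinuousFunction.toLp 2 μ ℝ g)) := by
    intro g
    set G := BoundedContinuousFunction.toLp 2 μ ℝ g with hG
    have hGae : (G : ℝ → ℝ) =ᵐ[μ] g := BoundedContinuousFunction.coeFn_toLp 2 μ ℝ g
    rw [tendsto_iff_norm_sub_tendsto_zero]
    have hle : ∀ t, ‖transitionOp P μ X t G - G‖
        ≤ √(∫ ω, (g (X t ω) - g (X 0 ω)) ^ 2 ∂P) := by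
      intro t
      have h1 : transitionOp P μ X t G - G = ContinuousLinearMap.adjoint (evalOp P μ (X 0))
          (evalOp P μ (X t) G - evalOp P μ (X 0) G) := by
        rw [map_sub]
        change transitionOp P μ X t G - G = transitionOp P μ X t G - transitionOp P μ X 0 G
        rw [transitionOp_zero h]
      rw [h1]
      refine (norm_adjoint_evalOp_le h 0 _).trans ?_
      refine Real.le_sqrt_of_sq_le ?_
      rw [← real_inner_self_eq_norm_sq, inner_eq_integral_mul]
      refine le_of_eq (integral_congr_ae ?_)
      filter_upwards [Lp.coeFn_sub (evalOp P μ (X t) G) (evalOp P μ (X 0) G),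
        evalOp_ae_eq (h t) G, evalOp_ae_eq (h 0) G, (h t).quasiMeasurePreserving.ae hGae,
        (h 0).quasiMeasurePreserving.ae hGae] with ω e1 e2 e3 e4 e5
      rw [e1, Pi.sub_apply, e2, e3, e4, e5, sq]
    have hlim : Tendsto (fun t => ∫ ω, (g (X t ω) - g (X 0 ω)) ^ 2 ∂P) (𝓝 0)
        (𝓝 (∫ ω, (0 : ℝ) ∂P)) := by
      refine tendsto_integral_filter_of_dominated_convergence (fun _ => (2 * ‖g‖) ^ 2) ?_ ?_
        (integrable_const _) ?_
      · refine .of_forall fun t => ?_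
        have hm := fun t => (h t).measurable
        exact (((g.continuous.measurable.comp (hm t)).sub
          (g.continuous.measurable.comp (hm 0))).pow_const 2).aestronglyMeasurable
      · refine .of_forall fun t => .of_forall fun ω => ?_
        rw [norm_pow]
        gcongr
        calc _ ≤ ‖g (X t ω)‖ + ‖g (X 0 ω)‖ := norm_sub_le _ _
          _ ≤ ‖g‖ + ‖g‖ := add_le_add (g.norm_coe_le_norm _) (g.norm_coe_le_norm _)
          _ = _ := by ring
      · refine .of_forall fun ω => ?_
        have h1 : Continuous fun t => (g (X t ω) - g (X 0 ω)) ^ 2 :=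
          ((g.continuous.comp (hc ω)).sub continuous_const).pow 2
        simpa using h1.tendsto 0
    have hsq := (Real.continuous_sqrt.tendsto _).comp hlim
    simp only [integral_zero, Real.sqrt_zero] at hsq
    exact squeeze_zero (fun _ => norm_nonneg _) hle hsq
  have hdense := BoundedContinuousFunction.toLp_denseRange (E := ℝ) (p := 2) μ ℝ (by norm_num)
  rw [Metric.tendsto_nhds]
  intro ε hε
  obtain ⟨g, hg⟩ := hdense.exists_dist_lt F (show 0 < ε / 3 by positivity)
  filter_upwards [Metric.tendsto_nhds.1 (hbc g) (ε / 3) (by positivity)] with t ht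
  set G := BoundedContinuousFunction.toLp 2 μ ℝ g
  have h1 : dist (transitionOp P μ X t F) (transitionOp P μ X t G) ≤ dist F G := by
    rw [dist_eq_norm, dist_eq_norm, ← map_sub]
    exact norm_transitionOp_le h t _
  have h2 := dist_triangle4 (transitionOp P μ X t F) (transitionOp P μ X t G) G F
  rw [dist_comm G F] at h2
  linarith

/-- Cauchy–Schwarz bounds the correlations by one, so the supremum is a genuine one; it also gives
zero covariance in the degenerate case, where the quotient is a default value. -/
theorem abs_covariance_le_maxCorrelation {m₁ m₂ : MeasurableSpace Ω} {Y Z : Ω → ℝ}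
    (hY : StronglyMeasurable[m₁] Y) (hZ : StronglyMeasurable[m₂] Z) (hY2 : MemLp Y 2 P)
    (hZ2 : MemLp Z 2 P) :
    |cov[Y, Z; P]| ≤ maxCorrelation (mΩ := mΩ) P m₁ m₂ * (√(Var[Y; P]) * √(Var[Z; P])) := by
  have hb := abs_covariance_le hY2 hZ2
  rcases eq_or_lt_of_le (show 0 ≤ √(Var[Y; P]) * √(Var[Z; P]) by positivity) with h0 | h0
  · rw [← h0] at hb ⊢
    linarith
  · rw [← div_le_iff₀ h0]
    unfold maxCorrelation
    refine le_csSup ⟨1, ?_⟩ ⟨Y, Z, hY, hZ, hY2, hZ2, rfl⟩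
    rintro _ ⟨Y', Z', -, -, hY', hZ', rfl⟩
    exact div_le_one_of_le₀ (abs_covariance_le hY' hZ') (by positivity)

/-- For `G = P_t F` with `F` of mean zero, the covariance of `G(X_0)` and `F(X_t)` equals `‖G‖²`.
The maximal correlation bounds it by `ρ ‖G‖ ‖F‖`, and one factor `‖G‖` cancels. -/
theorem norm_transitionOp_le_maxCorrelation (h : ∀ t, MeasurePreserving (X t) P μ) (t : ℝ≥0)
    (F : Lp ℝ 2 μ) (hF : ∫ x, F x ∂μ = 0) :
    ‖transitionOp P μ X t F‖ ≤ maxCorrelation P (MeasurableSpace.comap (X 0) inferInstance)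
      (MeasurableSpace.comap (X t) inferInstance) * ‖F‖ := by
  set G := transitionOp P μ X t F with hG
  have hint : ∀ (u : ℝ≥0) (H : Lp ℝ 2 μ), ∫ ω, H (X u ω) ∂P = ∫ x, H x ∂μ := fun u H =>
    integral_comp_measurePreserving (h u) (Lp.aestronglyMeasurable H)
  have hsm : ∀ (u : ℝ≥0) (H : Lp ℝ 2 μ),
      StronglyMeasurable[MeasurableSpace.comap (X u) inferInstance] fun ω => H (X u ω) :=
    fun u H => (Lp.stronglyMeasurable H).comp_measurable (comap_measurable (X u))
  have hvar : ∀ (u : ℝ≥0) (H : Lp ℝ 2 μ), Var[fun ω => H (X u ω); P] ≤ ‖H‖ ^ 2 := fun u H => by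
    refine (variance_le_expectation_sq (memLp_comp h H u).1).trans (le_of_eq ?_)
    rw [← real_inner_self_eq_norm_sq, inner_eq_integral_mul,
      ← integral_comp_measurePreserving (h u) (g := fun x => H x * H x)
        ((Lp.aestronglyMeasurable H).mul (Lp.aestronglyMeasurable H))]
    simp [sq]
  have hstd : ∀ (u : ℝ≥0) (H : Lp ℝ 2 μ), √(Var[fun ω => H (X u ω); P]) ≤ ‖H‖ := fun u H =>
    Real.sqrt_le_iff.2 ⟨norm_nonneg _, hvar u H⟩
  have h1 := abs_covariance_le_maxCorrelation (hsm 0 G) (hsm t F) (memLp_comp h G 0)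
    (memLp_comp h F t)
  have h2 : cov[fun ω => G (X 0 ω), fun ω => F (X t ω); P] = ‖G‖ ^ 2 := by
    rw [covariance_eq_sub (memLp_comp h G 0) (memLp_comp h F t), hint t F, hF, mul_zero, sub_zero,
      ← real_inner_self_eq_norm_sq]
    conv_rhs => rw [hG, inner_transitionOp h]
    rfl
  set ρ := maxCorrelation P (MeasurableSpace.comap (X 0) inferInstance)
      (MeasurableSpace.comap (X t) inferInstance) with hρ
  have hρ0 : 0 ≤ ρ := by
    refine Real.sSup_nonneg ?_
    rintro _ ⟨Y', Z', -, -, -, -, rfl⟩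
    positivity
  rw [h2, abs_of_nonneg (sq_nonneg _)] at h1
  have h3 : ‖G‖ ^ 2 ≤ ρ * (‖G‖ * ‖F‖) := by
    refine h1.trans (mul_le_mul_of_nonneg_left ?_ hρ0)
    exact mul_le_mul (hstd 0 G) (hstd t F) (Real.sqrt_nonneg _) (norm_nonneg _)
  rcases eq_or_lt_of_le (norm_nonneg G) with h4 | h4
  · rw [← h4]; positivity
  · refine le_of_mul_le_mul_left ?_ h4
    nlinarith

/-- The transition semigroup of a stationary `ρ`-mixing Markov process with continuous paths. -/
theorem isMixingSemigroup_transitionOp (h : ∀ t, MeasurePreserving (X t) P μ)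
    (hs : IsStationary P X) {ℱ : Filtration ℝ≥0 mΩ} (hX : StronglyAdapted ℱ X)
    (hM : IsMarkov P ℱ X) (hc : ∀ ω, Continuous fun t => X t ω) (hmix : IsRhoMixing P X) :
    IsMixingSemigroup (transitionOp P μ X) (toL2 μ fun _ => 1) := by
  have hμ : IsProbabilityMeasure μ := by
    rw [← (h 0).map_eq]
    exact Measure.isProbabilityMeasure_map (h 0).measurable.aemeasurable
  have h1 : MemLp (fun _ : ℝ => (1 : ℝ)) 2 μ := memLp_const 1
  have hone : ∀ u, (fun ω => (toL2 μ fun _ => (1 : ℝ)) (X u ω)) =ᵐ[P] fun _ => 1 := fun u =>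
    (h u).quasiMeasurePreserving.ae (toL2_ae_eq h1)
  have hint : ∀ (u : ℝ≥0) (H : Lp ℝ 2 μ), ∫ ω, H (X u ω) ∂P = ∫ x, H x ∂μ := fun u H =>
    integral_comp_measurePreserving (h u) (Lp.aestronglyMeasurable H)
  refine ⟨transitionOp_zero h, transitionOp_add h hs hX hM, norm_transitionOp_le h,
    tendsto_transitionOp_zero h hc, ?_, fun t => ?_, fun t F => ?_, ?_⟩
  · have := norm_toL2_sq h1
    simp only [one_pow, integral_const, probReal_univ, smul_eq_mul, mul_one] at this
    exact (pow_eq_one_iff_of_nonneg (norm_nonneg _) two_ne_zero).1 this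
  · refine ext_inner_left ℝ fun G => ?_
    rw [inner_transitionOp h, real_inner_comm, inner_one, ← hint 0]
    refine integral_congr_ae ?_
    filter_upwards [hone t] with ω hω
    rw [hω, mul_one]
  · rw [inner_transitionOp h, inner_one, ← hint t]
    refine integral_congr_ae ?_
    filter_upwards [hone 0] with ω hω
    rw [hω, one_mul]
  · have h2 : ∀ᶠ t : ℝ≥0 in atTop, maxCorrelation P (MeasurableSpace.comap (X 0) inferInstance)
      (MeasurableSpace.comap (X t) inferInstance) < 1 / 2 :=
      hmix.eventually (gt_mem_nhds (by norm_num))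
    obtain ⟨t, ht, ht0⟩ := (h2.and (eventually_gt_atTop 0)).exists
    refine ⟨t, ht0, fun F hF => ?_⟩
    rw [inner_one] at hF
    refine (norm_transitionOp_le_maxCorrelation h t F hF).trans ?_
    gcongr

end Markov

/-! ### The martingale identity for twice continuously differentiable test functions -/

/-- The operator `w ↦ a w + (1/2) b² w'`, so that `diffOp a b φ = firstOrderOp a b φ'`. -/
def firstOrderOp (a b w : ℝ → ℝ) (x : ℝ) : ℝ := a x * w x + 1 / 2 * b x ^ 2 * deriv w x

theorem diffOp_eq_firstOrderOp (a b φ : ℝ → ℝ) : diffOp a b φ = firstOrderOp a b (deriv φ) := by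
  ext x
  rw [diffOp, firstOrderOp, iteratedDeriv_succ, iteratedDeriv_one]

section TestFunctions

variable {S : Set ℝ} {a b : ℝ → ℝ}

theorem tsupport_firstOrderOp_subset (w : ℝ → ℝ) : tsupport (firstOrderOp a b w) ⊆ tsupport w := by
  refine closure_minimal (fun x hx => ?_) (isClosed_tsupport w)
  by_contra h
  refine hx ?_
  have h1 : deriv w x = 0 := by
    by_contra h2
    exact h (support_deriv_subset (𝕜 := ℝ) h2)
  rw [firstOrderOp, image_eq_zero_of_notMem_tsupport h, h1]
  ring

theorem hasCompactSupport_firstOrderOp {w : ℝ → ℝ} (hw : HasCompactSupport w) :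
    HasCompactSupport (firstOrderOp a b w) :=
  hw.of_isClosed_subset (isClosed_tsupport _) (tsupport_firstOrderOp_subset w)

theorem continuous_firstOrderOp (hS : IsOpen S) (ha : ContinuousOn a S) (hb : ContinuousOn b S)
    {w : ℝ → ℝ} (hw : ContDiff ℝ 1 w) (hwS : tsupport w ⊆ S) :
    Continuous (firstOrderOp a b w) := by
  refine ContinuousOn.continuous_of_tsupport_subset (s := S) ?_ hS
    ((tsupport_firstOrderOp_subset w).trans hwS)
  have h1 := hw.continuous.continuousOn (s := S)
  have h2 := (hw.continuous_deriv le_rfl).continuousOn (s := S)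
  exact (ha.mul h1).add ((continuousOn_const.mul (hb.pow 2)).mul h2)

/-- Approximation in `C²` by smooth functions, uniformly for a differential operator. -/
theorem exists_smooth_approx (hS : IsOpen S) (ha : ContinuousOn a S) (hb : ContinuousOn b S)
    {φ : ℝ → ℝ} (hφ : ContDiff ℝ 2 φ) (hφc : HasCompactSupport φ) (hφS : tsupport φ ⊆ S)
    {ε : ℝ} (hε : 0 < ε) :
    ∃ ψ : ℝ → ℝ, ContDiff ℝ (⊤ : ℕ∞) ψ ∧ HasCompactSupport ψ ∧ tsupport ψ ⊆ S ∧
      ∀ x, |ψ x - φ x| ≤ ε ∧ |diffOp a b ψ x - diffOp a b φ x| ≤ ε := by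
  obtain ⟨δ₁, hδ₁, hK⟩ := hφc.isCompact.exists_cthickening_subset_open hS hφS
  set K := Metric.cthickening δ₁ (tsupport φ) with hKdef
  have hKc : IsCompact K := hφc.isCompact.cthickening
  obtain ⟨Ca, hCa⟩ := hKc.exists_bound_of_continuousOn (ha.mono hK)
  obtain ⟨Cb, hCb⟩ := hKc.exists_bound_of_continuousOn (hb.mono hK)
  -- Accuracy `ε / D` for the function and its first two derivatives makes both errors at most `ε`,
  -- since `D` dominates the coefficients of the operator on `K`.
  set D := 1 + |Ca| + Cb ^ 2 with hD
  have hD0 : 0 < D := by positivity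
  have hφ1 : ContDiff ℝ 1 (deriv φ) := by
    have : ContDiff ℝ (1 + 1) φ := by simpa [one_add_one_eq_two] using hφ
    exact (contDiff_succ_iff_deriv.1 this).2.2
  have hd0 := hφ.continuous
  have hd1 := hφ1.continuous
  have hd2 := hφ1.continuous_deriv le_rfl
  have hc1 : HasCompactSupport (deriv φ) := hφc.deriv
  have hc2 : HasCompactSupport (deriv (deriv φ)) := hc1.deriv
  have hη : 0 < ε / D := div_pos hε hD0
  have huc : ∀ g : ℝ → ℝ, Continuous g → HasCompactSupport g →
      ∃ δ > 0, ∀ x y, dist x y < δ → dist (g x) (g y) ≤ ε / D := by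
    intro g hg hgc
    obtain ⟨δ, hδ, h⟩ := Metric.uniformContinuous_iff.1
      (hgc.uniformContinuous_of_continuous hg) _ hη
    exact ⟨δ, hδ, fun x y hxy => (h hxy).le⟩
  obtain ⟨e0, he0, h0⟩ := huc φ hd0 hφc
  obtain ⟨e1, he1, h1⟩ := huc _ hd1 hc1
  obtain ⟨e2, he2, h2⟩ := huc _ hd2 hc2
  -- The mollification radius is below the three moduli of continuity and below the margin that
  -- keeps the support inside `K ⊆ S`.
  set r := min δ₁ (min e0 (min e1 e2)) with hr
  have hr0 : 0 < r := by positivity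
  let ρ : ContDiffBump (0 : ℝ) := ⟨r / 2, r, by positivity, by linarith⟩
  have hρl : LocallyIntegrable (ρ.normed volume) := ρ.continuous_normed.locallyIntegrable
  let L := ContinuousLinearMap.lsmul ℝ ℝ (E := ℝ)
  let cv : (ℝ → ℝ) → ℝ → ℝ := fun g => convolution (ρ.normed volume) g L volume
  have hder : ∀ g, HasCompactSupport g → ContDiff ℝ 1 g → deriv (cv g) = cv (deriv g) :=
    fun g hgc hg => funext fun x => (hgc.hasDerivAt_convolution_right L hρl hg x).deriv
  have hψ1 : deriv (cv φ) = cv (deriv φ) := hder φ hφc (hφ.of_le (by norm_num))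
  have hψ2 : deriv (deriv (cv φ)) = cv (deriv (deriv φ)) := by
    rw [hψ1, hder _ hc1 hφ1]
  have hsupp : tsupport (cv φ) ⊆ K := by
    refine closure_minimal ?_ Metric.isClosed_cthickening
    refine (support_convolution_subset L).trans ?_
    rintro _ ⟨u, hu, v, hv, rfl⟩
    rw [ρ.support_normed_eq, mem_ball_zero_iff] at hu
    refine Metric.mem_cthickening_of_dist_le _ v _ _ (subset_tsupport _ hv) ?_
    rw [dist_eq_norm, add_sub_cancel_right]
    exact hu.le.trans (min_le_left _ _)
  have hclose : ∀ g e, Continuous g → r ≤ e →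
      (∀ x y, dist x y < e → dist (g x) (g y) ≤ ε / D) → ∀ x, |cv g x - g x| ≤ ε / D := by
    intro g e hg hre h x
    have := ContDiffBump.dist_normed_convolution_le (φ := ρ) (μ := volume) (x₀ := x) (ε := ε / D)
      hg.aestronglyMeasurable fun y hy => h y x (lt_of_lt_of_le hy hre)
    rwa [Real.dist_eq] at this
  have hr' := min_le_right δ₁ (min e0 (min e1 e2))
  have k0 := hclose φ e0 hd0 (hr'.trans (min_le_left _ _)) h0
  have k1 := hclose _ e1 hd1 (hr'.trans ((min_le_right _ _).trans (min_le_left _ _))) h1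
  have k2 := hclose _ e2 hd2 (hr'.trans ((min_le_right _ _).trans (min_le_right _ _))) h2
  have hψc : HasCompactSupport (cv φ) :=
    hKc.of_isClosed_subset (isClosed_tsupport _) hsupp
  have hηD : ε / D * D = ε := div_mul_cancel₀ _ hD0.ne'
  refine ⟨cv φ, ?_, hψc, hsupp.trans hK, fun x => ⟨?_, ?_⟩⟩
  · exact ρ.hasCompactSupport_normed.contDiff_convolution_left L ρ.contDiff_normed
      hd0.locallyIntegrable
  · refine (k0 x).trans ((div_le_iff₀ hD0).2 ?_)
    have : 1 ≤ D := by
      have := abs_nonneg Ca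
      nlinarith [sq_nonneg Cb]
    nlinarith
  · rw [diffOp_eq_firstOrderOp, diffOp_eq_firstOrderOp]
    by_cases hx : x ∈ K
    · have ea : |a x| ≤ |Ca| := (hCa x hx).trans (le_abs_self _)
      have eb : b x ^ 2 ≤ Cb ^ 2 := by
        have := hCb x hx
        rw [Real.norm_eq_abs] at this
        exact sq_le_sq' (by linarith [neg_abs_le (b x)]) (by linarith [le_abs_self (b x)])
      have e3 : firstOrderOp a b (deriv (cv φ)) x - firstOrderOp a b (deriv φ) x
          = a x * (cv (deriv φ) x - deriv φ x)
            + 1 / 2 * b x ^ 2 * (cv (deriv (deriv φ)) x - deriv (deriv φ) x) := by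
        rw [firstOrderOp, firstOrderOp, hψ2, hψ1]; ring
      rw [e3]
      calc _ ≤ |a x| * |cv (deriv φ) x - deriv φ x|
            + 1 / 2 * b x ^ 2 * |cv (deriv (deriv φ)) x - deriv (deriv φ) x| := by
              refine (abs_add_le _ _).trans (le_of_eq ?_)
              rw [abs_mul, abs_mul, abs_of_nonneg (show 0 ≤ 1 / 2 * b x ^ 2 by positivity)]
        _ ≤ |Ca| * (ε / D) + Cb ^ 2 * (ε / D) := by
              refine add_le_add (mul_le_mul ea (k1 x) (abs_nonneg _) (abs_nonneg _)) ?_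
              refine mul_le_mul ?_ (k2 x) (abs_nonneg _) (sq_nonneg _)
              nlinarith [sq_nonneg (b x)]
        _ ≤ ε := by
              conv_rhs => rw [← hηD, hD]
              nlinarith
    · have h3 : x ∉ tsupport φ := fun h => hx (Metric.self_subset_cthickening _ h)
      have e1 : firstOrderOp a b (deriv (cv φ)) x = 0 :=
        image_eq_zero_of_notMem_tsupport fun h => hx (hsupp
          (tsupport_deriv_subset (𝕜 := ℝ) (tsupport_firstOrderOp_subset _ h)))
      have e2 : firstOrderOp a b (deriv φ) x = 0 :=
        image_eq_zero_of_notMem_tsupport fun h => h3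
          (tsupport_deriv_subset (𝕜 := ℝ) (tsupport_firstOrderOp_subset _ h))
      rw [e1, e2]
      simpa using hε.le

end TestFunctions

section WeakSolution

variable {Ω : Type*} [mΩ : MeasurableSpace Ω] {X : ℝ≥0 → Ω → ℝ}

theorem measurable_comp_of_continuousOn {S : Set ℝ} {h : ℝ → ℝ} (hh : ContinuousOn h S)
    {Y : Ω → ℝ} (hY : Measurable Y) (hmem : ∀ ω, Y ω ∈ S) : Measurable fun ω => h (Y ω) :=
  (continuousOn_iff_continuous_domRestrict.1 hh).measurable.comp (hY.subtype_mk (h := hmem))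

theorem measurable_uncurry_path (hX : ∀ t, Measurable (X t))
    (hc : ∀ ω, Continuous fun t => X t ω) {h : ℝ → ℝ} (hh : Continuous h) :
    Measurable (Function.uncurry fun (u : ℝ) ω => h (X u.toNNReal ω)) :=
  measurable_uncurry_of_continuous_of_measurable
    (fun ω => hh.comp ((hc ω).comp continuous_real_toNNReal))
    (fun _ => hh.measurable.comp (hX _))

theorem measurable_integral_path (hX : ∀ t, Measurable (X t))
    (hc : ∀ ω, Continuous fun t => X t ω) {h : ℝ → ℝ} (hh : Continuous h) (s t : ℝ) :
    Measurable fun ω => ∫ u in s..t, h (X u.toNNReal ω) := by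
  simp only [intervalIntegral.intervalIntegral_eq_integral_uIoc]
  have h1 := (measurable_uncurry_path hX hc hh).stronglyMeasurable.integral_prod_left'
    (μ := volume.restrict (Set.uIoc s t))
  exact h1.measurable.const_smul (if s ≤ t then (1 : ℝ) else -1)

/-- The increment over `[s, t]` of `v(X) - ∫ g(X_u) du`. -/
def increment (X : ℝ≥0 → Ω → ℝ) (v g : ℝ → ℝ) (s t : ℝ≥0) (ω : Ω) : ℝ :=
  v (X t ω) - v (X s ω) - ∫ u in (s : ℝ)..t, g (X u.toNNReal ω)

omit mΩ in
theorem intervalIntegrable_path (hc : ∀ ω, Continuous fun t => X t ω) {g : ℝ → ℝ}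
    (hg : Continuous g) (ω : Ω) (s t : ℝ) :
    IntervalIntegrable (fun u : ℝ => g (X u.toNNReal ω)) volume s t :=
  (hg.comp ((hc ω).comp continuous_real_toNNReal)).intervalIntegrable _ _

omit mΩ in
theorem increment_add (hc : ∀ ω, Continuous fun t => X t ω) (v : ℝ → ℝ) {g : ℝ → ℝ}
    (hg : Continuous g) (r s t : ℝ≥0) (ω : Ω) :
    increment X v g r s ω + increment X v g s t ω = increment X v g r t ω := by
  rw [increment, increment, increment, ← intervalIntegral.integral_add_adjacent_intervals
    (intervalIntegrable_path hc hg ω r s) (intervalIntegrable_path hc hg ω s t)]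
  ring

theorem measurable_increment (hX : ∀ t, Measurable (X t)) (hc : ∀ ω, Continuous fun t => X t ω)
    {v g : ℝ → ℝ} (hv : Continuous v) (hg : Continuous g) (s t : ℝ≥0) :
    Measurable (increment X v g s t) :=
  ((hv.measurable.comp (hX t)).sub (hv.measurable.comp (hX s))).sub
    (measurable_integral_path hX hc hg _ _)

omit mΩ in
theorem abs_increment_le {v g : ℝ → ℝ} {Cv Cg : ℝ} (hv : ∀ x, |v x| ≤ Cv) (hg : ∀ x, |g x| ≤ Cg)
    {s t : ℝ≥0} (hst : s ≤ t) (ω : Ω) :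
    |increment X v g s t ω| ≤ 2 * Cv + Cg * (t - s) := by
  have h1 : |∫ u in (s : ℝ)..t, g (X u.toNNReal ω)| ≤ Cg * |(t : ℝ) - s| := by
    rw [← Real.norm_eq_abs]
    exact intervalIntegral.norm_integral_le_of_norm_le_const fun u _ => hg _
  rw [abs_of_nonneg (sub_nonneg.2 (NNReal.coe_le_coe.2 hst))] at h1
  have h2 := hv (X t ω)
  have h3 := hv (X s ω)
  rw [increment]
  rw [abs_le] at *
  constructor <;> linarith [h1.1, h1.2, h2.1, h2.2, h3.1, h3.2]

variable {P : Measure Ω} [IsProbabilityMeasure P] {ℱ : Filtration ℝ≥0 mΩ} {S : Set ℝ}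
  {a b : ℝ → ℝ} {μ : Measure ℝ}

omit [IsProbabilityMeasure P] in
theorem IsWeakSolution.measurable (hW : IsWeakSolution S a b μ P ℱ X) (t : ℝ≥0) :
    Measurable (X t) :=
  ((hW.adapted t).mono (ℱ.le t)).measurable

/-- This is the martingale property tested against an integrable `Z` known at time `s`; boundedness
of the martingale at each fixed time makes the products integrable. -/
theorem IsWeakSolution.integral_mul_increment_smooth (hW : IsWeakSolution S a b μ P ℱ X)
    (hS : IsOpen S) (ha : ContinuousOn a S) (hb : ContinuousOn b S) {φ : ℝ → ℝ}
    (hφ : ContDiff ℝ (⊤ : ℕ∞) φ) (hφc : HasCompactSupport φ) (hφS : tsupport φ ⊆ S)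
    {s t : ℝ≥0} (hst : s ≤ t) {Z : Ω → ℝ} (hZ : StronglyMeasurable[ℱ s] Z) (hZi : Integrable Z P) :
    ∫ ω, Z ω * increment X φ (diffOp a b φ) s t ω ∂P = 0 := by
  have hd1 : ContDiff ℝ 1 (deriv φ) :=
    ((contDiff_succ_iff_deriv (n := 1)).1 (by exact_mod_cast contDiff_infty.1 hφ 2)).2.2
  have hgc : Continuous (diffOp a b φ) := by
    rw [diffOp_eq_firstOrderOp]
    exact continuous_firstOrderOp hS ha hb hd1 ((tsupport_deriv_subset (𝕜 := ℝ)).trans hφS)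
  obtain ⟨Cv, hCv⟩ := hφc.exists_bound_of_continuous hφ.continuous
  have hgcs : HasCompactSupport (diffOp a b φ) := by
    rw [diffOp_eq_firstOrderOp]
    exact hasCompactSupport_firstOrderOp hφc.deriv
  obtain ⟨Cg, hCg⟩ := hgcs.exists_bound_of_continuous hgc
  have hmart := hW.martingale φ hφ hφc hφS
  set M : ℝ≥0 → Ω → ℝ := fun (t : ℝ≥0) ω =>
      φ (X t ω) - ∫ s in (0 : ℝ)..t, diffOp a b φ (X s.toNNReal ω) with hM
  have hinc : ∀ ω, increment X φ (diffOp a b φ) s t ω = M t ω - M s ω := by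
    intro ω
    rw [increment, hM]
    simp only
    rw [← intervalIntegral.integral_add_adjacent_intervals
      (intervalIntegrable_path hW.continuous_paths hgc ω 0 s)
      (intervalIntegrable_path hW.continuous_paths hgc ω s t)]
    ring
  have hMb : ∀ r : ℝ≥0, ∀ ω, ‖M r ω‖ ≤ Cv + Cg * |(r : ℝ) - 0| := by
    intro r ω
    refine (norm_sub_le _ _).trans (add_le_add (hCv _) ?_)
    exact intervalIntegral.norm_integral_le_of_norm_le_const fun u _ => hCg _
  have hMm : ∀ r, AEStronglyMeasurable (M r) P := fun r =>
    ((hmart.1 r).mono (ℱ.le r)).aestronglyMeasurable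
  have hZM : ∀ r, Integrable (Z * M r) P := fun r =>
    hZi.mul_bdd (hMm r) (.of_forall (hMb r))
  have hMi : ∀ r, Integrable (M r) P := fun r => hmart.integrable r
  simp only [hinc, mul_sub]
  rw [integral_sub (f := fun ω => Z ω * M t ω) (g := fun ω => Z ω * M s ω) (hZM t) (hZM s), ← integral_mul_condExp_eq (ℱ.le s) hZ (hZM t) (hMi t)]
  rw [sub_eq_zero]
  refine integral_congr_ae ?_
  filter_upwards [hmart.2 s t hst] with ω hω
  rw [hω]

/-- The martingale identity for test functions in `C²_c(S)`. -/
theorem IsWeakSolution.integral_mul_increment_compact (hW : IsWeakSolution S a b μ P ℱ X)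
    (hS : IsOpen S) (ha : ContinuousOn a S) (hb : ContinuousOn b S) {φ : ℝ → ℝ}
    (hφ : ContDiff ℝ 2 φ) (hφc : HasCompactSupport φ) (hφS : tsupport φ ⊆ S)
    {s t : ℝ≥0} (hst : s ≤ t) {Z : Ω → ℝ} (hZ : StronglyMeasurable[ℱ s] Z) (hZi : Integrable Z P) :
    ∫ ω, Z ω * increment X φ (diffOp a b φ) s t ω ∂P = 0 := by
  have hcont : ∀ ψ : ℝ → ℝ, ContDiff ℝ 2 ψ → HasCompactSupport ψ → tsupport ψ ⊆ S →
      Continuous (diffOp a b ψ) ∧ HasCompactSupport (diffOp a b ψ) := by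
    intro ψ hψ hψc hψS
    have hd1 : ContDiff ℝ 1 (deriv ψ) :=
      ((contDiff_succ_iff_deriv (n := 1)).1 (by simpa [one_add_one_eq_two] using hψ)).2.2
    rw [diffOp_eq_firstOrderOp]
    exact ⟨continuous_firstOrderOp hS ha hb hd1 ((tsupport_deriv_subset (𝕜 := ℝ)).trans hψS),
      hasCompactSupport_firstOrderOp hψc.deriv⟩
  have hint : ∀ ψ : ℝ → ℝ, ContDiff ℝ 2 ψ → HasCompactSupport ψ → tsupport ψ ⊆ S →
      Integrable (fun ω => Z ω * increment X ψ (diffOp a b ψ) s t ω) P := by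
    intro ψ hψ hψc hψS
    obtain ⟨h1, h2⟩ := hcont ψ hψ hψc hψS
    obtain ⟨Cv, hCv⟩ := hψc.exists_bound_of_continuous hψ.continuous
    obtain ⟨Cg, hCg⟩ := h2.exists_bound_of_continuous h1
    exact hZi.mul_bdd (measurable_increment hW.measurable hW.continuous_paths hψ.continuous
      h1 s t).aestronglyMeasurable (.of_forall (abs_increment_le hCv hCg hst))
  set C := ∫ ω, |Z ω| ∂P with hC
  have hC0 : 0 ≤ C := integral_nonneg fun ω => abs_nonneg _
  have hst' : (0 : ℝ) ≤ t - s := sub_nonneg.2 (NNReal.coe_le_coe.2 hst)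
  -- A smooth `ψ` that is `ε`-close to `φ`, operator included, changes the increment by at most `2ε`
  -- from the end points and `(t - s) ε` from the integral.
  have key : ∀ ε > 0, |∫ ω, Z ω * increment X φ (diffOp a b φ) s t ω ∂P|
      ≤ C * ((2 + (t - s)) * ε) := by
    intro ε hε
    obtain ⟨ψ, hψ, hψc, hψS, hψε⟩ := exists_smooth_approx hS ha hb hφ hφc hφS hε
    have hψ2 : ContDiff ℝ 2 ψ := by exact_mod_cast contDiff_infty.1 hψ 2
    have h0 := hW.integral_mul_increment_smooth hS ha hb hψ hψc hψS hst hZ hZi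
    have h1 : ∫ ω, Z ω * increment X φ (diffOp a b φ) s t ω ∂P
        = ∫ ω, Z ω * (increment X φ (diffOp a b φ) s t ω
          - increment X ψ (diffOp a b ψ) s t ω) ∂P := by
      simp only [mul_sub]
      rw [integral_sub (hint φ hφ hφc hφS) (hint ψ hψ2 hψc hψS), h0, sub_zero]
    rw [h1, hC, ← integral_mul_const, ← Real.norm_eq_abs]
    refine norm_integral_le_of_norm_le (hZi.abs.mul_const _) (.of_forall fun ω => ?_)
    rw [Real.norm_eq_abs, abs_mul]
    refine mul_le_mul_of_nonneg_left ?_ (abs_nonneg _)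
    have h2 : increment X φ (diffOp a b φ) s t ω - increment X ψ (diffOp a b ψ) s t ω
        = increment X (fun x => φ x - ψ x) (fun x => diffOp a b φ x - diffOp a b ψ x) s t ω := by
      rw [increment, increment, increment, intervalIntegral.integral_sub
        (intervalIntegrable_path hW.continuous_paths (hcont φ hφ hφc hφS).1 ω s t)
        (intervalIntegrable_path hW.continuous_paths (hcont ψ hψ2 hψc hψS).1 ω s t)]
      ring
    rw [h2]
    refine (abs_increment_le (Cv := ε) (Cg := ε) (fun x => ?_) (fun x => ?_) hst ω).trans
      (le_of_eq (by ring))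
    · rw [abs_sub_comm]; exact (hψε x).1
    · rw [abs_sub_comm]; exact (hψε x).2
  rw [← abs_nonpos_iff]
  refine le_of_forall_pos_le_add fun η hη => ?_
  rw [zero_add]
  have hB : 0 < C * (2 + (t - s)) + 1 := by positivity
  refine (key (η / (C * (2 + (t - s)) + 1)) (by positivity)).trans ?_
  rw [← mul_assoc, mul_div_assoc', div_le_iff₀ hB]
  nlinarith

end WeakSolution

/-! ### The martingale identity for test functions that are constant near the end points -/

theorem eq_of_hasDerivAt_of_eq_zero {v w : ℝ → ℝ} (hv : ∀ x, HasDerivAt v (w x) x) {x y : ℝ}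
    (hxy : x ≤ y) (hw : ∀ z ∈ Ioo x y, w z = 0) : v x = v y := by
  rcases hxy.eq_or_lt with rfl | hlt
  · rfl
  obtain ⟨c, hc, h⟩ := exists_hasDerivAt_eq_slope v w hlt
    (fun z _ => (hv z).continuousAt.continuousWithinAt) (fun z _ => hv z)
  rw [hw c hc, eq_comm, div_eq_zero_iff] at h
  rcases h with h | h <;> linarith

theorem exists_Icc_of_tsupport_subset {S : Set ℝ} (hne : S.Nonempty) {w : ℝ → ℝ}
    (hwc : HasCompactSupport w) (hwS : tsupport w ⊆ S) :
    ∃ k₁ ∈ S, ∃ k₂ ∈ S, k₁ ≤ k₂ ∧ tsupport w ⊆ Icc k₁ k₂ := by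
  obtain ⟨x₀, hx₀⟩ := hne
  -- Inserting a point of `S` covers the case of empty support.
  set K := insert x₀ (tsupport w) with hK
  have hKc : IsCompact K := hwc.isCompact.insert x₀
  have hKn : K.Nonempty := ⟨x₀, mem_insert _ _⟩
  have hKS : K ⊆ S := insert_subset hx₀ hwS
  refine ⟨sInf K, hKS (hKc.sInf_mem hKn), sSup K, hKS (hKc.sSup_mem hKn), ?_, fun x hx => ?_⟩
  · exact (csInf_le hKc.bddBelow (mem_insert _ _)).trans (le_csSup hKc.bddAbove (mem_insert x₀ _))
  · exact ⟨csInf_le hKc.bddBelow (mem_insert_of_mem _ hx),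
      le_csSup hKc.bddAbove (mem_insert_of_mem _ hx)⟩

theorem bounded_of_hasDerivAt {v w : ℝ → ℝ} (hv : ∀ x, HasDerivAt v (w x) x) {k₁ k₂ : ℝ}
    (hk : k₁ ≤ k₂) (hw : tsupport w ⊆ Icc k₁ k₂) :
    (∀ x ≤ k₁, v x = v k₁) ∧ (∀ x, k₂ ≤ x → v x = v k₂) ∧ ∃ C, ∀ x, |v x| ≤ C := by
  have hw0 : ∀ x, x ∉ Icc k₁ k₂ → w x = 0 := fun x hx =>
    image_eq_zero_of_notMem_tsupport fun h => hx (hw h)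
  have h1 : ∀ x ≤ k₁, v x = v k₁ := fun x hx =>
    eq_of_hasDerivAt_of_eq_zero hv hx fun z hz => hw0 z fun h => absurd h.1 (not_le.2 hz.2)
  have h2 : ∀ x, k₂ ≤ x → v x = v k₂ := fun x hx =>
    (eq_of_hasDerivAt_of_eq_zero hv hx fun z hz => hw0 z fun h => absurd h.2 (not_le.2 hz.1)).symm
  refine ⟨h1, h2, ?_⟩
  obtain ⟨C, hC⟩ := (isCompact_Icc (a := k₁) (b := k₂)).exists_bound_of_continuousOn (f := v)
    fun x _ => (hv x).continuousAt.continuousWithinAt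
  refine ⟨C, fun x => ?_⟩
  rcases le_or_gt x k₁ with h | h
  · rw [h1 x h]; exact hC _ (left_mem_Icc.2 hk)
  rcases le_or_gt k₂ x with h' | h'
  · rw [h2 x h']; exact hC _ (right_mem_Icc.2 hk)
  · exact hC x ⟨h.le, h'.le⟩

theorem contDiff_two_of_hasDerivAt {v w : ℝ → ℝ} (hv : ∀ x, HasDerivAt v (w x) x)
    (hw : ContDiff ℝ 1 w) : ContDiff ℝ 2 v := by
  have h : deriv v = w := funext fun x => (hv x).deriv
  have : ContDiff ℝ (1 + 1) v := by
    rw [contDiff_succ_iff_deriv]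
    exact ⟨fun x => (hv x).differentiableAt, by simp, h ▸ hw⟩
  simpa [one_add_one_eq_two] using this

/-- Over time intervals on which the path moves by at most `δ`, the increments for `v` are `0` or
coincide with those for a compactly supported function `φ`. -/
theorem exists_localisation {Ω : Type*} {S : Set ℝ} (hS : IsOpen S) (hSc : S.OrdConnected)
    (hne : S.Nonempty) (a b : ℝ → ℝ) {v w : ℝ → ℝ} (hw : ContDiff ℝ 1 w)
    (hwc : HasCompactSupport w) (hwS : tsupport w ⊆ S) (hv : ∀ x, HasDerivAt v (w x) x) :
    ∃ (φ : ℝ → ℝ) (k δ : ℝ), 0 < δ ∧ ContDiff ℝ 2 φ ∧ HasCompactSupport φ ∧ tsupport φ ⊆ S ∧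
      ∀ (X : ℝ≥0 → Ω → ℝ) (s t : ℝ≥0) (ω : Ω), s ≤ t → (∀ u ∈ Icc s t, |X u ω - X s ω| ≤ δ) →
        (X s ω ≤ k → increment X φ (diffOp a b φ) s t ω = increment X v (firstOrderOp a b w) s t ω)
        ∧ (k < X s ω → increment X v (firstOrderOp a b w) s t ω = 0) := by
  obtain ⟨k₁, hk₁, k₂, hk₂, hk, hsupp⟩ := exists_Icc_of_tsupport_subset hne hwc hwS
  obtain ⟨hleft, hright, -⟩ := bounded_of_hasDerivAt hv hk hsupp
  obtain ⟨η, hη, hball⟩ := Metric.isOpen_iff.1 hS k₂ hk₂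
  -- The margin to the right of `k₂` is divided into steps of length `δ`. The cut-off equals one
  -- below `k₂ + 3δ` and vanishes from `k₂ + 4δ ∈ S` on, and the threshold is `k₂ + δ`. A path that
  -- moves by at most `δ` stays below `k₂ + 3δ` if it starts at or below the threshold, and stays
  -- above `k₂`, where `v` is constant, if it starts beyond it.
  set δ := η / 8 with hδ
  have hδ0 : 0 < δ := by positivity
  have hk₃ : k₂ + 4 * δ ∈ S := hball (by
    rw [Metric.mem_ball, Real.dist_eq, add_sub_cancel_left, abs_of_pos (by positivity)]
    linarith)
  set χ : ℝ → ℝ := fun x => 1 - Real.smoothTransition ((x - (k₂ + 3 * δ)) / δ) with hχ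
  have hχ1 : ∀ x < k₂ + 3 * δ, χ x = 1 := fun x hx => by
    rw [hχ]
    simp only
    rw [Real.smoothTransition.zero_of_nonpos, sub_zero]
    exact div_nonpos_of_nonpos_of_nonneg (by linarith) hδ0.le
  have hχ0 : ∀ x, k₂ + 4 * δ ≤ x → χ x = 0 := fun x hx => by
    rw [hχ]
    simp only
    rw [Real.smoothTransition.one_of_one_le, sub_self]
    rw [one_le_div hδ0]
    linarith
  have hχs : ContDiff ℝ 2 χ := by
    refine contDiff_const.sub (Real.smoothTransition.contDiff.comp ?_)
    exact (contDiff_id.sub contDiff_const).div_const _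
  -- Subtracting the left constant makes `φ` vanish to the left of `k₁`; increments do not see the
  -- constant.
  set φ : ℝ → ℝ := fun x => (v x - v k₁) * χ x with hφ
  have hφs : tsupport φ ⊆ Icc k₁ (k₂ + 4 * δ) := by
    refine closure_minimal (fun x hx => ?_) isClosed_Icc
    by_contra h
    refine hx ?_
    simp only [hφ]
    rw [mem_Icc, not_and_or, not_le, not_le] at h
    rcases h with h | h
    · rw [hleft x h.le, sub_self, zero_mul]
    · rw [hχ0 x h.le, mul_zero]
  have heq : ∀ x < k₂ + 3 * δ, φ =ᶠ[𝓝 x] fun y => v y - v k₁ := fun x hx => by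
    filter_upwards [Iio_mem_nhds hx] with y hy
    rw [hφ]
    simp only
    rw [hχ1 y hy, mul_one]
  have hop : ∀ x < k₂ + 3 * δ, diffOp a b φ x = firstOrderOp a b w x := fun x hx => by
    have h1 : deriv φ =ᶠ[𝓝 x] w := by
      refine (heq x hx).deriv.trans (.of_forall fun y => ?_)
      rw [deriv_sub_const, (hv y).deriv]
    rw [diffOp_eq_firstOrderOp, firstOrderOp, firstOrderOp, h1.eq_of_nhds, h1.deriv_eq]
  refine ⟨φ, k₂ + δ, δ, hδ0, ?_, isCompact_Icc.of_isClosed_subset (isClosed_tsupport _) hφs,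
    hφs.trans (hSc.out hk₁ hk₃), fun X s t ω hst hosc => ⟨fun h => ?_, fun h => ?_⟩⟩
  · exact ((contDiff_two_of_hasDerivAt hv hw).sub contDiff_const).mul hχs
  · have hX : ∀ u ∈ Icc s t, X u ω < k₂ + 3 * δ := fun u hu => by
      have := (abs_le.1 (hosc u hu)).2
      linarith
    rw [increment, increment, (heq _ (hX t (right_mem_Icc.2 hst))).eq_of_nhds,
      (heq _ (hX s (left_mem_Icc.2 hst))).eq_of_nhds]
    congr 1
    · ring
    · refine intervalIntegral.integral_congr fun u hu => ?_
      rw [uIcc_of_le (NNReal.coe_le_coe.2 hst)] at hu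
      refine hop _ (hX _ ⟨NNReal.le_toNNReal_of_coe_le hu.1, Real.toNNReal_le_iff_le_coe.2 hu.2⟩)
  · have hX : ∀ u ∈ Icc s t, k₂ < X u ω := fun u hu => by
      have := (abs_le.1 (hosc u hu)).1
      linarith
    rw [increment, hright _ (hX t (right_mem_Icc.2 hst)).le,
      hright _ (hX s (left_mem_Icc.2 hst)).le, sub_self, zero_sub, neg_eq_zero]
    refine intervalIntegral.integral_zero_ae (.of_forall fun u hu => ?_)
    rw [uIoc_of_le (NNReal.coe_le_coe.2 hst)] at hu
    refine image_eq_zero_of_notMem_tsupport fun h' => ?_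
    have h1 := (hsupp (tsupport_firstOrderOp_subset w h')).2
    have h2 := hX u.toNNReal
      ⟨NNReal.le_toNNReal_of_coe_le hu.1.le, Real.toNNReal_le_iff_le_coe.2 hu.2⟩
    linarith

section Localisation

variable {Ω : Type*} [mΩ : MeasurableSpace Ω] {X : ℝ≥0 → Ω → ℝ} {P : Measure Ω}
  [IsProbabilityMeasure P] {ℱ : Filtration ℝ≥0 mΩ} {S : Set ℝ} {a b : ℝ → ℝ} {μ : Measure ℝ}

/-- The event that the path moves by at most `δ` from its initial value over the first `n`
intervals of length `h`. -/
def calmEvent (X : ℝ≥0 → Ω → ℝ) (δ : ℝ) (h : ℝ≥0) (n : ℕ) : Set Ω :=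
  {ω | ∀ i < n, ∀ u ∈ Icc (i * h) ((i + 1 : ℕ) * h), |X u ω - X (i * h) ω| ≤ δ}

-- Path continuity replaces the uncountably many times by a dense sequence, and the minimum with the
-- end of the interval keeps each sampled time inside it.
omit [IsProbabilityMeasure P] in
theorem IsWeakSolution.measurableSet_calmEvent (hW : IsWeakSolution S a b μ P ℱ X) (δ : ℝ)
    (h : ℝ≥0) (n : ℕ) : MeasurableSet[ℱ (n * h)] (calmEvent X δ h n) := by
  have heq : calmEvent X δ h n = ⋂ i : ℕ, ⋂ (_ : i < n), ⋂ m : ℕ,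
      {ω | |X (min (i * h + TopologicalSpace.denseSeq ℝ≥0 m) ((i + 1 : ℕ) * h)) ω
        - X (i * h) ω| ≤ δ} := by
    ext ω
    simp only [calmEvent, mem_ofPred_eq, mem_iInter]
    refine forall₂_congr fun i hi => ⟨fun H m => H _ ⟨?_, min_le_right _ _⟩, fun H u hu => ?_⟩
    · refine le_min le_self_add ?_
      push_cast
      rw [add_mul]
      exact le_self_add
    · have hcl : IsClosed {d : ℝ≥0 | |X (min (i * h + d) ((i + 1 : ℕ) * h)) ω
          - X (i * h) ω| ≤ δ} := by
        refine isClosed_le (Continuous.abs (Continuous.sub ?_ continuous_const)) continuous_const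
        exact (hW.continuous_paths ω).comp (by fun_prop)
      have hall := hcl.closure_subset_iff.2 (range_subset_iff.2 H)
      rw [(TopologicalSpace.denseRange_denseSeq ℝ≥0).closure_range] at hall
      obtain ⟨d, rfl⟩ := exists_add_of_le hu.1
      have := hall (mem_univ d)
      simpa only [mem_ofPred_eq, min_eq_left hu.2] using this
  rw [heq]
  refine MeasurableSet.iInter fun i => MeasurableSet.iInter fun hi => MeasurableSet.iInter fun m => ?_
  have hmono : ((i + 1 : ℕ) : ℝ≥0) * h ≤ n * h := by gcongr; exact hi
  have hmono' : (i : ℝ≥0) * h ≤ n * h := by gcongr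
  have m1 := ((hW.adapted (min (i * h + TopologicalSpace.denseSeq ℝ≥0 m) ((i + 1 : ℕ) * h))).mono
    (ℱ.mono ((min_le_right _ _).trans hmono))).measurable
  have m2 := ((hW.adapted (i * h)).mono (ℱ.mono hmono')).measurable
  exact (measurable_abs.comp (m1.sub m2)) measurableSet_Iic

omit mΩ in
theorem calmEvent_succ (X : ℝ≥0 → Ω → ℝ) (δ : ℝ) (h : ℝ≥0) (n : ℕ) (ω : Ω) :
    ω ∈ calmEvent X δ h (n + 1) ↔ ω ∈ calmEvent X δ h n ∧
      ∀ u ∈ Icc (n * h) ((n + 1 : ℕ) * h), |X u ω - X (n * h) ω| ≤ δ := by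
  simp only [calmEvent, mem_ofPred_eq]
  refine ⟨fun H => ⟨fun i hi => H i (by omega), H n (by omega)⟩, fun H i hi => ?_⟩
  rcases Nat.lt_succ_iff_lt_or_eq.1 hi with h' | rfl
  · exact H.1 i h'
  · exact H.2

omit mΩ in
theorem eventually_mem_calmEvent (hc : ∀ ω, Continuous fun t => X t ω) {δ : ℝ} (hδ : 0 < δ)
    (t : ℝ≥0) (ω : Ω) : ∀ᶠ n : ℕ in atTop, ω ∈ calmEvent X δ (t / n) n := by
  have huc := (isCompact_Icc (a := 0) (b := t)).uniformContinuousOn_of_continuous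
    (hc ω).continuousOn
  obtain ⟨η, hη, H⟩ := Metric.uniformContinuousOn_iff.1 huc δ hδ
  have hlim : Tendsto (fun n : ℕ => (t : ℝ) / n) atTop (𝓝 0) :=
    tendsto_const_div_atTop_nhds_zero_nat _
  filter_upwards [hlim.eventually (gt_mem_nhds hη), eventually_gt_atTop 0] with n hn hn0 i hi u hu
  have hn0' : (n : ℝ≥0) ≠ 0 := by exact_mod_cast hn0.ne'
  have hle : ∀ j : ℕ, j ≤ n → (j : ℝ≥0) * (t / n) ≤ t := fun j hj => by
    calc (j : ℝ≥0) * (t / n) ≤ n * (t / n) := by gcongr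
      _ = t := mul_div_cancel₀ _ hn0'
  have := H u ⟨zero_le, hu.2.trans (hle _ hi)⟩ (i * (t / n)) ⟨zero_le, hle _ hi.le⟩ (by
    rw [NNReal.dist_eq, abs_of_nonneg (sub_nonneg.2 (NNReal.coe_le_coe.2 hu.1))]
    have h2 := NNReal.coe_le_coe.2 hu.2
    push_cast at h2 ⊢
    linarith)
  exact (le_of_lt this)

/-- The martingale identity for test functions `v` with `v' = w ∈ C¹_c(S)`. -/
theorem IsWeakSolution.integral_mul_increment (hW : IsWeakSolution S a b μ P ℱ X)
    (hS : IsOpen S) (hSc : S.OrdConnected) (ha : ContinuousOn a S) (hb : ContinuousOn b S)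
    {v w : ℝ → ℝ} (hw : ContDiff ℝ 1 w) (hwc : HasCompactSupport w) (hwS : tsupport w ⊆ S)
    (hv : ∀ x, HasDerivAt v (w x) x) (t : ℝ≥0) {Z : Ω → ℝ} (hZ : StronglyMeasurable[ℱ 0] Z)
    (hZi : Integrable Z P) :
    ∫ ω, Z ω * increment X v (firstOrderOp a b w) 0 t ω ∂P = 0 := by
  obtain ⟨ω₀⟩ : Nonempty Ω := P.nonempty_of_neZero
  have hne : S.Nonempty := ⟨_, hW.mem_state 0 ω₀⟩
  obtain ⟨φ, k, δ, hδ, hφ, hφc, hφS, hloc⟩ :=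
    exists_localisation (Ω := Ω) hS hSc hne a b hw hwc hwS hv
  set g := firstOrderOp a b w with hg
  have hgc : Continuous g := continuous_firstOrderOp hS ha hb hw hwS
  obtain ⟨Cg, hCg⟩ := (hasCompactSupport_firstOrderOp (a := a) (b := b) hwc
    ).exists_bound_of_continuous hgc
  obtain ⟨k₁, hk₁, k₂, hk₂, hk, hsupp⟩ := exists_Icc_of_tsupport_subset hne hwc hwS
  obtain ⟨-, -, Cv, hCv⟩ := bounded_of_hasDerivAt hv hk hsupp
  obtain ⟨Cφ, hCφ⟩ := hφc.exists_bound_of_continuous hφ.continuous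
  have hd1 : ContDiff ℝ 1 (deriv φ) :=
    ((contDiff_succ_iff_deriv (n := 1)).1 (by simpa [one_add_one_eq_two] using hφ)).2.2
  have hLc : Continuous (diffOp a b φ) := by
    rw [diffOp_eq_firstOrderOp]
    exact continuous_firstOrderOp hS ha hb hd1 ((tsupport_deriv_subset (𝕜 := ℝ)).trans hφS)
  have hLs : HasCompactSupport (diffOp a b φ) := by
    rw [diffOp_eq_firstOrderOp]
    exact hasCompactSupport_firstOrderOp hφc.deriv
  obtain ⟨CL, hCL⟩ := hLs.exists_bound_of_continuous hLc
  have hCg0 : 0 ≤ Cg := (norm_nonneg _).trans (hCg 0)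
  have hCL0 : 0 ≤ CL := (norm_nonneg _).trans (hCL 0)
  have hCφ0 : 0 ≤ Cφ := (norm_nonneg _).trans (hCφ 0)
  have hvc : Continuous v := continuous_iff_continuousAt.2 fun x => (hv x).continuousAt
  -- the stopped sums
  let E : ℝ≥0 → ℕ → Set Ω := fun h j => calmEvent X δ h j ∩ {ω | X (j * h) ω ≤ k}
  let A : ℝ≥0 → ℕ → Ω → ℝ := fun h n ω => ∑ j ∈ Finset.range n,
    (E h j).indicator 1 ω * increment X φ (diffOp a b φ) (j * h) ((j + 1 : ℕ) * h) ω
  have hstep : ∀ (h : ℝ≥0) (j : ℕ), (j : ℝ≥0) * h ≤ (j + 1 : ℕ) * h := fun h j => by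
    gcongr; omega
  -- While the path is calm, the sum equals an increment for `v`, bounded by `2 Cv + Cg t`. At most
  -- one further step, during which calmness may fail, adds an increment for `φ`; afterwards all
  -- terms vanish.
  set C := 2 * Cv + Cg * t + (2 * Cφ + CL * t) with hC
  have hA : ∀ (h : ℝ≥0) (N : ℕ) (ω : Ω), N * h ≤ t → ∀ n ≤ N,
      (ω ∈ calmEvent X δ h n → A h n ω = increment X v g 0 (n * h) ω) ∧ |A h n ω| ≤ C := by
    intro h N ω hN n
    have hCv0 : 0 ≤ Cv := (abs_nonneg _).trans (hCv 0)
    induction n with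
    | zero =>
      intro _
      refine ⟨fun _ => by simp [A, increment], ?_⟩
      simp only [A, Finset.range_zero, Finset.sum_empty, abs_zero]
      positivity
    | succ n ih =>
      intro hn
      obtain ⟨ih1, ih2⟩ := ih (by omega)
      have hnt : ((n + 1 : ℕ) : ℝ≥0) * h ≤ t := le_trans (by gcongr) hN
      have hnt' : (n : ℝ≥0) * h ≤ t := (hstep h n).trans hnt
      have hsucc : A h (n + 1) ω = A h n ω + (E h n).indicator 1 ω *
          increment X φ (diffOp a b φ) (n * h) ((n + 1 : ℕ) * h) ω := by
        simp only [A, Finset.sum_range_succ]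
      by_cases hcalm : ω ∈ calmEvent X δ h n
      · have hinc := abs_increment_le (X := X) hCφ hCL (hstep h n) ω
        refine ⟨fun hs => ?_, ?_⟩
        · rw [calmEvent_succ] at hs
          obtain ⟨l1, l2⟩ := hloc X _ _ ω (hstep h n) hs.2
          rw [hsucc, ih1 hcalm, ← increment_add hW.continuous_paths v hgc 0 (n * h) ((n + 1 : ℕ) * h)]
          congr 1
          rcases le_or_gt (X (n * h) ω) k with hle | hgt
          · have : ω ∈ E h n := ⟨hcalm, hle⟩
            rw [indicator_of_mem this, Pi.one_apply, one_mul, l1 hle]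
          · have : ω ∉ E h n := fun h' => absurd h'.2 (not_le.2 hgt)
            rw [indicator_of_notMem this, zero_mul, l2 hgt]
        · rw [hsucc, ih1 hcalm, hC]
          refine (abs_add_le _ _).trans (add_le_add ?_ ?_)
          · refine (abs_increment_le hCv hCg zero_le ω).trans ?_
            have := NNReal.coe_le_coe.2 hnt'
            simp only [NNReal.coe_zero, sub_zero]
            gcongr
          · have h1 : |(E h n).indicator (1 : Ω → ℝ) ω| ≤ 1 := by
              by_cases hE : ω ∈ E h n <;> simp [hE]
            rw [abs_mul]
            refine (mul_le_of_le_one_left (abs_nonneg _) h1).trans (hinc.trans ?_)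
            have h2 := NNReal.coe_le_coe.2 hnt
            have h3 : (0 : ℝ) ≤ ((n : ℝ≥0) * h : ℝ≥0) := NNReal.coe_nonneg _
            have h4 : CL * ((((n + 1 : ℕ) : ℝ≥0) * h : ℝ≥0) - ((n : ℝ≥0) * h : ℝ≥0)) ≤ CL * t := by
              gcongr
              linarith
            linarith
      · refine ⟨fun hs => absurd ((calmEvent_succ X δ h n ω).1 hs).1 hcalm, ?_⟩
        have : ω ∉ E h n := fun h' => hcalm h'.1
        rw [hsucc, indicator_of_notMem this, zero_mul, add_zero]
        exact ih2
  have hEm : ∀ (h : ℝ≥0) (j : ℕ), MeasurableSet[ℱ (j * h)] (E h j) := fun h j =>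
    (hW.measurableSet_calmEvent δ h j).inter
      ((hW.adapted (j * h)).measurable measurableSet_Iic)
  have hincm : ∀ s t, Measurable (increment X φ (diffOp a b φ) s t) := fun s t =>
    measurable_increment hW.measurable hW.continuous_paths hφ.continuous hLc s t
  have hAm : ∀ h n, Measurable (A h n) := fun h n =>
    Finset.measurable_sum _ fun j _ =>
      (measurable_one.indicator (ℱ.le _ _ (hEm h j))).mul (hincm _ _)
  have hzero : ∀ h n, ∫ ω, Z ω * A h n ω ∂P = 0 := by
    intro h n
    have hZj : ∀ j : ℕ, StronglyMeasurable[ℱ (j * h)] fun ω => Z ω * (E h j).indicator 1 ω := fun j =>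
      (hZ.mono (ℱ.mono zero_le)).mul (stronglyMeasurable_one.indicator (hEm h j))
    have hZji : ∀ j : ℕ, Integrable (fun ω => Z ω * (E h j).indicator 1 ω) P := fun j => by
      refine hZi.mul_bdd (c := 1) ?_ (.of_forall fun ω => ?_)
      · exact (measurable_one.indicator (ℱ.le _ _ (hEm h j))).aestronglyMeasurable
      · by_cases hE : ω ∈ E h j <;> simp [hE]
    have e : ∀ ω, Z ω * A h n ω = ∑ j ∈ Finset.range n, Z ω * (E h j).indicator 1 ω *
        increment X φ (diffOp a b φ) (j * h) ((j + 1 : ℕ) * h) ω := fun ω => by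
      simp only [A, Finset.mul_sum, mul_assoc]
    simp only [e]
    rw [integral_finsetSum]
    · exact Finset.sum_eq_zero fun j _ =>
        hW.integral_mul_increment_compact hS ha hb hφ hφc hφS (hstep h j) (hZj j) (hZji j)
    · exact fun j _ => (hZji j).mul_bdd (hincm _ _).aestronglyMeasurable
        (.of_forall (abs_increment_le hCφ hCL (hstep h j)))
  -- Each path is eventually calm at mesh `t / n`, so the sums are eventually equal to the increment
  -- for `v`; the uniform bound `C` gives dominated convergence.
  have hlim : Tendsto (fun n : ℕ => ∫ ω, Z ω * A (t / n) n ω ∂P) atTop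
      (𝓝 (∫ ω, Z ω * increment X v g 0 t ω ∂P)) := by
    have hmul : ∀ n : ℕ, n ≠ 0 → (n : ℝ≥0) * (t / n) = t := fun n hn =>
      mul_div_cancel₀ _ (by exact_mod_cast hn)
    refine tendsto_integral_filter_of_dominated_convergence (fun ω => |Z ω| * C) ?_ ?_
      (hZi.abs.mul_const _) ?_
    · exact .of_forall fun n => (hZi.1.mul (hAm _ _).aestronglyMeasurable)
    · filter_upwards [eventually_gt_atTop 0] with n hn
      refine .of_forall fun ω => ?_
      rw [Real.norm_eq_abs, abs_mul]
      gcongr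
      exact (hA (t / n) n ω (hmul n hn.ne').le n le_rfl).2
    · refine .of_forall fun ω => tendsto_const_nhds.congr' ?_
      filter_upwards [eventually_mem_calmEvent hW.continuous_paths hδ t ω, eventually_gt_atTop 0]
        with n hn hn0
      rw [(hA (t / n) n ω (hmul n hn0.ne').le n le_rfl).1 hn, hmul n hn0.ne']
  simp only [hzero] at hlim
  exact (tendsto_nhds_unique tendsto_const_nhds hlim).symm

end Localisation

/-! ### Extension of quadratic form identities from dense subsets -/

section Dense

variable {E : Type*} [NormedAddCommGroup E] [InnerProductSpace ℝ E] [CompleteSpace E]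
  {T : ℝ≥0 → E →L[ℝ] E} {e : E} {U : E →L[ℝ] E} {D : Set E}

theorem IsMixingSemigroup.potential_symm_of_dense (hT : IsMixingSemigroup T e)
    (hU : IsPotential T e U) (hD : ∀ x, inner ℝ e x = 0 → x ∈ closure D)
    (hsymm : ∀ x ∈ D, ∀ y ∈ D, inner ℝ (U x) y = inner ℝ x (U y)) (x y : E) :
    inner ℝ (U x) y = inner ℝ x (U y) := by
  have h1 : ∀ x ∈ D, ∀ y ∈ closure D, inner ℝ (U x) y = inner ℝ x (U y) := fun x hx y hy =>
    closure_minimal (fun y hy => hsymm x hx y hy)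
      (isClosed_eq (f := fun y => inner ℝ (U x) y) (g := fun y => inner ℝ x (U y))
        (by fun_prop) (by fun_prop)) hy
  have h2 : ∀ x ∈ closure D, ∀ y ∈ closure D, inner ℝ (U x) y = inner ℝ x (U y) :=
    fun x hx y hy => closure_minimal (fun x hx => h1 x hx y hy)
      (isClosed_eq (f := fun x => inner ℝ (U x) y) (g := fun x => inner ℝ x (U y))
        (by fun_prop) (by fun_prop)) hx
  have h3 := h2 _ (hD _ (hT.inner_centre x)) _ (hD _ (hT.inner_centre y))
  rw [hT.potential_centre hU, hT.potential_centre hU] at h3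
  rw [centre_apply, inner_sub_right, real_inner_smul_right, real_inner_comm e (U x),
    hT.inner_potential hU, centre_apply, inner_sub_left, real_inner_smul_left,
    hT.inner_potential hU] at h3
  simpa using h3

/-- The form of `U` depends only on the centred component, and centring does not increase the norm.
-/
theorem IsMixingSemigroup.inner_le_of_dense (hT : IsMixingSemigroup T e)
    (hU : IsPotential T e U) (hD : ∀ x, inner ℝ e x = 0 → x ∈ closure D) {C : ℝ} (hC : 0 ≤ C)
    (hle : ∀ x ∈ D, inner ℝ (U x) x ≤ C * ‖x‖ ^ 2) (x : E) :
    inner ℝ (U x) x ≤ C * ‖x‖ ^ 2 := by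
  have h1 : ∀ x ∈ closure D, inner ℝ (U x) x ≤ C * ‖x‖ ^ 2 := fun x hx =>
    closure_minimal (fun x hx => hle x hx)
      (isClosed_le (f := fun x => inner ℝ (U x) x) (g := fun x => C * ‖x‖ ^ 2)
        (by fun_prop) (by fun_prop)) hx
  have h2 := h1 _ (hD _ (hT.inner_centre x))
  have h3 : inner ℝ (U (centre e x)) (centre e x) = inner ℝ (U x) x := by
    rw [hT.potential_centre hU, centre_apply, inner_sub_right, real_inner_smul_right,
      real_inner_comm e, hT.inner_potential hU]
    simp
  have h4 : ‖centre e x‖ ^ 2 ≤ ‖x‖ ^ 2 := by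
    rw [← real_inner_self_eq_norm_sq, ← hT.inner_centre_left, centre_apply, inner_sub_left,
      real_inner_self_eq_norm_sq, real_inner_smul_left]
    nlinarith [mul_self_nonneg (inner ℝ e x : ℝ)]
  rw [h3] at h2
  exact h2.trans (by gcongr)

end Dense

/-! ### Density of compactly supported continuous functions -/

section CompactSupport

variable {μ : Measure ℝ}

theorem memLp_of_continuous_of_hasCompactSupport [IsFiniteMeasure μ] {h : ℝ → ℝ}
    (hc : Continuous h) (hs : HasCompactSupport h) : MemLp h 2 μ := by
  obtain ⟨C, hC⟩ := hs.exists_bound_of_continuous hc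
  exact MemLp.of_bound hc.aestronglyMeasurable C (.of_forall hC)

/-- A bounded continuous approximation is multiplied by a cut-off equal to one on a compact `K ⊆ S`
with nearly full measure; `η` is chosen so that the loss off `K` is small in `L²(μ)`. -/
theorem exists_continuous_approx [IsProbabilityMeasure μ] {S : Set ℝ} (hS : IsOpen S)
    (hμS : μ S = 1) (F : Lp ℝ 2 μ) {ε : ℝ} (hε : 0 < ε) :
    ∃ h : ℝ → ℝ, Continuous h ∧ HasCompactSupport h ∧ tsupport h ⊆ S ∧ ‖F - toL2 μ h‖ < ε := by
  have hdense := BoundedContinuousFunction.toLp_denseRange (E := ℝ) (p := 2) μ ℝ (by norm_num)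
  obtain ⟨g, hg⟩ := hdense.exists_dist_lt F (show 0 < ε / 2 by positivity)
  have hgm : MemLp g 2 μ := MemLp.of_bound g.continuous.aestronglyMeasurable ‖g‖
    (.of_forall g.norm_coe_le_norm)
  have hgL : BoundedContinuousFunction.toLp 2 μ ℝ g = toL2 μ g := by
    rw [toL2_of_memLp hgm]
    rfl
  rw [hgL, dist_eq_norm] at hg
  set η := (ε / 2) ^ 2 / (‖g‖ + 1) ^ 2 / 2 with hη
  have hη0 : 0 < η := by positivity
  obtain ⟨K, hKS, hK, hKμ⟩ : ∃ K ⊆ S, IsCompact K ∧ ENNReal.ofReal (1 - η) < μ K := by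
    refine hS.exists_lt_isCompact ?_
    rw [hμS, ENNReal.ofReal_lt_one]
    linarith
  obtain ⟨χ, hχ1, hχc, hχS, hχb⟩ := exists_continuousMap_one_of_isCompact_subset_isOpen hK hS hKS
  have hcont : Continuous fun x => g x * χ x := g.continuous.mul χ.continuous
  have hsup : tsupport (fun x => g x * χ x) ⊆ tsupport χ :=
    closure_mono (Function.support_mul_subset_right _ _)
  have hcs : HasCompactSupport fun x => g x * χ x :=
    hχc.of_isClosed_subset (isClosed_tsupport _) hsup
  refine ⟨_, hcont, hcs, hsup.trans hχS, ?_⟩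
  have hm := memLp_of_continuous_of_hasCompactSupport (μ := μ) hcont hcs
  have h1 : ‖toL2 μ g - toL2 μ fun x => g x * χ x‖ ^ 2 < (ε / 2) ^ 2 := by
    rw [toL2_of_memLp hgm, toL2_of_memLp hm, ← MemLp.toLp_sub, norm_toLp_sq]
    have hKc : μ.real Kᶜ ≤ η := by
      rw [measureReal_compl hK.measurableSet, probReal_univ]
      have : 1 - η < μ.real K := by
        by_contra! h
        have := ENNReal.ofReal_le_ofReal h
        rw [ofReal_measureReal] at this
        exact absurd hKμ (not_lt.2 this)
      linarith
    calc ∫ x, ((g : ℝ → ℝ) - fun x => g x * χ x) x ^ 2 ∂μ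
        ≤ ∫ x, Kᶜ.indicator (fun _ => (‖g‖ + 1) ^ 2) x ∂μ := by
          refine integral_mono_of_nonneg (.of_forall fun x => sq_nonneg _)
            ((integrable_const _).indicator hK.measurableSet.compl) (.of_forall fun x => ?_)
          by_cases hx : x ∈ K
          · simp [hχ1 hx, hx]
          · simp only [Pi.sub_apply, mem_compl_iff, hx, not_false_eq_true, indicator_of_mem]
            refine sq_le_sq' ?_ ?_
            all_goals
              have h2 := abs_le.1 (g.norm_coe_le_norm x)
              have h3 := hχb x
              have h4 := norm_nonneg g
              nlinarith [h2.1, h2.2, h3.1, h3.2]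
      _ = μ.real Kᶜ * (‖g‖ + 1) ^ 2 := by
          rw [integral_indicator_const _ hK.measurableSet.compl, smul_eq_mul]
      _ ≤ η * (‖g‖ + 1) ^ 2 := by gcongr
      _ < (ε / 2) ^ 2 := by
          have : η * (‖g‖ + 1) ^ 2 = (ε / 2) ^ 2 / 2 := by
            rw [hη]; field_simp
          rw [this]
          have : 0 < (ε / 2) ^ 2 := by positivity
          linarith
  have h2 : ‖toL2 μ g - toL2 μ fun x => g x * χ x‖ < ε / 2 :=
    lt_of_pow_lt_pow_left₀ 2 (by positivity) h1
  calc ‖F - toL2 μ fun x => g x * χ x‖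
      = ‖(F - toL2 μ g) + (toL2 μ g - toL2 μ fun x => g x * χ x)‖ := by congr 1; abel
    _ ≤ _ := norm_add_le _ _
    _ < ε := by linarith

end CompactSupport

/-! ### Solution of `a w + (1/2) b² w' = h` with compact support -/

section Poisson

variable {S : Set ℝ} {a b : ℝ → ℝ}

/-- The speed density: there is a positive continuous `m` on `S` such that every `h ∈ C_c(S)` with
`∫ h m = 0` is of the form `a w + (1/2) b² w'` with `w ∈ C¹_c(S)`. -/
theorem exists_speed_density (hS : IsOpen S) (hSc : S.OrdConnected) (hne : S.Nonempty)
    (ha : ContinuousOn a S) (hb : ContinuousOn b S) (hb0 : ∀ x ∈ S, 0 < b x) :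
    ∃ m : ℝ → ℝ, ContinuousOn m S ∧ (∀ x ∈ S, 0 < m x) ∧
      ∀ h : ℝ → ℝ, Continuous h → HasCompactSupport h → tsupport h ⊆ S → ∫ x, h x * m x = 0 →
        ∃ w : ℝ → ℝ, ContDiff ℝ 1 w ∧ HasCompactSupport w ∧ tsupport w ⊆ S ∧
          firstOrderOp a b w = h := by
  obtain ⟨x₀, hx₀⟩ := id hne
  set β : ℝ → ℝ := fun x => 2 * a x / b x ^ 2 with hβ
  have hb2 : ∀ x ∈ S, b x ^ 2 ≠ 0 := fun x hx => (pow_pos (hb0 x hx) 2).ne'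
  have hβc : ContinuousOn β S := (continuousOn_const.mul ha).div (hb.pow 2) hb2
  set B : ℝ → ℝ := fun x => ∫ y in x₀..x, β y with hB
  have hBd : ∀ x ∈ S, HasDerivAt B (β x) x := fun x hx => by
    refine intervalIntegral.integral_hasDerivAt_right ?_ ?_ (hβc.continuousAt (hS.mem_nhds hx))
    · exact (hβc.mono (hSc.uIcc_subset hx₀ hx)).intervalIntegrable
    · exact hβc.stronglyMeasurableAtFilter hS x hx
  have hBc : ContinuousOn B S := fun x hx => (hBd x hx).continuousAt.continuousWithinAt
  -- `exp B` is the integrating factor: `a w + b² w' / 2 = h` is equivalent to `(w exp B)' = h m` on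
  -- `S`. The solution that vanishes to the left of the support of `h` vanishes to its right exactly
  -- when `∫ h m = 0`.
  set m : ℝ → ℝ := fun x => 2 * Real.exp (B x) / b x ^ 2 with hm
  have hmc : ContinuousOn m S := (continuousOn_const.mul hBc.rexp).div (hb.pow 2) hb2
  refine ⟨m, hmc, fun x hx => ?_, fun h hh hhc hhS hint => ?_⟩
  · have := hb0 x hx
    positivity
  obtain ⟨k₁, hk₁, k₂, hk₂, hk, hsupp⟩ := exists_Icc_of_tsupport_subset hne hhc hhS
  have hIS : Icc k₁ k₂ ⊆ S := hSc.out hk₁ hk₂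
  have hh0 : ∀ x, x ∉ Icc k₁ k₂ → h x = 0 := fun x hx =>
    image_eq_zero_of_notMem_tsupport fun h' => hx (hsupp h')
  have hmsupp : tsupport (fun x => h x * m x) ⊆ tsupport h :=
    closure_mono (Function.support_mul_subset_left _ _)
  have hhm : Continuous fun x => h x * m x :=
    (hh.continuousOn.mul hmc).continuous_of_tsupport_subset hS (hmsupp.trans hhS)
  have hhmc : HasCompactSupport fun x => h x * m x :=
    hhc.of_isClosed_subset (isClosed_tsupport _) hmsupp
  set H : ℝ → ℝ := fun x => ∫ y in k₁..x, h y * m y with hH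
  have hHd : ∀ x, HasDerivAt H (h x * m x) x := fun x =>
    intervalIntegral.integral_hasDerivAt_right (hhm.intervalIntegrable _ _)
      (hhm.stronglyMeasurableAtFilter _ _) hhm.continuousAt
  have hHk₁ : H k₁ = 0 := by simp [hH]
  have hHk₂ : H k₂ = 0 := by
    rw [← hint, hH]
    simp only
    rw [intervalIntegral.integral_of_le hk, ← integral_Icc_eq_integral_Ioc,
      setIntegral_eq_integral_of_forall_compl_eq_zero]
    intro x hx
    rw [hh0 x hx, zero_mul]
  have hH0 : ∀ x, x ∉ Icc k₁ k₂ → H x = 0 := by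
    intro x hx
    rw [mem_Icc, not_and_or, not_le, not_le] at hx
    rcases hx with hx | hx
    · rw [← hHk₁]
      refine eq_of_hasDerivAt_of_eq_zero hHd hx.le fun z hz => ?_
      rw [hh0 z fun h' => absurd h'.1 (not_le.2 hz.2), zero_mul]
    · rw [← hHk₂]
      refine (eq_of_hasDerivAt_of_eq_zero hHd hx.le fun z hz => ?_).symm
      rw [hh0 z fun h' => absurd h'.2 (not_le.2 hz.1), zero_mul]
  set w : ℝ → ℝ := fun x => H x * Real.exp (-B x) with hw
  set w' : ℝ → ℝ := fun x => 2 * h x / b x ^ 2 - w x * β x with hw'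
  have hw0 : ∀ x, x ∉ Icc k₁ k₂ → w x = 0 := fun x hx => by
    rw [hw]; simp only; rw [hH0 x hx, zero_mul]
  have hsub : ∀ f : ℝ → ℝ, (∀ x, x ∉ Icc k₁ k₂ → f x = 0) → tsupport f ⊆ Icc k₁ k₂ :=
    fun f hf => closure_minimal (fun x hx => by
      by_contra h'; exact hx (hf x h')) isClosed_Icc
  have hws := hsub w hw0
  have hw's : tsupport w' ⊆ Icc k₁ k₂ := hsub w' fun x hx => by
    rw [hw']; simp only; rw [hw0 x hx, hh0 x hx]; ring
  have hwd : ∀ x, HasDerivAt w (w' x) x := by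
    intro x
    by_cases hx : x ∈ S
    · have h1 := (hHd x).mul ((hBd x hx).neg.exp)
      refine h1.congr_deriv ?_
      simp only [hw', hw, hm, Pi.neg_apply]
      have h2 : Real.exp (B x) * Real.exp (-B x) = 1 := by rw [← Real.exp_add]; simp
      have h3 := (hb0 x hx).ne'
      field_simp
      linear_combination (2 * h x) * h2
    · have hx' : x ∉ Icc k₁ k₂ := fun h' => hx (hIS h')
      have h1 : w =ᶠ[𝓝 x] fun _ => 0 := by
        filter_upwards [isClosed_Icc.isOpen_compl.mem_nhds hx'] with y hy using hw0 y hy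
      have h2 : w' x = 0 := image_eq_zero_of_notMem_tsupport fun h' => hx' (hw's h')
      rw [h2]
      exact (hasDerivAt_const x (0 : ℝ)).congr_of_eventuallyEq h1
  have hwc : Continuous w := continuous_iff_continuousAt.2 fun x => (hwd x).continuousAt
  have hw'c : Continuous w' := by
    refine ContinuousOn.continuous_of_tsupport_subset (s := S) ?_ hS (hw's.trans hIS)
    exact ((continuousOn_const.mul hh.continuousOn).div (hb.pow 2) hb2).sub
      (hwc.continuousOn.mul hβc)
  have hderiv : deriv w = w' := funext fun x => (hwd x).deriv
  refine ⟨w, contDiff_one_iff_deriv.2 ⟨fun x => (hwd x).differentiableAt, hderiv ▸ hw'c⟩,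
    isCompact_Icc.of_isClosed_subset (isClosed_tsupport _) hws, hws.trans hIS, funext fun x => ?_⟩
  rw [firstOrderOp, hderiv]
  by_cases hx : x ∈ S
  · have h3 := (hb0 x hx).ne'
    simp only [hw', hβ]
    field_simp
    ring
  · have hx' : x ∉ Icc k₁ k₂ := fun h' => hx (hIS h')
    rw [hw0 x hx', hh0 x hx', image_eq_zero_of_notMem_tsupport fun h' => hx' (hw's h')]
    ring

end Poisson

/-! ### Stationary mixing diffusions: the potential operator on explicit functions -/

section StationaryDiffusion

variable {Ω : Type*} [mΩ : MeasurableSpace Ω]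

/-- A stationary `ρ`-mixing weak solution on an open interval `S`, with continuous coefficients and
positive diffusion coefficient. -/
structure IsStationaryDiffusion (S : Set ℝ) (a b : ℝ → ℝ) (μ : Measure ℝ) (P : Measure Ω)
    (ℱ : Filtration ℝ≥0 mΩ) (X : ℝ≥0 → Ω → ℝ) : Prop where
  sol : IsWeakSolution S a b μ P ℱ X
  stationary : IsStationary P X
  mixing : IsRhoMixing P X
  isOpen : IsOpen S
  ordConnected : S.OrdConnected
  continuousOn_drift : ContinuousOn a S
  continuousOn_diffusion : ContinuousOn b S
  diffusion_pos : ∀ x ∈ S, 0 < b x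

variable {S : Set ℝ} {a b : ℝ → ℝ} {μ : Measure ℝ} {P : Measure Ω} [IsProbabilityMeasure P]
  {ℱ : Filtration ℝ≥0 mΩ} {X : ℝ≥0 → Ω → ℝ}

/-- `v` is a test function: `v' = w` is continuously differentiable with compact support in `S`. -/
structure IsTestFunction (S : Set ℝ) (v w : ℝ → ℝ) : Prop where
  contDiff : ContDiff ℝ 1 w
  compact : HasCompactSupport w
  subset : tsupport w ⊆ S
  hasDerivAt : ∀ x, HasDerivAt v (w x) x

theorem IsTestFunction.continuous {v w : ℝ → ℝ} (h : IsTestFunction S v w) : Continuous v :=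
  continuous_iff_continuousAt.2 fun x => (h.hasDerivAt x).continuousAt

theorem exists_isTestFunction {w : ℝ → ℝ} (hw : ContDiff ℝ 1 w) (hwc : HasCompactSupport w)
    (hwS : tsupport w ⊆ S) : ∃ v, IsTestFunction S v w :=
  ⟨fun x => ∫ y in (0 : ℝ)..x, w y, hw, hwc, hwS, fun _ =>
    intervalIntegral.integral_hasDerivAt_right (hw.continuous.intervalIntegrable _ _)
      (hw.continuous.stronglyMeasurableAtFilter _ _) hw.continuous.continuousAt⟩

theorem IsTestFunction.exists_bound {v w : ℝ → ℝ} (h : IsTestFunction S v w) :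
    ∃ C, ∀ x, |v x| ≤ C := by
  obtain ⟨k₁, -, k₂, -, hk, hsupp⟩ :=
    exists_Icc_of_tsupport_subset (S := univ) univ_nonempty h.compact (subset_univ _)
  exact (bounded_of_hasDerivAt h.hasDerivAt hk hsupp).2.2

theorem IsTestFunction.memLp [IsFiniteMeasure μ] {v w : ℝ → ℝ} (h : IsTestFunction S v w) :
    MemLp v 2 μ := by
  obtain ⟨C, hC⟩ := h.exists_bound
  exact MemLp.of_bound h.continuous.aestronglyMeasurable C (.of_forall hC)

namespace IsStationaryDiffusion

variable (hD : IsStationaryDiffusion S a b μ P ℱ X)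
include hD

omit [IsProbabilityMeasure P] in
theorem measurePreserving (t : ℝ≥0) : MeasurePreserving (X t) P μ :=
  hD.stationary.measurePreserving hD.sol.measurable hD.sol.initial_law t

theorem isProbabilityMeasure : IsProbabilityMeasure μ := by
  rw [← (hD.measurePreserving 0).map_eq]
  exact Measure.isProbabilityMeasure_map (hD.measurePreserving 0).measurable.aemeasurable

theorem isMixingSemigroup : IsMixingSemigroup (transitionOp P μ X) (toL2 μ fun _ => 1) :=
  isMixingSemigroup_transitionOp hD.measurePreserving hD.stationary hD.sol.adapted hD.sol.markov
    hD.sol.continuous_paths hD.mixing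

theorem measure_state : μ S = 1 := by
  rw [← (hD.measurePreserving 0).map_eq,
    Measure.map_apply (hD.measurePreserving 0).measurable hD.isOpen.measurableSet]
  have : X 0 ⁻¹' S = univ := eq_univ_of_forall fun ω => hD.sol.mem_state 0 ω
  rw [this, measure_univ]

theorem ae_mem_state : ∀ᵐ x ∂μ, x ∈ S := by
  have := hD.isProbabilityMeasure
  exact (prob_compl_eq_zero_iff hD.isOpen.measurableSet).2 hD.measure_state

theorem nonempty_state : S.Nonempty := by
  obtain ⟨ω₀⟩ : Nonempty Ω := P.nonempty_of_neZero
  exact ⟨_, hD.sol.mem_state 0 ω₀⟩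

omit [IsProbabilityMeasure P] in
theorem continuous_op {v w : ℝ → ℝ} (h : IsTestFunction S v w) :
    Continuous (firstOrderOp a b w) :=
  continuous_firstOrderOp hD.isOpen hD.continuousOn_drift hD.continuousOn_diffusion h.contDiff
    h.subset

theorem memLp_op {v w : ℝ → ℝ} (h : IsTestFunction S v w) : MemLp (firstOrderOp a b w) 2 μ := by
  have := hD.isProbabilityMeasure
  exact memLp_of_continuous_of_hasCompactSupport (hD.continuous_op h)
    (hasCompactSupport_firstOrderOp h.compact)

/-- `T_t v - v = ∫₀ᵗ T_u (L v) du` in `L²(μ)`. -/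
theorem transitionOp_sub {v w : ℝ → ℝ} (h : IsTestFunction S v w) (t : ℝ≥0) :
    transitionOp P μ X t (toL2 μ v) - toL2 μ v
      = ∫ u in (0 : ℝ)..t, transitionOp P μ X u.toNNReal (toL2 μ (firstOrderOp a b w)) := by
  have := hD.isProbabilityMeasure
  set g := firstOrderOp a b w with hg
  have hgc : Continuous g := hD.continuous_op h
  have hgm : MemLp g 2 μ := hD.memLp_op h
  have hvm : MemLp v 2 μ := h.memLp
  have hmp := hD.measurePreserving
  have hTc : Continuous fun u : ℝ => transitionOp P μ X u.toNNReal (toL2 μ g) :=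
    hD.isMixingSemigroup.continuous_toNNReal _
  obtain ⟨Cg, hCg⟩ := (hasCompactSupport_firstOrderOp (a := a) (b := b) h.compact
    ).exists_bound_of_continuous hgc
  refine ext_inner_left ℝ fun G => ?_
  have hZ : StronglyMeasurable[ℱ 0] fun ω => G (X 0 ω) :=
    (Lp.stronglyMeasurable G).comp_measurable (hD.sol.adapted 0).measurable
  have hZi : Integrable (fun ω => G (X 0 ω)) P := (memLp_comp hmp G 0).integrable one_le_two
  have key := hD.sol.integral_mul_increment hD.isOpen hD.ordConnected hD.continuousOn_drift
    hD.continuousOn_diffusion h.contDiff h.compact h.subset h.hasDerivAt t hZ hZi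
  have hinner : ∀ (f : ℝ → ℝ) (hf : MemLp f 2 μ) (u : ℝ≥0),
      inner ℝ G (transitionOp P μ X u (toL2 μ f)) = ∫ ω, G (X 0 ω) * f (X u ω) ∂P := by
    intro f hf u
    rw [inner_transitionOp hmp]
    refine integral_congr_ae ?_
    filter_upwards [(hmp u).quasiMeasurePreserving.ae (toL2_ae_eq hf)] with ω hω
    rw [hω]
  have hvi : ∀ u, Integrable (fun ω => G (X 0 ω) * v (X u ω)) P := fun u =>
    (memLp_comp hmp G 0).integrable_mul (hvm.comp_measurePreserving (hmp u))
  have hpm : Measurable (Function.uncurry fun (u : ℝ) ω => g (X u.toNNReal ω)) :=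
    measurable_uncurry_path hD.sol.measurable hD.sol.continuous_paths hgc
  have hprod : Integrable (Function.uncurry fun (u : ℝ) ω => G (X 0 ω) * g (X u.toNNReal ω))
      ((volume.restrict (Set.uIoc 0 (t : ℝ))).prod P) := by
    have h1 : Integrable (fun p : ℝ × Ω => G (X 0 p.2))
        ((volume.restrict (Set.uIoc 0 (t : ℝ))).prod P) := by
      have : IsFiniteMeasure (volume.restrict (Set.uIoc 0 (t : ℝ))) :=
        ⟨by rw [Measure.restrict_apply_univ]; simp [Set.uIoc]⟩
      exact hZi.comp_snd _
    exact h1.mul_bdd hpm.aestronglyMeasurable (.of_forall fun p => hCg _)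
  have hswap := intervalIntegral_integral_swap hprod
  have hint : ∫ ω, G (X 0 ω) * (∫ u in (0 : ℝ)..t, g (X u.toNNReal ω)) ∂P
      = ∫ u in (0 : ℝ)..t, inner ℝ G (transitionOp P μ X u.toNNReal (toL2 μ g)) := by
    simp only [hinner g hgm]
    rw [hswap]
    refine integral_congr_ae (.of_forall fun ω => ?_)
    simp only [intervalIntegral.integral_const_mul]
  have hIi : Integrable (fun ω => G (X 0 ω) * ∫ u in (0 : ℝ)..t, g (X u.toNNReal ω)) P :=
    hZi.mul_bdd (measurable_integral_path hD.sol.measurable hD.sol.continuous_paths hgc _ _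
      ).aestronglyMeasurable (.of_forall fun ω =>
        intervalIntegral.norm_integral_le_of_norm_le_const fun u _ => hCg _)
  have hcomm : inner ℝ G (∫ u in (0 : ℝ)..t, transitionOp P μ X u.toNNReal (toL2 μ g))
      = ∫ u in (0 : ℝ)..t, inner ℝ G (transitionOp P μ X u.toNNReal (toL2 μ g)) :=
    ((innerSL ℝ G).intervalIntegral_comp_comm (hTc.intervalIntegrable _ _)).symm
  rw [inner_sub_right, hinner v hvm, hcomm, ← hint]
  have h0 : inner ℝ G (toL2 μ v) = ∫ ω, G (X 0 ω) * v (X 0 ω) ∂P := by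
    rw [← hinner v hvm 0, transitionOp_zero hmp]
  rw [h0]
  simp only [increment, mul_sub] at key
  rw [integral_sub (f := fun ω => G (X 0 ω) * v (X t ω) - G (X 0 ω) * v (X 0 ω))
    ((hvi t).sub (hvi 0)) (by simpa using hIi), integral_sub (hvi t) (hvi 0)] at key
  simpa [sub_eq_zero] using key

theorem hasGenerator {v w : ℝ → ℝ} (h : IsTestFunction S v w) :
    HasGenerator (transitionOp P μ X) (toL2 μ v) (toL2 μ (firstOrderOp a b w)) := by
  unfold HasGenerator
  simp only [hD.transitionOp_sub h]
  exact hD.isMixingSemigroup.tendsto_average _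

/-- Invariance of `μ`: elements of the range of the generator are orthogonal to the constants. -/
theorem integral_op_eq_zero {w : ℝ → ℝ} (hw : ContDiff ℝ 1 w) (hwc : HasCompactSupport w)
    (hwS : tsupport w ⊆ S) : ∫ x, firstOrderOp a b w x ∂μ = 0 := by
  have := hD.isProbabilityMeasure
  obtain ⟨v, hv⟩ := exists_isTestFunction hw hwc hwS
  rw [← inner_one_toL2 (hD.memLp_op hv)]
  exact hD.isMixingSemigroup.inner_generator (hD.hasGenerator hv)

/-- Integration by parts. -/
theorem integral_mul_op {v₁ w₁ v₂ w₂ : ℝ → ℝ} (h₁ : IsTestFunction S v₁ w₁)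
    (h₂ : IsTestFunction S v₂ w₂) :
    ∫ x, v₂ x * firstOrderOp a b w₁ x ∂μ = -∫ x, 1 / 2 * b x ^ 2 * (w₁ x * w₂ x) ∂μ := by
  have := hD.isProbabilityMeasure
  -- The first order operator obeys a product rule on `v₂ w₁`, producing `v₂ L v₁` plus the
  -- symmetric term; invariance makes the total integral zero.
  set w : ℝ → ℝ := fun x => v₂ x * w₁ x with hw
  have hs : tsupport w ⊆ tsupport w₁ := closure_mono (Function.support_mul_subset_right _ _)
  have hv₂ : ContDiff ℝ 1 v₂ :=
    (contDiff_two_of_hasDerivAt h₂.hasDerivAt h₂.contDiff).of_le (by norm_num)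
  have h0 := hD.integral_op_eq_zero (hv₂.mul h₁.contDiff)
    (h₁.compact.of_isClosed_subset (isClosed_tsupport _) hs) (hs.trans h₁.subset)
  have h1 : ∀ x, firstOrderOp a b w x = v₂ x * firstOrderOp a b w₁ x
      + 1 / 2 * b x ^ 2 * (w₁ x * w₂ x) := by
    intro x
    have hd : HasDerivAt w (w₂ x * w₁ x + v₂ x * deriv w₁ x) x :=
      (h₂.hasDerivAt x).mul ((h₁.contDiff.differentiable one_ne_zero) x).hasDerivAt
    rw [firstOrderOp, firstOrderOp, hd.deriv, hw]
    ring
  have hi : Integrable (fun x => v₂ x * firstOrderOp a b w₁ x) μ :=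
    h₂.memLp.integrable_mul (hD.memLp_op h₁)
  have hi' : Integrable (firstOrderOp a b w) μ := by
    obtain ⟨v, hv⟩ := exists_isTestFunction (hv₂.mul h₁.contDiff)
      (h₁.compact.of_isClosed_subset (isClosed_tsupport _) hs) (hs.trans h₁.subset)
    exact (hD.memLp_op hv).integrable one_le_two
  have h2 : ∫ x, 1 / 2 * b x ^ 2 * (w₁ x * w₂ x) ∂μ
      = ∫ x, (firstOrderOp a b w x - v₂ x * firstOrderOp a b w₁ x) ∂μ := by
    refine integral_congr_ae (.of_forall fun x => ?_)
    simp only [h1]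
    ring
  rw [h2, integral_sub hi' hi]
  change ∫ x, firstOrderOp a b w x ∂μ = 0 at h0
  rw [h0]
  ring

/-- The functions `L v`, for test functions `v`, are dense in the mean zero part of `L²(μ)`. -/
theorem mem_closure_range (x : Lp ℝ 2 μ) (hx : inner ℝ (toL2 μ fun _ => 1) x = 0) :
    x ∈ closure {y | ∃ v w, IsTestFunction S v w ∧ y = toL2 μ (firstOrderOp a b w)} := by
  have := hD.isProbabilityMeasure
  obtain ⟨m, hmc, hm0, hrange⟩ := exists_speed_density hD.isOpen hD.ordConnected hD.nonempty_state
    hD.continuousOn_drift hD.continuousOn_diffusion hD.diffusion_pos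
  have hhm : ∀ h : ℝ → ℝ, Continuous h → HasCompactSupport h → tsupport h ⊆ S →
      Continuous (fun x => h x * m x) ∧ HasCompactSupport fun x => h x * m x := by
    intro h hh hhc hhS
    have hs : tsupport (fun x => h x * m x) ⊆ tsupport h :=
      closure_mono (Function.support_mul_subset_left _ _)
    exact ⟨(hh.continuousOn.mul hmc).continuous_of_tsupport_subset hD.isOpen (hs.trans hhS),
      hhc.of_isClosed_subset (isClosed_tsupport _) hs⟩
  -- a normalized bump function
  obtain ⟨k, hk, hkc, hkS, hk1⟩ : ∃ k : ℝ → ℝ, Continuous k ∧ HasCompactSupport k ∧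
      tsupport k ⊆ S ∧ ∫ x, k x * m x = 1 := by
    obtain ⟨x₀, hx₀⟩ := hD.nonempty_state
    obtain ⟨χ, hχ1, hχc, hχS, hχb⟩ := exists_continuousMap_one_of_isCompact_subset_isOpen
      (isCompact_singleton (x := x₀)) hD.isOpen (singleton_subset_iff.2 hx₀)
    obtain ⟨h1, h2⟩ := hhm χ χ.continuous hχc hχS
    have hpos : 0 < ∫ x, χ x * m x := by
      refine h1.integral_pos_of_hasCompactSupport_nonneg_nonzero h2 (fun x => ?_) (x := x₀) ?_
      · by_cases hxS : x ∈ S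
        · exact mul_nonneg (hχb x).1 (hm0 x hxS).le
        · have : χ x = 0 := image_eq_zero_of_notMem_tsupport fun h' => hxS (hχS h')
          simp [this]
      · rw [hχ1 (mem_singleton x₀)]
        simpa using (hm0 x₀ hx₀).ne'
    have hs : tsupport (fun x => (∫ x, χ x * m x)⁻¹ * χ x) ⊆ tsupport χ :=
      closure_mono (Function.support_mul_subset_right _ _)
    refine ⟨fun x => (∫ x, χ x * m x)⁻¹ * χ x, continuous_const.mul χ.continuous,
      hχc.of_isClosed_subset (isClosed_tsupport _) hs, hs.trans hχS, ?_⟩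
    simp only [mul_assoc]
    rw [integral_const_mul, inv_mul_cancel₀ hpos.ne']
  have hmem : ∀ h : ℝ → ℝ, Continuous h → HasCompactSupport h → MemLp h 2 μ := fun h h1 h2 =>
    memLp_of_continuous_of_hasCompactSupport h1 h2
  -- Subtracting `(∫ h m) k` puts any `h` in the range of the operator. Since the range has `μ`-mean
  -- zero, the mean of `h` is `c ∫ h m`.
  set c := ∫ x, k x ∂μ with hc
  -- the range contains the centred functions
  have hproj : ∀ h : ℝ → ℝ, Continuous h → HasCompactSupport h → tsupport h ⊆ S →
      (∃ v w, IsTestFunction S v w ∧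
        toL2 μ h - (∫ x, h x * m x) • toL2 μ k = toL2 μ (firstOrderOp a b w)) ∧
      ∫ x, h x ∂μ = c * ∫ x, h x * m x := by
    intro h hh hhc hhS
    set r := ∫ x, h x * m x with hr
    have hs : tsupport (fun x => h x - r * k x) ⊆ S := by
      refine (closure_minimal (fun x hx => ?_) ((isClosed_tsupport h).union
        (isClosed_tsupport k))).trans (union_subset hhS hkS)
      by_contra hcon
      rw [mem_union, not_or] at hcon
      refine hx ?_
      simp only
      rw [image_eq_zero_of_notMem_tsupport hcon.1, image_eq_zero_of_notMem_tsupport hcon.2]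
      ring
    have hcs : HasCompactSupport fun x => h x - r * k x := hhc.sub (hkc.mul_left (f := fun _ => r))
    have hcc : Continuous fun x => h x - r * k x := hh.sub (continuous_const.mul hk)
    have h0 : ∫ x, (h x - r * k x) * m x = 0 := by
      obtain ⟨i1, i2⟩ := hhm h hh hhc hhS
      obtain ⟨j1, j2⟩ := hhm k hk hkc hkS
      simp only [sub_mul, mul_assoc]
      rw [integral_sub (i1.integrable_of_hasCompactSupport i2)
        ((j1.integrable_of_hasCompactSupport j2).const_mul _), integral_const_mul, hk1]
      ring
    obtain ⟨w, hw, hwc, hwS, hwh⟩ := hrange _ hcc hcs hs h0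
    obtain ⟨v, hv⟩ := exists_isTestFunction hw hwc hwS
    refine ⟨⟨v, w, hv, ?_⟩, ?_⟩
    · rw [hwh, toL2_of_memLp (hmem _ hcc hcs), toL2_of_memLp (hmem h hh hhc),
        toL2_of_memLp (hmem k hk hkc), ← MemLp.toLp_const_smul, ← MemLp.toLp_sub]
      rfl
    · have h1 := hD.integral_op_eq_zero hw hwc hwS
      rw [hwh, integral_sub ((hmem h hh hhc).integrable one_le_two)
        (((hmem k hk hkc).integrable one_le_two).const_mul _), integral_const_mul] at h1
      linarith
  have hnorm := hD.isMixingSemigroup.norm_unit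
  set e := toL2 μ fun _ => (1 : ℝ) with he
  -- If `c` were zero, every continuous `h` with compact support in `S` would have mean zero,
  -- although such functions approximate the constant one.
  have hc0 : c ≠ 0 := by
    intro h0
    obtain ⟨h, hh, hhc, hhS, hlt⟩ := exists_continuous_approx hD.isOpen hD.measure_state e one_pos
    have h1 := (hproj h hh hhc hhS).2
    rw [h0, zero_mul, ← inner_one_toL2 (hmem h hh hhc)] at h1
    have h2 : inner ℝ e (e - toL2 μ h) = 1 := by
      rw [inner_sub_right, h1, hD.isMixingSemigroup.inner_self, sub_zero]
    have h3 := real_inner_le_norm e (e - toL2 μ h)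
    rw [h2, hnorm] at h3
    linarith
  rw [Metric.mem_closure_iff]
  intro ε hε
  -- As `x` has mean zero, the mean of its approximation `h`, and with it the correction `r k`, is
  -- controlled by the approximation error; `K` collects both errors.
  set K := 1 + |c|⁻¹ * ‖toL2 μ k‖ with hK
  have hK0 : 0 < K := by positivity
  obtain ⟨h, hh, hhc, hhS, hlt⟩ := exists_continuous_approx hD.isOpen hD.measure_state x
    (div_pos hε hK0)
  obtain ⟨⟨v, w, hv, hvw⟩, hch⟩ := hproj h hh hhc hhS
  refine ⟨_, ⟨v, w, hv, rfl⟩, ?_⟩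
  rw [← hvw, dist_eq_norm]
  set r := ∫ x, h x * m x with hr
  have hr1 : |r| ≤ |c|⁻¹ * ‖x - toL2 μ h‖ := by
    have h1 : c * r = -inner ℝ e (x - toL2 μ h) := by
      rw [inner_sub_right, hx, inner_one_toL2 (hmem h hh hhc), hch]
      ring
    have h2 : |c * r| ≤ ‖x - toL2 μ h‖ := by
      rw [h1, abs_neg]
      refine (abs_real_inner_le_norm _ _).trans ?_
      rw [hnorm, one_mul]
    rw [abs_mul] at h2
    rw [inv_mul_eq_div, le_div_iff₀ (abs_pos.2 hc0)]
    linarith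
  calc ‖x - (toL2 μ h - r • toL2 μ k)‖ = ‖(x - toL2 μ h) + r • toL2 μ k‖ := by congr 1; abel
    _ ≤ ‖x - toL2 μ h‖ + |r| * ‖toL2 μ k‖ := by
        refine (norm_add_le _ _).trans ?_
        rw [norm_smul, Real.norm_eq_abs]
    _ ≤ ‖x - toL2 μ h‖ + |c|⁻¹ * ‖x - toL2 μ h‖ * ‖toL2 μ k‖ := by gcongr
    _ = K * ‖x - toL2 μ h‖ := by rw [hK]; ring
    _ < K * (ε / K) := by gcongr
    _ = ε := mul_div_cancel₀ _ hK0.ne'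

variable {U : Lp ℝ 2 μ →L[ℝ] Lp ℝ 2 μ}
  (hU : IsPotential (transitionOp P μ X) (toL2 μ fun _ => 1) U)
include hU

/-- Because `U` undoes the generator up to sign and centring, the left side is `-⟨v₁, L v₂⟩`, and
integration by parts turns it into the Dirichlet form. -/
theorem inner_potential_op {v₁ w₁ v₂ w₂ : ℝ → ℝ} (h₁ : IsTestFunction S v₁ w₁)
    (h₂ : IsTestFunction S v₂ w₂) :
    inner ℝ (U (toL2 μ (firstOrderOp a b w₁))) (toL2 μ (firstOrderOp a b w₂))
      = ∫ x, 1 / 2 * b x ^ 2 * (w₁ x * w₂ x) ∂μ := by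
  have := hD.isProbabilityMeasure
  have h0 := hD.isMixingSemigroup.inner_generator (hD.hasGenerator h₂)
  rw [hD.isMixingSemigroup.potential_generator hU (hD.hasGenerator h₁), inner_neg_left,
    centre_apply, inner_sub_left, real_inner_smul_left, h0, mul_zero, sub_zero,
    inner_toL2 h₁.memLp (hD.memLp_op h₂), hD.integral_mul_op h₂ h₁, neg_neg]
  simp only [mul_comm (w₂ _)]

/-- Reversibility: the potential operator is self-adjoint. -/
theorem potential_symm (x y : Lp ℝ 2 μ) : inner ℝ (U x) y = inner ℝ x (U y) := by
  refine hD.isMixingSemigroup.potential_symm_of_dense hU hD.mem_closure_range ?_ x y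
  rintro _ ⟨v₁, w₁, h₁, rfl⟩ _ ⟨v₂, w₂, h₂, rfl⟩
  rw [hD.inner_potential_op hU h₁ h₂, real_inner_comm, hD.inner_potential_op hU h₂ h₁]
  simp only [mul_comm (w₂ _)]

end IsStationaryDiffusion

end StationaryDiffusion

/-! ### The variance of the empirical mean -/

section Autocorrelation

variable {E : Type*} [NormedAddCommGroup E] [InnerProductSpace ℝ E] [CompleteSpace E]
  {T : ℝ≥0 → E →L[ℝ] E} {e : E} {U : E →L[ℝ] E}

namespace IsMixingSemigroup

variable (hT : IsMixingSemigroup T e) (hU : IsPotential T e U)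
  (hsymm : ∀ x y, inner ℝ (U x) y = inner ℝ x (U y))
include hT hU hsymm

theorem inner_map_add_self (t : ℝ≥0) (x : E) : inner ℝ x (T (t + t) x) = ‖T t x‖ ^ 2 := by
  rw [hT.add, ← hT.inner_map_comm hU hsymm, real_inner_self_eq_norm_sq]

/-- Splitting `t` into halves and moving one half across makes the autocorrelation a squared norm;
contractivity then also makes it decreasing. -/
theorem inner_map_nonneg (t : ℝ≥0) (x : E) : 0 ≤ inner ℝ x (T t x) := by
  rw [← add_halves t, hT.inner_map_add_self hU hsymm]
  positivity

theorem inner_map_antitone (x : E) : Antitone fun t => inner ℝ x (T t x) := by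
  intro s t hst
  simp only
  rw [← add_halves t, ← add_halves s, hT.inner_map_add_self hU hsymm,
    hT.inner_map_add_self hU hsymm]
  obtain ⟨r, hr⟩ := exists_add_of_le (show s / 2 ≤ t / 2 by gcongr)
  have h : ‖T (t / 2) x‖ ≤ ‖T (s / 2) x‖ := by
    rw [hr, add_comm, hT.add]
    exact hT.contraction _ _
  gcongr

/-- The left side is a right-hand Riemann sum of a nonnegative decreasing function, hence at most
its integral over the half-line, which is `⟨x, U x⟩`. -/
theorem sum_inner_map_le {x : E} (hx : inner ℝ e x = 0) {δ : ℝ≥0} (hδ : 0 < δ) (n : ℕ) :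
    (δ : ℝ) * ∑ i ∈ Finset.range n, inner ℝ x (T ((i + 1 : ℕ) * δ) x) ≤ inner ℝ x (U x) := by
  have hδ' : (0 : ℝ) < δ := hδ
  set c : ℝ → ℝ := fun u => inner ℝ x (T u.toNNReal x) with hc
  have hca : Antitone c := fun s t hst =>
    hT.inner_map_antitone hU hsymm x (Real.toNNReal_le_toNNReal hst)
  have hint : IntegrableOn c (Ioi 0) := (hT.integrableOn x hx).const_inner x
  have hI : ∫ u in Ioi 0, c u = inner ℝ x (U x) := by
    rw [hU x, centre_of_inner_eq_zero hx]
    exact integral_inner (𝕜 := ℝ) (hT.integrableOn x hx) x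
  have h1 := AntitoneOn.sum_le_integral (x₀ := 0) (a := n) (f := fun u => c (u * δ))
    (Antitone.antitoneOn (fun s t hst => hca (by gcongr)) _)
  have h2 : ∀ i : ℕ, c ((0 + (i + 1 : ℕ)) * δ) = inner ℝ x (T ((i + 1 : ℕ) * δ) x) := by
    intro i
    have : ((0 : ℝ) + (i + 1 : ℕ)) * δ = (((i + 1 : ℕ) * δ : ℝ≥0) : ℝ) := by push_cast; ring
    rw [hc]
    simp only
    rw [this, Real.toNNReal_coe]
  simp only [h2] at h1
  rw [intervalIntegral.integral_comp_mul_right _ hδ'.ne', smul_eq_mul] at h1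
  have h3 : ∫ u in (0 * (δ : ℝ))..(0 + n) * δ, c u ≤ ∫ u in Ioi 0, c u := by
    rw [zero_mul, zero_add, intervalIntegral.integral_of_le (by positivity)]
    exact setIntegral_mono_set hint (.of_forall fun u => hT.inner_map_nonneg hU hsymm _ _)
      (Ioc_subset_Ioi_self.eventuallyLE)
  rw [← hI]
  calc _ ≤ (δ : ℝ) * ((δ : ℝ)⁻¹ * ∫ u in (0 * (δ : ℝ))..(0 + n) * δ, c u) := by gcongr
    _ = ∫ u in (0 * (δ : ℝ))..(0 + n) * δ, c u := by field_simp
    _ ≤ _ := h3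

/-- The variance of a sum of variables with the autocorrelation `⟪x, T_t x⟫`. -/
theorem norm_sum_sq_le {H : Type*} [NormedAddCommGroup H] [InnerProductSpace ℝ H]
    {x : E} (hx : inner ℝ e x = 0) {δ : ℝ≥0} (hδ : 0 < δ) {y : ℕ → H}
    (hy : ∀ i j, inner ℝ (y i) (y (i + j)) = inner ℝ x (T (j * δ) x)) (n : ℕ) :
    (δ : ℝ) * ‖∑ i ∈ Finset.range n, y i‖ ^ 2 ≤ n * (δ * ‖x‖ ^ 2 + 2 * inner ℝ x (U x)) := by
  induction n with
  | zero => simp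
  | succ n ih =>
    have h1 : inner ℝ (∑ i ∈ Finset.range n, y i) (y n)
        = ∑ i ∈ Finset.range n, inner ℝ x (T ((i + 1 : ℕ) * δ) x) := by
      -- After reversal the index counts the lag to the last variable, from `1` to `n`.
      rw [sum_inner, ← Finset.sum_range_reflect]
      refine Finset.sum_congr rfl fun i hi => ?_
      have hi' := Finset.mem_range.1 hi
      have h : n - 1 - i + (i + 1) = n := by lia
      rw [← hy (n - 1 - i) (i + 1), h]
    have h2 : ‖y n‖ ^ 2 = ‖x‖ ^ 2 := by
      have := hy n 0
      simpa [hT.zero] using this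
    have h3 := hT.sum_inner_map_le hU hsymm hx hδ n
    rw [Finset.sum_range_succ, norm_add_sq_real, h1, h2]
    rw [Nat.cast_add_one]
    linarith

end IsMixingSemigroup

end Autocorrelation

section Empirical

variable {Ω : Type*} [mΩ : MeasurableSpace Ω] {S : Set ℝ} {a b : ℝ → ℝ} {μ : Measure ℝ}
  {P : Measure Ω} [IsProbabilityMeasure P] {ℱ : Filtration ℝ≥0 mΩ} {X : ℝ≥0 → Ω → ℝ}

theorem IsStationaryDiffusion.integral_sum_sq_le (hD : IsStationaryDiffusion S a b μ P ℱ X)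
    {U : Lp ℝ 2 μ →L[ℝ] Lp ℝ 2 μ}
    (hU : IsPotential (transitionOp P μ X) (toL2 μ fun _ => 1) U) {f : ℝ → ℝ} (hf : MemLp f 2 μ)
    (hf0 : ∫ x, f x ∂μ = 0) {δ : ℝ≥0} (hδ : 0 < δ) (n : ℕ) :
    (δ : ℝ) * ∫ ω, (∑ i ∈ Finset.Icc 1 n, f (X (i * δ) ω)) ^ 2 ∂P
      ≤ n * (δ * ‖toL2 μ f‖ ^ 2 + 2 * inner ℝ (toL2 μ f) (U (toL2 μ f))) := by
  have := hD.isProbabilityMeasure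
  have hmp := hD.measurePreserving
  have hfX : ∀ t, MemLp (fun ω => f (X t ω)) 2 P := fun t => hf.comp_measurePreserving (hmp t)
  have hy : ∀ i j : ℕ, inner ℝ ((hfX ((i + 1 : ℕ) * δ)).toLp)
      ((hfX ((i + j + 1 : ℕ) * δ)).toLp)
      = inner ℝ (toL2 μ f) (transitionOp P μ X (j * δ) (toL2 μ f)) := by
    intro i j
    rw [inner_toLp_toLp, inner_transitionOp hmp]
    have h1 : ((i + j + 1 : ℕ) : ℝ≥0) * δ = (i + 1 : ℕ) * δ + j * δ := by push_cast; ring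
    rw [h1, integral_mul_shift hmp hD.stationary _ _ hf.aestronglyMeasurable
      hf.aestronglyMeasurable]
    refine integral_congr_ae ?_
    filter_upwards [(hmp 0).quasiMeasurePreserving.ae (toL2_ae_eq hf),
      (hmp (j * δ)).quasiMeasurePreserving.ae (toL2_ae_eq hf)] with ω h2 h3
    rw [h2, h3]
  have hx : inner ℝ (toL2 μ fun _ => (1 : ℝ)) (toL2 μ f) = 0 := by rw [inner_one_toL2 hf, hf0]
  have key := hD.isMixingSemigroup.norm_sum_sq_le hU (hD.potential_symm hU) hx hδ
    (y := fun i => (hfX ((i + 1 : ℕ) * δ)).toLp) hy n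
  have hsum : ∑ i ∈ Finset.range n, (hfX ((i + 1 : ℕ) * δ)).toLp
      = (memLp_finsetSum' (Finset.range n) fun i _ => hfX ((i + 1 : ℕ) * δ)).toLp := by
    generalize Finset.range n = s
    induction s using Finset.cons_induction with
    | empty => simp
    | cons i s hi ih => simp only [Finset.sum_cons, ih]; rfl
  rw [hsum, norm_toLp_sq] at key
  refine le_of_eq_of_le ?_ key
  congr 1
  refine integral_congr_ae (.of_forall fun ω => ?_)
  simp only [Finset.sum_apply]
  rw [Finset.range_eq_Ico, Finset.sum_Ico_add' (fun i : ℕ => f (X (i * δ) ω)) 0 n 1]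
  rfl

end Empirical

/-! ### The variance of a normal limit law -/

section LimitLaw

/-- The function `z ↦ min (z², K)`. -/
def truncSq (K : ℝ) (hK : 0 ≤ K) : BoundedContinuousFunction ℝ ℝ :=
  BoundedContinuousFunction.ofNormedAddCommGroup (fun z => min (z ^ 2) K) (by fun_prop) K
    fun z => by
      rw [Real.norm_of_nonneg (le_min (sq_nonneg z) hK)]
      exact min_le_right _ _

theorem truncSq_apply {K : ℝ} (hK : 0 ≤ K) (z : ℝ) : truncSq K hK z = min (z ^ 2) K := rfl

theorem integral_sq_gaussianReal (v : ℝ≥0) : ∫ z, z ^ 2 ∂gaussianReal 0 v = v := by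
  have h := variance_id_gaussianReal (μ := 0) (v := v)
  rw [variance_eq_integral aemeasurable_id] at h
  simpa [integral_id_gaussianReal] using h

theorem tendsto_integral_truncSq (v : ℝ≥0) :
    Tendsto (fun n : ℕ => ∫ z, truncSq n n.cast_nonneg z ∂gaussianReal 0 v) atTop (𝓝 v) := by
  rw [← integral_sq_gaussianReal v]
  refine tendsto_integral_of_dominated_convergence (fun z => z ^ 2)
    (fun n => (truncSq n n.cast_nonneg).continuous.aestronglyMeasurable)
    ?_ (fun n => .of_forall fun z => ?_) (.of_forall fun z => ?_)
  · exact (memLp_id_gaussianReal (μ := 0) (v := v) 2).integrable_sq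
  · rw [truncSq_apply, Real.norm_of_nonneg (le_min (sq_nonneg z) n.cast_nonneg)]
    exact min_le_left _ _
  · refine tendsto_const_nhds.congr' ?_
    filter_upwards [eventually_ge_atTop ⌈z ^ 2⌉₊] with n hn
    rw [truncSq_apply, min_eq_left (Nat.ceil_le.1 hn)]

variable {Ω : Type*} [mΩ : MeasurableSpace Ω] {P : Measure Ω} [IsProbabilityMeasure P]
  {m : ℝ → ℝ} {θ₀ d : ℝ} {r B : ℕ → ℝ} {est Z : ℕ → Ω → ℝ} {L : ℝ} {v : ℝ≥0}

/-- Near `θ₀` the derivative gives `c |est - θ₀| ≤ |m(est) - m(θ₀)|`, and the right side is `|Z|`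
off an event of vanishing probability. The truncation limits the contribution of that event to `c²
K` times its probability and makes the test function bounded and continuous, as convergence in law
requires. -/
theorem mul_integral_truncSq_le (hm : HasDerivAt m d θ₀) (hest : ∀ n, Measurable (est n))
    (hE : ∀ n, MeasurableSet {ω | Z n ω = m (est n ω) - m θ₀})
    (hP : Tendsto (fun n => P {ω | Z n ω = m (est n ω) - m θ₀}) atTop (𝓝 1))
    (hcons : TendstoInMeasure P est atTop fun _ => θ₀)
    (hZi : ∀ n, Integrable (fun ω => Z n ω ^ 2) P)
    (hZ : ∀ᶠ n in atTop, r n ^ 2 * ∫ ω, Z n ω ^ 2 ∂P ≤ B n) (hB : Tendsto B atTop (𝓝 L))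
    (hlaw : TendstoInDistribution (fun n ω => r n * (est n ω - θ₀)) atTop (id : ℝ → ℝ)
      (fun _ => P) (gaussianReal 0 v))
    {c : ℝ} (hc0 : 0 ≤ c) (hc : c < |d|) {K : ℝ} (hK : 0 ≤ K) :
    c ^ 2 * ∫ z, truncSq K hK z ∂gaussianReal 0 v ≤ L := by
  obtain ⟨δ, hδ, hδm⟩ : ∃ δ > 0, ∀ y, |y - θ₀| < δ → c * |y - θ₀| ≤ |m y - m θ₀| := by
    have h1 := (hasDerivAt_iff_isLittleO.1 hm).bound (sub_pos.2 hc)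
    obtain ⟨δ, hδ, h2⟩ := Metric.eventually_nhds_iff.1 h1
    refine ⟨δ, hδ, fun y hy => ?_⟩
    have h3 := h2 (show dist y θ₀ < δ from hy)
    simp only [Real.norm_eq_abs, smul_eq_mul] at h3
    have h4 := abs_sub_abs_le_abs_sub ((y - θ₀) * d) (m y - m θ₀)
    rw [abs_sub_comm ((y - θ₀) * d), abs_mul] at h4
    linarith
  set bad : ℕ → Set Ω := fun n =>
    {ω | Z n ω = m (est n ω) - m θ₀}ᶜ ∪ {ω | δ ≤ ‖est n ω - θ₀‖} with hbad
  have hbadm : ∀ n, MeasurableSet (bad n) := fun n =>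
    (hE n).compl.union (measurableSet_le measurable_const ((hest n).sub_const _).norm)
  have hbad0 : Tendsto (fun n => P.real (bad n)) atTop (𝓝 0) := by
    have h1 : Tendsto (fun n => P {ω | Z n ω = m (est n ω) - m θ₀}ᶜ) atTop (𝓝 0) := by
      simp only [prob_compl_eq_one_sub (hE _)]
      simpa using ENNReal.Tendsto.sub tendsto_const_nhds hP (Or.inl ENNReal.one_ne_top)
    have h2 := tendstoInMeasure_iff_norm.1 hcons δ hδ
    have h3 : Tendsto (fun n => P (bad n)) atTop (𝓝 0) :=
      tendsto_of_tendsto_of_tendsto_of_le_of_le tendsto_const_nhds (by simpa using h1.add h2)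
        (fun n => zero_le) fun n => measure_union_le _ _
    have h4 := (ENNReal.tendsto_toReal ENNReal.zero_ne_top).comp h3
    rwa [ENNReal.toReal_zero] at h4
  have hWm : ∀ n, Measurable fun ω => r n * (est n ω - θ₀) := fun n =>
    ((hest n).sub_const _).const_mul _
  have hbound : ∀ᶠ n in atTop, c ^ 2 * ∫ ω, truncSq K hK (r n * (est n ω - θ₀)) ∂P
      ≤ B n + c ^ 2 * K * P.real (bad n) := by
    filter_upwards [hZ] with n hn
    have h1 : ∀ ω, c ^ 2 * truncSq K hK (r n * (est n ω - θ₀))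
        ≤ r n ^ 2 * Z n ω ^ 2 + (bad n).indicator (fun _ => c ^ 2 * K) ω := by
      intro ω
      rw [truncSq_apply]
      by_cases hω : ω ∈ bad n
      · rw [indicator_of_mem hω]
        have : c ^ 2 * min ((r n * (est n ω - θ₀)) ^ 2) K ≤ c ^ 2 * K := by
          gcongr
          exact min_le_right _ _
        nlinarith [sq_nonneg (r n * Z n ω)]
      · rw [indicator_of_notMem hω, add_zero]
        simp only [hbad, mem_union, mem_compl_iff, mem_ofPred_eq, not_or, not_not, not_le,
          Real.norm_eq_abs] at hω
        have h2 := hδm _ hω.2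
        rw [← hω.1] at h2
        have h3 : (c * |est n ω - θ₀|) ^ 2 ≤ |Z n ω| ^ 2 := by gcongr
        rw [mul_pow, sq_abs, sq_abs] at h3
        calc c ^ 2 * min ((r n * (est n ω - θ₀)) ^ 2) K
            ≤ c ^ 2 * (r n * (est n ω - θ₀)) ^ 2 := by
              gcongr
              exact min_le_left _ _
          _ = r n ^ 2 * (c ^ 2 * (est n ω - θ₀) ^ 2) := by ring
          _ ≤ r n ^ 2 * Z n ω ^ 2 := by gcongr
    have hi1 : Integrable (fun ω => truncSq K hK (r n * (est n ω - θ₀))) P :=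
      Integrable.of_bound
        ((truncSq K hK).continuous.measurable.comp (hWm n)).aestronglyMeasurable _
        (.of_forall fun ω => (truncSq K hK).norm_coe_le_norm _)
    have hi2 : Integrable ((bad n).indicator fun _ => c ^ 2 * K) P :=
      (integrable_const _).indicator (hbadm n)
    have h4 := integral_mono (hi1.const_mul (c ^ 2)) (((hZi n).const_mul (r n ^ 2)).add hi2) h1
    rw [integral_const_mul] at h4
    refine h4.trans ?_
    simp only [Pi.add_apply]
    rw [integral_add ((hZi n).const_mul _) hi2, integral_const_mul,
      integral_indicator_const _ (hbadm n), smul_eq_mul]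
    linarith
  have hlim : Tendsto (fun n => ∫ ω, truncSq K hK (r n * (est n ω - θ₀)) ∂P) atTop
      (𝓝 (∫ z, truncSq K hK z ∂gaussianReal 0 v)) := by
    have h1 := ProbabilityMeasure.tendsto_iff_forall_integral_tendsto.1 hlaw.tendsto (truncSq K hK)
    simp only [ProbabilityMeasure.coe_mk, Measure.map_id] at h1
    refine h1.congr fun n => ?_
    exact integral_map (hWm n).aemeasurable (truncSq K hK).continuous.aestronglyMeasurable
  have hR : Tendsto (fun n => B n + c ^ 2 * K * P.real (bad n)) atTop (𝓝 L) := by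
    simpa using hB.add (hbad0.const_mul (c ^ 2 * K))
  exact le_of_tendsto_of_tendsto (hlim.const_mul _) hR hbound

/-- If `r_n (est_n - θ₀)` converges in law to `N(0, v)`, where `Z_n = m(est_n) - m(θ₀)` with
probability tending to one and the second moments of `r_n Z_n` are asymptotically at most `L`,
then `v m'(θ₀)² ≤ L`. -/
theorem variance_mul_sq_le (hm : HasDerivAt m d θ₀) (hest : ∀ n, Measurable (est n))
    (hE : ∀ n, MeasurableSet {ω | Z n ω = m (est n ω) - m θ₀})
    (hP : Tendsto (fun n => P {ω | Z n ω = m (est n ω) - m θ₀}) atTop (𝓝 1))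
    (hcons : TendstoInMeasure P est atTop fun _ => θ₀)
    (hZi : ∀ n, Integrable (fun ω => Z n ω ^ 2) P)
    (hZ : ∀ᶠ n in atTop, r n ^ 2 * ∫ ω, Z n ω ^ 2 ∂P ≤ B n) (hB : Tendsto B atTop (𝓝 L))
    (hlaw : TendstoInDistribution (fun n ω => r n * (est n ω - θ₀)) atTop (id : ℝ → ℝ)
      (fun _ => P) (gaussianReal 0 v)) (hd : d ≠ 0) : v * d ^ 2 ≤ L := by
  have h1 : ∀ c, 0 ≤ c → c < |d| → c ^ 2 * v ≤ L := fun c hc0 hc =>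
    le_of_tendsto ((tendsto_integral_truncSq v).const_mul _) (.of_forall fun n =>
      mul_integral_truncSq_le hm hest hE hP hcons hZi hZ hB hlaw hc0 hc n.cast_nonneg)
  have h2 : Tendsto (fun c : ℝ => c ^ 2 * v) (𝓝[<] |d|) (𝓝 (|d| ^ 2 * v)) :=
    (Continuous.tendsto (by fun_prop) _).mono_left nhdsWithin_le_nhds
  rw [sq_abs, mul_comm] at h2
  refine le_of_tendsto h2 ?_
  filter_upwards [Ioo_mem_nhdsLT (abs_pos.2 hd)] with c hc
  exact h1 c hc.1.le hc.2

end LimitLaw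

/-! ### Regular diffusion models -/

section OpenInterval

theorem isOpen_openInterval (l r : EReal) : IsOpen (openInterval l r) :=
  (isOpen_lt continuous_const continuous_coe_real_ereal).inter
    (isOpen_lt continuous_coe_real_ereal continuous_const)

theorem ordConnected_openInterval (l r : EReal) : (openInterval l r).OrdConnected :=
  ⟨fun _ hx _ hy _ hz => ⟨hx.1.trans_le (EReal.coe_le_coe_iff.2 hz.1),
    (EReal.coe_le_coe_iff.2 hz.2).trans_lt hy.2⟩⟩

theorem openInterval_bot_top : openInterval ⊥ ⊤ = univ :=
  eq_univ_of_forall fun x => ⟨EReal.bot_lt_coe x, EReal.coe_lt_top x⟩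

end OpenInterval

theorem CPoly.continuousOn {j : ℕ} {S : Set ℝ} {g : ℝ → ℝ} (h : CPoly j S g) : ContinuousOn g S :=
  h.1.continuousOn

theorem CPoly.polyGrowth {j : ℕ} {S : Set ℝ} {g : ℝ → ℝ} (h : CPoly j S g) : PolyGrowth S g := by
  simpa using h.2 0 (Nat.zero_le j)

/-- Rounding the real exponent up gives integer powers, for which moments are assumed. -/
theorem PolyGrowth.exists_pow {S : Set ℝ} {g : ℝ → ℝ} (h : PolyGrowth S g) :
    ∃ (C : ℝ) (k : ℕ), ∀ x ∈ S, |g x| ≤ C * (1 + |x| ^ k) := by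
  obtain ⟨C, hC, h⟩ := h
  refine ⟨C * 2, ⌈C⌉₊, fun x hx => (h x hx).trans ?_⟩
  have h1 : |x| ^ C ≤ 1 + |x| ^ ⌈C⌉₊ := by
    rcases le_total |x| 1 with hx1 | hx1
    · have := Real.rpow_le_one (abs_nonneg x) hx1 hC.le
      have : 0 ≤ |x| ^ ⌈C⌉₊ := by positivity
      linarith
    · have := Real.rpow_le_rpow_of_exponent_le hx1 (Nat.le_ceil C)
      rw [Real.rpow_natCast] at this
      linarith
  have h2 : 0 ≤ |x| ^ ⌈C⌉₊ := by positivity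
  rw [mul_assoc]
  gcongr
  linarith

theorem PolyGrowth.memLp {S : Set ℝ} {g : ℝ → ℝ} (h : PolyGrowth S g) (hg : ContinuousOn g S)
    (hS : MeasurableSet S) {μ : Measure ℝ} [IsProbabilityMeasure μ] (hμ : ∀ᵐ x ∂μ, x ∈ S)
    (hpow : ∀ k : ℕ, MemLp (fun x => |x| ^ k) 2 μ) : MemLp g 2 μ := by
  obtain ⟨C, k, hCk⟩ := h.exists_pow
  have h0 : MemLp (fun x : ℝ => 1 + |x| ^ k) 2 μ :=
    MemLp.add (f := fun _ => (1 : ℝ)) (g := fun x => |x| ^ k) (memLp_const 1) (hpow k)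
  have h1 : MemLp (fun x : ℝ => C * (1 + |x| ^ k)) 2 μ := h0.const_mul C
  have hm : AEStronglyMeasurable g μ := by
    have h2 := hg.aestronglyMeasurable (μ := μ) hS
    rwa [Measure.restrict_eq_self_of_ae_mem hμ] at h2
  refine h1.mono hm ?_
  filter_upwards [hμ] with x hx
  exact (hCk x hx).trans (le_abs_self _)

namespace Model

variable {Ω : Type*} [MeasurableSpace Ω] {M : Model Ω}

theorem Regular.isStationaryDiffusion (hM : M.Regular) {θ : ℝ} (hθ : θ ∈ M.Θ) :
    IsStationaryDiffusion M.S (fun x => M.a x θ) (fun x => M.b x θ) (M.μ θ) (M.P θ : Measure Ω)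
      M.ℱ M.X where
  sol := hM.weak_solution θ hθ
  stationary := hM.stationary θ hθ
  mixing := hM.rho_mixing θ hθ
  isOpen := isOpen_openInterval _ _
  ordConnected := ordConnected_openInterval _ _
  continuousOn_drift := (hM.drift_smooth.1 θ hθ).continuousOn
  continuousOn_diffusion := (hM.diffusion_smooth.1 θ hθ).continuousOn
  diffusion_pos := hM.diffusion_pos θ hθ

theorem Regular.memLp_pow (hM : M.Regular) {θ : ℝ} (hθ : θ ∈ M.Θ) (k : ℕ) :
    MemLp (fun x => |x| ^ k) 2 (M.μ θ) := by
  have := (hM.isStationaryDiffusion hθ).isProbabilityMeasure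
  rw [memLp_two_iff_integrable_sq (by fun_prop)]
  simp only [← pow_mul]
  rcases Nat.eq_zero_or_pos (k * 2) with h | h
  · simp only [h, pow_zero]
    exact integrable_const _
  · exact hM.moments θ hθ _ h

theorem Regular.memLp_of_polyGrowth (hM : M.Regular) {θ : ℝ} (hθ : θ ∈ M.Θ) {g : ℝ → ℝ}
    (hg : ContinuousOn g M.S) (h : PolyGrowth M.S g) : MemLp g 2 (M.μ θ) := by
  have hD := hM.isStationaryDiffusion hθ
  have := hD.isProbabilityMeasure
  exact h.memLp hg hD.isOpen.measurableSet hD.ae_mem_state (hM.memLp_pow hθ)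

theorem Regular.memLp_of_cPoly (hM : M.Regular) {θ : ℝ} (hθ : θ ∈ M.Θ) {j : ℕ} {g : ℝ → ℝ}
    (hg : CPoly j M.S g) : MemLp g 2 (M.μ θ) :=
  hM.memLp_of_polyGrowth hθ hg.continuousOn hg.polyGrowth

theorem Regular.exists_isPotential (hM : M.Regular) {θ : ℝ} (hθ : θ ∈ M.Θ) :
    ∃ U, IsPotential (M.semigroup θ) (toL2 (M.μ θ) fun _ => 1) U :=
  (hM.isStationaryDiffusion hθ).isMixingSemigroup.exists_potential

section Centred

variable (hM : M.Regular) {θ : ℝ} (hθ : θ ∈ M.Θ) {g : ℝ → ℝ} (hg : MemLp g 2 (M.μ θ))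
  (hg0 : M.mean g θ = 0)
include hM hθ hg hg0

theorem inner_one_toL2_eq_zero : inner ℝ (toL2 (M.μ θ) fun _ => 1) (toL2 (M.μ θ) g) = 0 := by
  have := (hM.isStationaryDiffusion hθ).isProbabilityMeasure
  rw [inner_one_toL2 hg]
  exact hg0

theorem potentialConverges : M.PotentialConverges θ g :=
  (hM.isStationaryDiffusion hθ).isMixingSemigroup.integrableOn _
    (inner_one_toL2_eq_zero hM hθ hg hg0)

theorem potential_eq {U : Lp ℝ 2 (M.μ θ) →L[ℝ] Lp ℝ 2 (M.μ θ)}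
    (hU : IsPotential (M.semigroup θ) (toL2 (M.μ θ) fun _ => 1) U) :
    M.potential θ g = U (toL2 (M.μ θ) g) := by
  rw [hU, centre_of_inner_eq_zero (inner_one_toL2_eq_zero hM hθ hg hg0)]
  rfl

theorem integral_mul_potential {U : Lp ℝ 2 (M.μ θ) →L[ℝ] Lp ℝ 2 (M.μ θ)}
    (hU : IsPotential (M.semigroup θ) (toL2 (M.μ θ) fun _ => 1) U) :
    ∫ x, g x * M.potential θ g x ∂(M.μ θ)
      = inner ℝ (toL2 (M.μ θ) g) (U (toL2 (M.μ θ) g)) := by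
  rw [potential_eq hM hθ hg hg0 hU, inner_eq_integral_mul]
  refine integral_congr_ae ?_
  filter_upwards [toL2_ae_eq hg] with x hx
  rw [hx]

end Centred

/-! ### The variance bounds for regular models. -/

section Bound

variable (hM : M.Regular) {θ₀ : ℝ} (hθ₀ : θ₀ ∈ M.Θ) {f : ℝ → ℝ}
  (hf : MemLp (M.centred f θ₀) 2 (M.μ θ₀))
include hM hθ₀ hf

theorem variance_eq_norm_sq :
    Var[fun ω => f (M.X 0 ω); (M.P θ₀ : Measure Ω)] = ‖toL2 (M.μ θ₀) (M.centred f θ₀)‖ ^ 2 := by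
  have hmp := (hM.isStationaryDiffusion hθ₀).measurePreserving 0
  have hfm : AEStronglyMeasurable f (M.μ θ₀) := by
    have h1 := hf.aestronglyMeasurable.add_const (M.mean f θ₀)
    simpa [centred] using h1
  have hfX : AEMeasurable (fun ω => f (M.X 0 ω)) (M.P θ₀ : Measure Ω) :=
    (hfm.comp_measurePreserving hmp).aemeasurable
  have h2 : ∫ ω, f (M.X 0 ω) ∂(M.P θ₀ : Measure Ω) = M.mean f θ₀ :=
    integral_comp_measurePreserving hmp hfm
  rw [variance_eq_integral hfX, h2, norm_toL2_sq hf]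
  exact integral_comp_measurePreserving hmp (hf.aestronglyMeasurable.pow 2)

theorem avar_le_avarBound (hf0 : M.mean (M.centred f θ₀) θ₀ = 0) {lam : ℝ}
    (hlam : IsSpectralGap (M.semigroup θ₀) lam) : M.avar f θ₀ ≤ M.avarBound f θ₀ lam := by
  have hD := hM.isStationaryDiffusion hθ₀
  obtain ⟨U, hU⟩ := hM.exists_isPotential hθ₀
  rw [avar, avarBound, variance_eq_norm_sq hM hθ₀ hf, integral_mul_potential hM hθ₀ hf hf0 hU]
  have h1 := hD.isMixingSemigroup.inner_le_of_isSpectralGap hU (hD.potential_symm hU) hlam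
    (toL2 (M.μ θ₀) (M.centred f θ₀))
  rw [real_inner_comm] at h1
  calc _ ≤ 2 * (lam⁻¹ * ‖toL2 (M.μ θ₀) (M.centred f θ₀)‖ ^ 2) / deriv (M.mean f) θ₀ ^ 2 := by
        gcongr
    _ = _ := by
        rw [← mul_assoc, mul_comm 2 lam⁻¹, mul_assoc, inv_mul_eq_div, div_div]

theorem integral_average_sq_le (hf0 : M.mean (M.centred f θ₀) θ₀ = 0)
    {U : Lp ℝ 2 (M.μ θ₀) →L[ℝ] Lp ℝ 2 (M.μ θ₀)}
    (hU : IsPotential (M.semigroup θ₀) (toL2 (M.μ θ₀) fun _ => 1) U) {δ : ℝ≥0} (hδ : 0 < δ)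
    {n : ℕ} (hn : n ≠ 0) :
    √((n : ℝ) * δ) ^ 2 *
        ∫ ω, ((n : ℝ)⁻¹ * ∑ i ∈ Finset.Icc 1 n, M.centred f θ₀ (M.X (i * δ) ω)) ^ 2
          ∂(M.P θ₀ : Measure Ω)
      ≤ δ * ‖toL2 (M.μ θ₀) (M.centred f θ₀)‖ ^ 2
        + 2 * inner ℝ (toL2 (M.μ θ₀) (M.centred f θ₀)) (U (toL2 (M.μ θ₀) (M.centred f θ₀))) := by
  have h1 := (hM.isStationaryDiffusion hθ₀).integral_sum_sq_le hU hf hf0 hδ n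
  have hn' : (0 : ℝ) < n := by positivity
  rw [Real.sq_sqrt (by positivity)]
  simp only [mul_pow]
  rw [integral_const_mul]
  refine le_of_mul_le_mul_left ?_ hn'
  refine le_of_eq_of_le ?_ h1
  generalize ∫ ω, (∑ i ∈ Finset.Icc 1 n, M.centred f θ₀ (M.X (i * δ) ω)) ^ 2
    ∂(M.P θ₀ : Measure Ω) = I
  field_simp

/-- The variance of a normal limit law of the estimators is at most
`2 μ(f* U f*) / (∂_θ μ_θ(f))²`. -/
theorem asymptoticVariance_le_avar (hfS : ContinuousOn (M.centred f θ₀) M.S)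
    (hf0 : M.mean (M.centred f θ₀) θ₀ = 0) (hmc : ContinuousOn (M.mean f) M.Θ)
    (hmd : DifferentiableAt ℝ (M.mean f) θ₀) (hd : deriv (M.mean f) θ₀ ≠ 0)
    {Δ : ℕ → ℝ≥0} {est : ℕ → Ω → ℝ} {v : ℝ≥0} (hΔ : HighFrequency Δ)
    (hest : M.IsConsistentEstimator f θ₀ Δ est) (hv : M.IsAsymptoticVariance θ₀ Δ est v) :
    (v : ℝ) ≤ M.avar f θ₀ := by
  have hD := hM.isStationaryDiffusion hθ₀
  obtain ⟨U, hU⟩ := hM.exists_isPotential hθ₀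
  rw [avar, integral_mul_potential hM hθ₀ hf hf0 hU, le_div_iff₀ (by positivity)]
  set Z : ℕ → Ω → ℝ := fun n ω =>
    (n : ℝ)⁻¹ * ∑ i ∈ Finset.Icc 1 n, M.centred f θ₀ (M.X (i * Δ n) ω) with hZdef
  have hfX : ∀ t, Measurable fun ω => M.centred f θ₀ (M.X t ω) := fun t =>
    measurable_comp_of_continuousOn hfS (hD.sol.measurable t) (hD.sol.mem_state t)
  have hZm : ∀ n, Measurable (Z n) := fun n =>
    (Finset.measurable_fun_sum _ fun i _ => hfX _).const_mul _
  have hmm : ∀ n, Measurable fun ω => M.mean f (est n ω) := fun n =>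
    measurable_comp_of_continuousOn hmc (hest.measurable n) (hest.mem n)
  -- The estimating function is `n` times the difference of the two sides, so for `n ≠ 0` its zeros
  -- are exactly this event.
  have hset : ∀ n, n ≠ 0 → {ω | M.estimatingFunction f Δ n (est n ω) ω = 0}
      = {ω | Z n ω = M.mean f (est n ω) - M.mean f θ₀} := by
    intro n hn
    have hn' : (n : ℝ) ≠ 0 := Nat.cast_ne_zero.2 hn
    ext ω
    have h1 : M.estimatingFunction f Δ n (est n ω) ω
        = n * (Z n ω - (M.mean f (est n ω) - M.mean f θ₀)) := by
      have h2 : ∀ i : ℕ, f (M.X (i * Δ n) ω) - M.mean f (est n ω)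
          = M.centred f θ₀ (M.X (i * Δ n) ω) - (M.mean f (est n ω) - M.mean f θ₀) := by
        intro i
        rw [centred]
        ring
      simp only [estimatingFunction, hZdef, h2]
      rw [Finset.sum_sub_distrib, Finset.sum_const, Nat.card_Icc, Nat.add_sub_cancel, nsmul_eq_mul]
      generalize ∑ i ∈ Finset.Icc 1 n, M.centred f θ₀ (M.X (i * Δ n) ω) = I
      field_simp
    simp only [mem_ofPred_eq, h1, mul_eq_zero, hn', false_or, sub_eq_zero]
  refine variance_mul_sq_le (Z := Z)
    (B := fun n => (Δ n : ℝ) * ‖toL2 (M.μ θ₀) (M.centred f θ₀)‖ ^ 2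
      + 2 * inner ℝ (toL2 (M.μ θ₀) (M.centred f θ₀)) (U (toL2 (M.μ θ₀) (M.centred f θ₀))))
    hmd.hasDerivAt hest.measurable
    (fun n => measurableSet_eq_fun (hZm n) ((hmm n).sub_const _)) ?_ hest.consistent
    (fun n => ?_) ?_ ?_ hv hd
  · refine hest.solves.congr' ?_
    filter_upwards [eventually_ne_atTop 0] with n hn
    rw [hset n hn]
  · have h1 : MemLp (fun ω => ∑ i ∈ Finset.Icc 1 n, M.centred f θ₀ (M.X (i * Δ n) ω)) 2
        (M.P θ₀ : Measure Ω) :=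
      memLp_finsetSum _ fun i _ => hf.comp_measurePreserving (hD.measurePreserving _)
    exact (h1.const_mul _).integrable_sq
  · filter_upwards [eventually_ne_atTop 0] with n hn
    exact integral_average_sq_le hM hθ₀ hf hf0 hU (hΔ.1 n) hn
  · have h1 : Tendsto (fun n => (Δ n : ℝ)) atTop (𝓝 0) := by
      exact_mod_cast (NNReal.continuous_coe.tendsto 0).comp hΔ.2.1
    simpa using (h1.mul_const _).add_const _

end Bound

end Model

/-! ### The Ornstein–Uhlenbeck process -/

theorem tendsto_toL2_of_dominated {μ : Measure ℝ} {F : ℕ → ℝ → ℝ} {f g : ℝ → ℝ}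
    (hF : ∀ n, Continuous (F n)) (hf : Continuous f) (hg : MemLp g 2 μ)
    (hFg : ∀ n x, |F n x| ≤ g x) (hlim : ∀ x, Tendsto (fun n => F n x) atTop (𝓝 (f x))) :
    Tendsto (fun n => toL2 μ (F n)) atTop (𝓝 (toL2 μ f)) := by
  have hfg : ∀ x, |f x| ≤ g x := fun x =>
    le_of_tendsto (hlim x).abs (.of_forall fun n => hFg n x)
  have hFm : ∀ n, MemLp (F n) 2 μ := fun n => hg.mono (hF n).aestronglyMeasurable
    (.of_forall fun x => (hFg n x).trans (le_abs_self _))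
  have hfm : MemLp f 2 μ := hg.mono hf.aestronglyMeasurable
    (.of_forall fun x => (hfg x).trans (le_abs_self _))
  rw [tendsto_iff_norm_sub_tendsto_zero]
  have h1 : Tendsto (fun n => ∫ x, (F n x - f x) ^ 2 ∂μ) atTop (𝓝 (∫ _, (0 : ℝ) ∂μ)) := by
    refine tendsto_integral_of_dominated_convergence (fun x => (2 * g x) ^ 2)
      (fun n => (((hF n).sub hf).pow 2).aestronglyMeasurable) (hg.const_mul 2).integrable_sq
      (fun n => .of_forall fun x => ?_) (.of_forall fun x => ?_)
    · rw [Real.norm_of_nonneg (sq_nonneg _)]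
      refine sq_le_sq' ?_ ?_
      · linarith [(abs_le.1 (hFg n x)).1, (abs_le.1 (hfg x)).2]
      · linarith [(abs_le.1 (hFg n x)).2, (abs_le.1 (hfg x)).1]
    · have := ((hlim x).sub_const (f x)).pow 2
      simpa using this
  have h2 : ∀ n, ‖toL2 μ (F n) - toL2 μ f‖ = √(∫ x, (F n x - f x) ^ 2 ∂μ) := by
    intro n
    have h3 : toL2 μ (F n) - toL2 μ f = ((hFm n).sub hfm).toLp := by
      rw [toL2_of_memLp (hFm n), toL2_of_memLp hfm]
      rfl
    rw [h3, ← Real.sqrt_sq (norm_nonneg (((hFm n).sub hfm).toLp)), norm_toLp_sq]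
    rfl
  simp only [h2]
  simpa using h1.sqrt

/-- Smooth cut-off functions that increase to `1`, with bounded derivatives. -/
theorem exists_cutoff : ∃ (w : ℕ → ℝ → ℝ) (C : ℝ), 0 ≤ C ∧ (∀ n, ContDiff ℝ 1 (w n)) ∧
    (∀ n, HasCompactSupport (w n)) ∧ (∀ n x, w n x ∈ Icc (0 : ℝ) 1) ∧
    (∀ n x, |deriv (w n) x| ≤ C) ∧ (∀ (n : ℕ) (x : ℝ), |x| ≤ n → w n x = 1) ∧
    ∀ (n : ℕ) (x : ℝ), |x| < n → deriv (w n) x = 0 := by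
  let χ : ContDiffBump (0 : ℝ) := ⟨1, 2, one_pos, one_lt_two⟩
  have hχ : ContDiff ℝ 1 χ := χ.contDiff
  have hχd : Continuous (deriv χ) := hχ.continuous_deriv le_rfl
  obtain ⟨C, hC⟩ := χ.hasCompactSupport.deriv.exists_bound_of_continuous hχd
  have hC0 : 0 ≤ C := (norm_nonneg _).trans (hC 0)
  -- Scaling by `n + 1` keeps the dilation invertible at `n = 0` and its factor at most one, so a
  -- single `C` bounds all derivatives.
  set w : ℕ → ℝ → ℝ := fun n x => χ ((n + 1 : ℝ)⁻¹ * x) with hw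
  have hn0 : ∀ n : ℕ, (0 : ℝ) < (n + 1 : ℝ)⁻¹ := fun n => by positivity
  have hw1 : ∀ (n : ℕ) (x : ℝ), |x| ≤ n → w n x = 1 := by
    intro n x hx
    refine χ.one_of_mem_closedBall ?_
    rw [mem_closedBall_zero_iff, Real.norm_eq_abs, abs_mul, abs_of_pos (hn0 n),
      inv_mul_le_iff₀ (by positivity)]
    change |x| ≤ (n + 1) * 1
    linarith
  have hderiv : ∀ n x, HasDerivAt (w n) (deriv χ ((n + 1 : ℝ)⁻¹ * x) * (n + 1 : ℝ)⁻¹) x := by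
    intro n x
    have h1 : HasDerivAt (fun x : ℝ => (n + 1 : ℝ)⁻¹ * x) (n + 1 : ℝ)⁻¹ x := by
      simpa using (hasDerivAt_id x).const_mul (n + 1 : ℝ)⁻¹
    exact ((hχ.differentiable one_ne_zero) _).hasDerivAt.comp x h1
  refine ⟨w, C, hC0, fun n => hχ.comp (contDiff_const.mul contDiff_id), fun n => ?_,
    fun n x => ⟨χ.nonneg, χ.le_one⟩, fun n x => ?_, hw1, fun n x hx => ?_⟩
  · exact χ.hasCompactSupport.comp_homeomorph (Homeomorph.mulLeft₀ _ (hn0 n).ne')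
  · rw [(hderiv n x).deriv, abs_mul, abs_of_pos (hn0 n)]
    have h1 : (n + 1 : ℝ)⁻¹ ≤ 1 := inv_le_one_of_one_le₀ (by linarith [n.cast_nonneg (α := ℝ)])
    calc _ ≤ C * 1 := by
          gcongr
          exact hC _
      _ = C := mul_one C
  · have h1 : w n =ᶠ[𝓝 x] fun _ => 1 := by
      filter_upwards [(isOpen_lt continuous_abs continuous_const).mem_nhds hx] with y hy
      exact hw1 n y (le_of_lt hy)
    rw [h1.deriv_eq, deriv_const]

section OrnsteinUhlenbeck

variable {Ω : Type*} [mΩ : MeasurableSpace Ω] {μ : Measure ℝ} {P : Measure Ω}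
  [IsProbabilityMeasure P] {ℱ : Filtration ℝ≥0 mΩ} {X : ℝ≥0 → Ω → ℝ} {κ ξ θ : ℝ}

/-- Approximation of the identity by test functions. -/
theorem exists_testFunction_approx [IsProbabilityMeasure μ]
    (hpow : ∀ k : ℕ, MemLp (fun x => |x| ^ k) 2 μ) (κ ξ θ : ℝ) :
    ∃ v w : ℕ → ℝ → ℝ, (∀ n, IsTestFunction univ (v n) (w n)) ∧
      Tendsto (fun n => toL2 μ (v n)) atTop (𝓝 (toL2 μ fun x => x)) ∧
      Tendsto (fun n => toL2 μ (firstOrderOp (fun x => κ * (θ - x)) (fun _ => ξ) (w n))) atTop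
        (𝓝 (toL2 μ fun x => κ * (θ - x))) ∧
      Tendsto (fun n => ∫ x, 1 / 2 * ξ ^ 2 * (w n x * w n x) ∂μ) atTop (𝓝 (1 / 2 * ξ ^ 2)) := by
  obtain ⟨w, C, hC0, hw, hwc, hw01, hwC, hw1, hw0⟩ := exists_cutoff
  have habs : MemLp (fun x : ℝ => |x|) 2 μ := by simpa using hpow 1
  have hwabs : ∀ n x, |w n x| ≤ 1 := fun n x => by
    rw [abs_of_nonneg (hw01 n x).1]
    exact (hw01 n x).2
  have htest : ∀ n, IsTestFunction univ (fun x => ∫ y in (0 : ℝ)..x, w n y) (w n) := fun n =>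
    ⟨hw n, hwc n, subset_univ _, fun _ =>
      intervalIntegral.integral_hasDerivAt_right ((hw n).continuous.intervalIntegrable _ _)
      ((hw n).continuous.stronglyMeasurableAtFilter _ _) (hw n).continuous.continuousAt⟩
  refine ⟨fun n x => ∫ y in (0 : ℝ)..x, w n y, w, htest, ?_, ?_, ?_⟩
  · refine tendsto_toL2_of_dominated (fun n => (htest n).continuous) continuous_id habs
      (fun n x => ?_) fun x => ?_
    · have := intervalIntegral.norm_integral_le_of_norm_le_const (a := 0) (b := x) (C := 1)
        (f := w n) fun y _ => hwabs n y
      simpa using this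
    · refine tendsto_const_nhds.congr' ?_
      filter_upwards [eventually_ge_atTop ⌈|x|⌉₊] with n hn
      have h1 : ∫ y in (0 : ℝ)..x, w n y = ∫ y in (0 : ℝ)..x, 1 := by
        refine intervalIntegral.integral_congr fun y hy => hw1 n y ?_
        have h2 : |y| ≤ |x| := by simpa using Set.abs_sub_left_of_mem_uIcc hy
        exact h2.trans (Nat.ceil_le.1 hn)
      rw [h1]
      simp
  · have hg : MemLp (fun x : ℝ => |κ| * |θ| + 1 / 2 * ξ ^ 2 * C + |κ| * |x|) 2 μ :=
      MemLp.add (f := fun _ => |κ| * |θ| + 1 / 2 * ξ ^ 2 * C) (g := fun x => |κ| * |x|)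
        (memLp_const _) (habs.const_mul _)
    refine tendsto_toL2_of_dominated (fun n => ?_) (by fun_prop) hg (fun n x => ?_) fun x => ?_
    · have := (hw n).continuous_deriv le_rfl
      have := (hw n).continuous
      unfold firstOrderOp
      fun_prop
    · rw [firstOrderOp]
      have h1 : |κ * (θ - x) * w n x| ≤ |κ| * (|θ| + |x|) * 1 := by
        rw [abs_mul, abs_mul]
        gcongr
        · exact abs_sub _ _
        · exact hwabs n x
      have h2 : |1 / 2 * ξ ^ 2 * deriv (w n) x| ≤ 1 / 2 * ξ ^ 2 * C := by
        rw [abs_mul, abs_of_nonneg (by positivity : 0 ≤ 1 / 2 * ξ ^ 2)]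
        gcongr
        exact hwC n x
      refine (abs_add_le _ _).trans ?_
      linarith
    · refine tendsto_const_nhds.congr' ?_
      filter_upwards [eventually_gt_atTop ⌈|x|⌉₊] with n hn
      have h1 : |x| < n := (Nat.le_ceil _).trans_lt (Nat.cast_lt.2 hn)
      rw [firstOrderOp, hw1 n x h1.le, hw0 n x h1]
      ring
  · have h1 : (1 / 2 * ξ ^ 2 : ℝ) = ∫ _, 1 / 2 * ξ ^ 2 ∂μ := by simp
    nth_rewrite 2 [h1]
    refine tendsto_integral_of_dominated_convergence (fun _ => 1 / 2 * ξ ^ 2)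
      (fun n => ?_) (integrable_const _) (fun n => .of_forall fun x => ?_) (.of_forall fun x => ?_)
    · have := (hw n).continuous
      exact Continuous.aestronglyMeasurable (by fun_prop)
    · rw [norm_mul (1 / 2 * ξ ^ 2), norm_mul (w n x), Real.norm_of_nonneg (by positivity : 0 ≤ 1 / 2 * ξ ^ 2)]
      have h2 : ‖w n x‖ * ‖w n x‖ ≤ 1 :=
        mul_le_one₀ (hwabs n x) (norm_nonneg _) (hwabs n x)
      exact mul_le_of_le_one_right (by positivity) h2
    · refine tendsto_const_nhds.congr' ?_
      filter_upwards [eventually_ge_atTop ⌈|x|⌉₊] with n hn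
      rw [hw1 n x (Nat.ceil_le.1 hn)]
      ring

variable (hD : IsStationaryDiffusion univ (fun x => κ * (θ - x)) (fun _ => ξ) μ P ℱ X)
  (hpow : ∀ k : ℕ, MemLp (fun x => |x| ^ k) 2 μ) (hκ : 0 < κ)
include hD

theorem memLp_sub_const (hpow : ∀ k : ℕ, MemLp (fun x => |x| ^ k) 2 μ) (c : ℝ) :
    MemLp (fun x => x - c) 2 μ := by
  have := hD.isProbabilityMeasure
  have h0 : MemLp (fun x : ℝ => |x|) 2 μ := by simpa using hpow 1
  exact MemLp.sub (f := fun x => x) (g := fun _ => c)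
    (h0.mono continuous_id.aestronglyMeasurable (.of_forall fun x => by simp)) (memLp_const _)

include hpow

theorem drift_ornsteinUhlenbeck :
    (toL2 μ fun x => κ * (θ - x)) = -(κ • toL2 μ fun x => x - θ) := by
  have h := memLp_sub_const hD hpow θ
  have h' : MemLp (fun x => κ * (θ - x)) 2 μ := by
    have := (h.const_mul κ).neg
    refine this.ae_eq (.of_forall fun x => ?_)
    simp only [Pi.neg_apply]
    ring
  rw [toL2_of_memLp h, toL2_of_memLp h', ← MemLp.toLp_const_smul, ← MemLp.toLp_neg]
  congr 1
  ext x
  simp only [Pi.neg_apply, Pi.smul_apply, smul_eq_mul]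
  ring

include hκ

/-- The functions `L v_n` have mean zero and converge in `L²(μ)` to the drift `κ (θ - x)`, whose
mean therefore vanishes. -/
theorem integral_ornsteinUhlenbeck : ∫ x, x ∂μ = θ := by
  have := hD.isProbabilityMeasure
  obtain ⟨v, w, htest, -, hL, -⟩ := exists_testFunction_approx hpow κ ξ θ
  have hx : MemLp (fun x : ℝ => x) 2 μ := by simpa using memLp_sub_const hD hpow 0
  have hm : MemLp (fun x => κ * (θ - x)) 2 μ :=
    (MemLp.sub (f := fun _ => θ) (g := fun x => x) (memLp_const _) hx).const_mul κ
  have h1 : Tendsto (fun n => inner ℝ (toL2 μ fun _ => (1 : ℝ))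
      (toL2 μ (firstOrderOp (fun x => κ * (θ - x)) (fun _ => ξ) (w n)))) atTop
      (𝓝 (inner ℝ (toL2 μ fun _ => (1 : ℝ)) (toL2 μ fun x => κ * (θ - x)))) :=
    tendsto_const_nhds.inner (𝕜 := ℝ) hL
  simp only [hD.isMixingSemigroup.inner_generator (hD.hasGenerator (htest _))] at h1
  have h2 := tendsto_nhds_unique h1 tendsto_const_nhds
  rw [inner_one_toL2 hm, integral_const_mul,
    integral_sub (integrable_const _) (hx.integrable one_le_two)] at h2
  simp only [integral_const, probReal_univ, smul_eq_mul, one_mul] at h2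
  rcases mul_eq_zero.1 h2 with h | h
  · exact absurd h hκ.ne'
  · linarith

theorem centre_ornsteinUhlenbeck :
    centre (toL2 μ fun _ => (1 : ℝ)) (toL2 μ fun x => x) = toL2 μ fun x => x - θ := by
  have := hD.isProbabilityMeasure
  have hx : MemLp (fun x : ℝ => x) 2 μ := by simpa using memLp_sub_const hD hpow 0
  rw [centre_apply, inner_one_toL2 hx, integral_ornsteinUhlenbeck hD hpow hκ,
    toL2_of_memLp hx, toL2_of_memLp (memLp_sub_const hD hpow θ), toL2_of_memLp (memLp_const 1),
    ← MemLp.toLp_const_smul, ← MemLp.toLp_sub]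
  congr 1
  ext x
  simp

variable {U : Lp ℝ 2 μ →L[ℝ] Lp ℝ 2 μ}
  (hU : IsPotential (transitionOp P μ X) (toL2 μ fun _ => 1) U)
include hU

/-- Passing to the limit in `U (L v_n) = -centre v_n`, with `v_n` tending to the identity, exhibits
`x - θ` as an eigenfunction. -/
theorem potential_ornsteinUhlenbeck :
    U (toL2 μ fun x => x - θ) = κ⁻¹ • toL2 μ fun x => x - θ := by
  have := hD.isProbabilityMeasure
  obtain ⟨v, w, htest, hv, hL, -⟩ := exists_testFunction_approx hpow κ ξ θ
  have h1 := (U.continuous.tendsto _).comp hL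
  have h2 := ((centre (toL2 μ fun _ => (1 : ℝ))).continuous.tendsto _).comp hv
  have h3 : ∀ n, U (toL2 μ (firstOrderOp (fun x => κ * (θ - x)) (fun _ => ξ) (w n)))
      = -centre (toL2 μ fun _ => 1) (toL2 μ (v n)) := fun n =>
    hD.isMixingSemigroup.potential_generator hU (hD.hasGenerator (htest n))
  have h4 := tendsto_nhds_unique (h1.congr h3) h2.neg
  rw [centre_ornsteinUhlenbeck hD hpow hκ, drift_ornsteinUhlenbeck hD hpow, map_neg, neg_inj,
    map_smul] at h4
  rw [eq_inv_smul_iff₀ hκ.ne', h4]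

/-- The stationary variance comes from the Dirichlet form: in the limit `⟨U L v_n, L v_n⟩` is `κ ‖x
- θ‖²` on one side and `ξ² / 2` on the other. -/
theorem norm_sq_ornsteinUhlenbeck : ‖toL2 μ fun x => x - θ‖ ^ 2 = ξ ^ 2 / (2 * κ) := by
  have := hD.isProbabilityMeasure
  obtain ⟨v, w, htest, -, hL, hw⟩ := exists_testFunction_approx hpow κ ξ θ
  have h1 := ((U.continuous.tendsto _).comp hL).inner (𝕜 := ℝ) hL
  have h2 := tendsto_nhds_unique
    (h1.congr fun n => hD.inner_potential_op hU (htest n) (htest n)) hw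
  rw [drift_ornsteinUhlenbeck hD hpow, map_neg, inner_neg_neg, map_smul,
    potential_ornsteinUhlenbeck hD hpow hκ hU, smul_inv_smul₀ hκ.ne', real_inner_smul_right,
    real_inner_self_eq_norm_sq] at h2
  rw [eq_div_iff (by positivity)]
  linarith

-- By density the claim reduces to `κ ∫ ½ ξ² w² dμ ≤ ∫ (L v)² dμ`, an integrated curvature
-- inequality in the manner of Bakry and Émery.
omit hpow in
theorem isSpectralGap_ornsteinUhlenbeck : IsSpectralGap (transitionOp P μ X) κ := by
  have := hD.isProbabilityMeasure
  refine hD.isMixingSemigroup.isSpectralGap_of_inner_le hU hκ fun x => ?_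
  refine hD.isMixingSemigroup.inner_le_of_dense hU hD.mem_closure_range (by positivity) ?_ x
  rintro _ ⟨v, w, h, rfl⟩
  set a : ℝ → ℝ := fun x => κ * (θ - x) with ha
  set b : ℝ → ℝ := fun _ => ξ with hb
  -- Adding `κ` times the operator at `W` costs nothing after integration. Pointwise the sum with
  -- `(L v)²` is exactly `½ κ ξ² w² + (½ ξ² w')²`, and the last square is dropped.
  set W : ℝ → ℝ := fun x => (x - θ) * w x ^ 2 with hW
  have hWd : ContDiff ℝ 1 W := (contDiff_id.sub contDiff_const).mul (h.contDiff.pow 2)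
  have hWs : tsupport W ⊆ tsupport w := closure_mono fun x hx => by
    intro h0
    exact hx (by simp [hW, h0])
  have hWc : HasCompactSupport W := h.compact.of_isClosed_subset (isClosed_tsupport _) hWs
  have h0 := hD.integral_op_eq_zero hWd hWc (subset_univ _)
  have hWi : Integrable (firstOrderOp a b W) μ := by
    obtain ⟨u, hu⟩ := exists_isTestFunction hWd hWc (subset_univ _)
    exact (hD.memLp_op hu).integrable one_le_two
  rw [hD.inner_potential_op hU h h, norm_toL2_sq (hD.memLp_op h), inv_mul_eq_div,
    le_div_iff₀ hκ, ← integral_mul_const]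
  have hLi := (hD.memLp_op h).integrable_sq
  have hpt : ∀ x, 1 / 2 * b x ^ 2 * (w x * w x) * κ
      ≤ firstOrderOp a b w x ^ 2 + κ * firstOrderOp a b W x := by
    intro x
    have hd : HasDerivAt W (w x ^ 2 + (x - θ) * (2 * w x * deriv w x)) x := by
      have h1 := ((h.contDiff.differentiable one_ne_zero) x).hasDerivAt
      have h2 := ((hasDerivAt_id x).sub_const θ).mul (h1.pow 2)
      refine (h2.congr_deriv ?_ : HasDerivAt W _ x)
      simp
    rw [firstOrderOp, firstOrderOp, hd.deriv, ha, hb, hW]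
    nlinarith [sq_nonneg (1 / 2 * ξ ^ 2 * deriv w x)]
  have hnn : ∀ x, 0 ≤ 1 / 2 * b x ^ 2 * (w x * w x) * κ := fun x => by
    have := mul_self_nonneg (w x)
    positivity
  have h1 := integral_mono_of_nonneg (.of_forall hnn) (hLi.add (hWi.const_mul κ)) (.of_forall hpt)
  rwa [integral_add' hLi (hWi.const_mul κ), integral_const_mul, h0, mul_zero, add_zero] at h1

/-- A larger gap would put `-κ` in the resolvent set, whereas `x - θ` is an eigenfunction for `-κ`,
nonzero because its norm is positive. -/
theorem le_of_isSpectralGap_ornsteinUhlenbeck (hξ : 0 < ξ) {lam : ℝ}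
    (hlam : IsSpectralGap (transitionOp P μ X) lam) : lam ≤ κ := by
  by_contra! hlt
  have hgen := hD.isMixingSemigroup.hasGenerator_potential hU (toL2 μ fun x => x - θ)
  have hinner : inner ℝ (toL2 μ fun _ => (1 : ℝ)) (toL2 μ fun x => x - θ) = 0 := by
    rw [← centre_ornsteinUhlenbeck hD hpow hκ]
    exact hD.isMixingSemigroup.inner_centre _
  rw [potential_ornsteinUhlenbeck hD hpow hκ hU, centre_of_inner_eq_zero hinner] at hgen
  have hres : -κ ∈ generatorResolventSet (transitionOp P μ X) := by
    by_contra hcon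
    rcases hlam.2 hcon with h | h
    · simp only [mem_Iic] at h
      linarith
    · simp only [mem_singleton_iff] at h
      linarith
  obtain ⟨R, -, hR⟩ := hres
  have h1 := hR _ _ hgen
  rw [smul_smul, neg_mul, mul_inv_cancel₀ hκ.ne', neg_one_smul, sub_self, map_zero] at h1
  have h2 := norm_sq_ornsteinUhlenbeck hD hpow hκ hU
  rcases smul_eq_zero.1 h1.symm with h | h
  · exact (inv_ne_zero hκ.ne') h
  · rw [h, norm_zero] at h2
    have : 0 < ξ ^ 2 / (2 * κ) := by positivity
    simp only [ne_eq, OfNat.ofNat_ne_zero, not_false_eq_true, zero_pow] at h2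
    linarith

end OrnsteinUhlenbeck

theorem polyGrowth_of_le {S : Set ℝ} {g : ℝ → ℝ} {D : ℝ} (hg : ∀ x ∈ S, |g x| ≤ D * (1 + |x|)) :
    PolyGrowth S g := by
  -- One number serves as both factor and exponent: it is at least `1`, so its power dominates `|x|`
  -- for `|x| ≥ 1`, and it exceeds `2 |D|`.
  refine ⟨2 * |D| + 1, by positivity, fun x hx => (hg x hx).trans ?_⟩
  have hD := abs_nonneg D
  have h1 : 1 + |x| ≤ 2 * (1 + |x| ^ (2 * |D| + 1)) := by
    have h0 : 0 ≤ |x| ^ (2 * |D| + 1) := by positivity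
    rcases le_total |x| 1 with hx1 | hx1
    · linarith
    · have := Real.rpow_le_rpow_of_exponent_le hx1 (by linarith : (1 : ℝ) ≤ 2 * |D| + 1)
      rw [Real.rpow_one] at this
      linarith
  have h2 : 0 ≤ 1 + |x| ^ (2 * |D| + 1) := by positivity
  calc D * (1 + |x|) ≤ |D| * (1 + |x|) := by
        gcongr
        exact le_abs_self D
    _ ≤ |D| * (2 * (1 + |x| ^ (2 * |D| + 1))) := by gcongr
    _ ≤ (2 * |D| + 1) * (1 + |x| ^ (2 * |D| + 1)) := by linarith

theorem cPoly_affine (S : Set ℝ) (c d : ℝ) : CPoly 2 S fun x => c * (x - d) := by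
  have h1 : deriv (fun x : ℝ => c * (x - d)) = fun _ => c := by
    ext x
    simp
  refine ⟨ContDiff.contDiffOn (by fun_prop), fun k hk => ?_⟩
  interval_cases k
  · rw [iteratedDeriv_zero]
    refine polyGrowth_of_le (D := |c| * (1 + |d|)) fun x _ => ?_
    rw [abs_mul, mul_assoc]
    gcongr
    nlinarith [abs_sub x d, abs_nonneg x, abs_nonneg d]
  · rw [iteratedDeriv_one, h1]
    refine polyGrowth_of_le (D := |c|) fun x _ => ?_
    nlinarith [abs_nonneg x, abs_nonneg c]
  · rw [iteratedDeriv_succ, iteratedDeriv_one, h1]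
    refine polyGrowth_of_le (D := 0) fun x _ => ?_
    simp

/-! ### The Ornstein–Uhlenbeck model: regularity, largest gap and equality in the bound. -/

namespace Model

variable {Ω : Type*} [MeasurableSpace Ω] {M : Model Ω}

section OrnsteinUhlenbeck

variable {κ ξ : ℝ} (hM : M.Regular) (hOU : M.IsOrnsteinUhlenbeck κ ξ)
include hM hOU

omit hM in
theorem IsOrnsteinUhlenbeck.state_eq : M.S = univ := by
  rw [S, hOU.1, hOU.2.1, openInterval_bot_top]

theorem IsOrnsteinUhlenbeck.isStationaryDiffusion {θ : ℝ} (hθ : θ ∈ M.Θ) :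
    IsStationaryDiffusion univ (fun x => κ * (θ - x)) (fun _ => ξ) (M.μ θ) (M.P θ : Measure Ω)
      M.ℱ M.X := by
  have h := hM.isStationaryDiffusion hθ
  have ha : (fun x => M.a x θ) = fun x => κ * (θ - x) := funext fun x => (hOU.2.2 θ hθ x).1
  have hb : (fun x => M.b x θ) = fun _ => ξ := funext fun x => (hOU.2.2 θ hθ x).2
  rwa [ha, hb, hOU.state_eq] at h

theorem IsOrnsteinUhlenbeck.mean_eq (hκ : 0 < κ) {θ : ℝ} (hθ : θ ∈ M.Θ) :
    M.mean (fun x => x) θ = θ :=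
  integral_ornsteinUhlenbeck (hOU.isStationaryDiffusion hM hθ) (hM.memLp_pow hθ) hκ

theorem IsOrnsteinUhlenbeck.centred_eq (hκ : 0 < κ) {θ : ℝ} (hθ : θ ∈ M.Θ) :
    M.centred (fun x => x) θ = fun x => x - θ := by
  ext x
  rw [centred, hOU.mean_eq hM hκ hθ]

/-- The mean is known to equal the parameter only on `Θ`, so the derivative is computed at interior
points. -/
theorem IsOrnsteinUhlenbeck.deriv_mean (hκ : 0 < κ) {θ : ℝ} (hθ : θ ∈ interior M.Θ) :
    deriv (M.mean fun x => x) θ = 1 := by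
  have h : (M.mean fun x => x) =ᶠ[𝓝 θ] fun y => y := by
    filter_upwards [mem_interior_iff_mem_nhds.1 hθ] with y hy
    exact hOU.mean_eq hM hκ hy
  rw [h.deriv_eq, deriv_id'']

theorem IsOrnsteinUhlenbeck.memLp_centred (hκ : 0 < κ) {θ : ℝ} (hθ : θ ∈ M.Θ) :
    MemLp (M.centred (fun x => x) θ) 2 (M.μ θ) := by
  rw [hOU.centred_eq hM hκ hθ]
  exact memLp_sub_const (hOU.isStationaryDiffusion hM hθ) (hM.memLp_pow hθ) θ

theorem IsOrnsteinUhlenbeck.mean_centred (hκ : 0 < κ) {θ : ℝ} (hθ : θ ∈ M.Θ) :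
    M.mean (M.centred (fun x => x) θ) θ = 0 := by
  have hD := hOU.isStationaryDiffusion hM hθ
  have := hD.isProbabilityMeasure
  have hx : MemLp (fun x : ℝ => x) 2 (M.μ θ) := by
    simpa using memLp_sub_const hD (hM.memLp_pow hθ) 0
  rw [hOU.centred_eq hM hκ hθ, mean, integral_sub (hx.integrable one_le_two) (integrable_const _),
    integral_ornsteinUhlenbeck hD (hM.memLp_pow hθ) hκ]
  simp

theorem IsOrnsteinUhlenbeck.predictorRegular (hκ : 0 < κ) {θ : ℝ} (hθ : θ ∈ M.Θ) :
    M.PredictorRegular (fun x => x) θ := by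
  obtain ⟨U, hU⟩ := hM.exists_isPotential hθ
  have hD := hOU.isStationaryDiffusion hM hθ
  have hf := hOU.memLp_centred hM hκ hθ
  have hf0 := hOU.mean_centred hM hκ hθ
  have hc := hOU.centred_eq hM hκ hθ
  refine ⟨⟨?_, hf0, fun x => κ⁻¹ * (x - θ), cPoly_affine _ _ _, ?_⟩, ?_⟩
  · rw [hc]
    simpa using cPoly_affine M.S 1 θ
  · rw [potential_eq hM hθ hf hf0 hU, hc]
    rw [hc] at hf
    have h1 : U (toL2 (M.μ θ) fun x => x - θ) = κ⁻¹ • toL2 (M.μ θ) fun x => x - θ :=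
      potential_ornsteinUhlenbeck hD (hM.memLp_pow hθ) hκ hU
    rw [h1]
    filter_upwards [Lp.coeFn_smul κ⁻¹ (toL2 (M.μ θ) fun x => x - θ), toL2_ae_eq hf] with x h2 h3
    rw [h2, Pi.smul_apply, h3, smul_eq_mul]
  · exact contDiffOn_id.congr fun θ' hθ' => hOU.mean_eq hM hκ hθ'

theorem IsOrnsteinUhlenbeck.isGreatest_gap (hκ : 0 < κ) (hξ : 0 < ξ) {θ : ℝ} (hθ : θ ∈ M.Θ) :
    IsGreatest {lam | IsSpectralGap (M.semigroup θ) lam} κ := by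
  obtain ⟨U, hU⟩ := hM.exists_isPotential hθ
  have hD := hOU.isStationaryDiffusion hM hθ
  exact ⟨isSpectralGap_ornsteinUhlenbeck hD hκ hU, fun lam hlam =>
    le_of_isSpectralGap_ornsteinUhlenbeck hD (hM.memLp_pow hθ) hκ hU hξ hlam⟩

theorem IsOrnsteinUhlenbeck.avar_eq (hκ : 0 < κ) {θ : ℝ} (hθ : θ ∈ interior M.Θ) :
    M.avar (fun x => x) θ = (ξ / κ) ^ 2 := by
  have hθ' := interior_subset hθ
  obtain ⟨U, hU⟩ := hM.exists_isPotential hθ'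
  have hD := hOU.isStationaryDiffusion hM hθ'
  have h1 : U (toL2 (M.μ θ) fun x => x - θ) = κ⁻¹ • toL2 (M.μ θ) fun x => x - θ :=
    potential_ornsteinUhlenbeck hD (hM.memLp_pow hθ') hκ hU
  rw [avar, hOU.deriv_mean hM hκ hθ, integral_mul_potential hM hθ' (hOU.memLp_centred hM hκ hθ')
    (hOU.mean_centred hM hκ hθ') hU, hOU.centred_eq hM hκ hθ', h1, real_inner_smul_right,
    real_inner_self_eq_norm_sq, norm_sq_ornsteinUhlenbeck hD (hM.memLp_pow hθ') hκ hU]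
  field_simp

theorem IsOrnsteinUhlenbeck.avarBound_eq (hκ : 0 < κ) {θ : ℝ} (hθ : θ ∈ interior M.Θ) :
    M.avarBound (fun x => x) θ κ = (ξ / κ) ^ 2 := by
  have hθ' := interior_subset hθ
  obtain ⟨U, hU⟩ := hM.exists_isPotential hθ'
  have hD := hOU.isStationaryDiffusion hM hθ'
  rw [avarBound, hOU.deriv_mean hM hκ hθ,
    variance_eq_norm_sq hM hθ' (hOU.memLp_centred hM hκ hθ'), hOU.centred_eq hM hκ hθ',
    norm_sq_ornsteinUhlenbeck hD (hM.memLp_pow hθ') hκ hU]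
  field_simp

end OrnsteinUhlenbeck

end Model

end Diffusion

end

/-! ### Assembly of the proposition. -/

theorem proposition5p1 {Ω : Type*} [MeasurableSpace Ω] (M : Diffusion.Model Ω) (hM : M.Regular)
    (θ₀ : ℝ) (hθ₀ : θ₀ ∈ interior M.Θ) :
    -- the generator under `P_{θ₀}` has a spectral gap, and the upper bound holds
    (∃ lam : ℝ, Diffusion.IsSpectralGap (M.semigroup θ₀) lam) ∧
    (∀ f : ℝ → ℝ, M.PredictorRegular f θ₀ → deriv (M.mean f) θ₀ ≠ 0 →
      M.PotentialConverges θ₀ (M.centred f θ₀) ∧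
      ∀ lam : ℝ, Diffusion.IsSpectralGap (M.semigroup θ₀) lam →
        M.avar f θ₀ ≤ M.avarBound f θ₀ lam ∧
        ∀ (Δ : ℕ → ℝ≥0) (est : ℕ → Ω → ℝ) (v : ℝ≥0), Diffusion.HighFrequency Δ →
          M.IsConsistentEstimator f θ₀ Δ est → M.IsAsymptoticVariance θ₀ Δ est v →
            (v : ℝ) ≤ M.avarBound f θ₀ lam) ∧
    -- the upper bound is attained for the mean of an Ornstein-Uhlenbeck process
    (∀ κ ξ : ℝ, 0 < κ → 0 < ξ → M.IsOrnsteinUhlenbeck κ ξ →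
      M.PredictorRegular (fun x => x) θ₀ ∧ deriv (M.mean fun x => x) θ₀ ≠ 0 ∧
      IsGreatest {lam | Diffusion.IsSpectralGap (M.semigroup θ₀) lam} κ ∧
      M.avar (fun x => x) θ₀ = M.avarBound (fun x => x) θ₀ κ ∧
      M.avar (fun x => x) θ₀ = (ξ / κ) ^ 2) := by

  have hθ := interior_subset hθ₀
  have hD := hM.isStationaryDiffusion hθ
  obtain ⟨U, hU⟩ := hM.exists_isPotential hθ
  refine ⟨hD.isMixingSemigroup.exists_isSpectralGap hU, fun f hf hd => ?_, fun κ ξ hκ hξ hOU => ?_⟩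
  · obtain ⟨⟨hcp, hf0, -⟩, hmc⟩ := hf
    have hfm := hM.memLp_of_cPoly hθ hcp
    refine ⟨Diffusion.Model.potentialConverges hM hθ hfm hf0, fun lam hlam => ?_⟩
    have hle := Diffusion.Model.avar_le_avarBound hM hθ hfm hf0 hlam
    refine ⟨hle, fun Δ est v hΔ hest hv => le_trans ?_ hle⟩
    exact Diffusion.Model.asymptoticVariance_le_avar hM hθ hfm hcp.continuousOn hf0
      hmc.continuousOn ((hmc.contDiffAt (mem_interior_iff_mem_nhds.1 hθ₀)).differentiableAt
      one_ne_zero) hd hΔ hest hv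
  · exact ⟨hOU.predictorRegular hM hκ hθ, by rw [hOU.deriv_mean hM hκ hθ₀]; exact one_ne_zero,
      hOU.isGreatest_gap hM hκ hξ hθ, by rw [hOU.avar_eq hM hκ hθ₀, hOU.avarBound_eq hM hκ hθ₀],
      hOU.avar_eq hM hκ hθ₀⟩
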